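/- Work on $\mathbb Z^2$ with $e_1=(1,0)$, $e_2=(0,1)$, $e_3=e_1-e_2$, $e_4=-e_1$, $e_5=-e_2$, $e_6=-e_3$, and the triangular-lattice Laplacian $\Delta_d u(x)=\sum_{j=1}^6u(x+e_j)-6u(x)$. Let $\mathring\Omega=\{x\in\mathbb Z^2: x_2>0\}$, $\Gamma=\{x\in\mathbb Z^2:x_2=0\}$, $\Omega=\mathring\Omega\cup\Gamma$. Let $k\in(0,3)\setminus\{2\sqrt2\}$. **Green's functions.** Put $\sigma(\xi;s)=s-6+2\cos\xi_1+2\cos\xi_2+2\cos(\xi_1-\xi_2)$ and $$\mathcal G(x)=\lim_{\varepsilon\downarrow0}\frac1{4\pi^2}\int_{-\pi}^{\pi}\int_{-\pi}^{\pi}\frac{e^{i x\cdot\xi}}{\sigma(\xi;k^2+i\varepsilon)}\,d\xi_2\,d\xi_1,\qquad \mathcal G(x;y)=\mathcal G(x-y),$$ and $\mathcal G^+(x;y)=\mathcal G(x;y)-\mathcal G(\hat x;y)$ with $\hat x=(x_1+x_2,-x_2)$. **Radiation condition.** Write $x\in\Omega\setminus\{0\}$ as $x=|x|(\cos\alpha,\sin\alpha)$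 with $|x|$ the Euclidean length and $0\le\alpha\le\pi$. Let $Q=(-\pi,\pi)^2$. For $k^2<8$ let $\xi^*(\alpha,k)$ be the unique point $\xi\in Q$ such that $\sigma(\xi;k^2)=0$ and $-\nabla_\xi\sigma(\xi;k^2)$ is a positive multiple of $(\cos\alpha,\sin\alpha)$. For $8<k^2<9$ let $\xi^{*,1}(\alpha,k)$ and $\xi^{*,2}(\alpha,k)$ be the unique such points in $Q\cap\{\xi_2<\xi_1\}$ and in $Q\cap\{\xi_1<\xi_2\}$, respectively. A function $w:\Omega\to\mathbb C$ *radiates* with $\xi^\bullet$ if, uniformly in $\alpha$, as $|x|\to\infty$ in $\Omega$, $$w(x)=O(|x|^{-1/2}),\qquad w(x+e_j)=e^{i\xi^\bullet_j(\alpha,k)}w(x)+O(|x|^{-3/2}),\quad j=1,2.$$ A function $u:\Omega\to\mathbb C$ satisfies the *radiation condition* if $u$ radiates with $\xi^*$ (when $k^2<8$), respectively if $u=u_1+u_2$ where $u_i$ radiates with $\xi^{*,i}$, $i=1,2$ (when $8<k^2<9$). **Boundary terms.** For $y\in\Gamma$ let $J(y)=\{j: y-e_j\in\mathring\Omega\}$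 $(=\{3,5\})$, and for $j\in J(y)$ let $T_jw(y)=w(y)-w(y-e_j)$; on $\mathcal G^+(x;y)$ the operator $T_j$ acts in $y$. Let $H_0=\{0\}$ and $H_{N+1}=\bigcup_{x\in H_N}\{x,x+e_1,\dots,x+e_6\}$. **Theorem.** Let $u:\Omega\to\mathbb C$ satisfy the radiation condition and let $u|_\Gamma$ have finite support. The limit defining $\mathcal G$ exists at every point of $\mathbb Z^2$, and for every $x\in\mathring\Omega$ $$u(x)=\sum_{y\in\Gamma}\ \sum_{j\in J(y)}\big(u(y)\,T_j\mathcal G^+(x;y)-\mathcal G^+(x;y)\,T_ju(y)\big)+\lim_{N\to\infty}\sum_{y\in\mathring\Omega\cap H_N}\mathcal G^+(x;y)\,(\Delta_d+k^2)u(y),$$ where the sum over $\Gamma$ is unconditionally convergent and the limit exists. In particular, if $(\Delta_d+k^2)u=0$ in $\mathring\Omega$, then $$u(x)=\sum_{y\in\Gamma}\ \sum_{j\in J(y)}u(y)\,T_j\mathcal G^+(x;y)\qquad(x\in\mathring\Omega).$$ -/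

import Mathlib

open Filter Topology

noncomputable section

namespace TriLattice

/-- The six lattice directions `e₁, …, e₆` (indexed from `0`): `e₁ = (1,0)`, `e₂ = (0,1)`,
`e₃ = e₁ - e₂`, `e₄ = -e₁`, `e₅ = -e₂`, `e₆ = -e₃`. -/
def dir : Fin 6 → ℤ × ℤ :=
  ![(1, 0), (0, 1), (1, -1), (-1, 0), (0, -1), (-1, 1)]

/-- The 7-point discrete Laplacian of the triangular lattice in the integer coordinates. -/
def laplacian (u : ℤ × ℤ → ℂ) (x : ℤ × ℤ) : ℂ :=
  (∑ j : Fin 6, u (x + dir j)) - 6 * u x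

/-- The discrete Helmholtz operator `Δ_d + k²`. -/
def helmholtz (k : ℝ) (u : ℤ × ℤ → ℂ) (x : ℤ × ℤ) : ℂ :=
  laplacian u x + (k : ℂ) ^ 2 * u x

/-- The interior points `ℤ × ℤ⁺` of the discrete half-plane. -/
def interiorPts : Set (ℤ × ℤ) := {x | 0 < x.2}

/-- The boundary `Γ` of the discrete half-plane. -/
def boundaryPts : Set (ℤ × ℤ) := {x | x.2 = 0}

/-- The discrete half-plane `Ω`, the union of its interior points and of `Γ`.
A function `Ω → ℂ` is represented by a function on `ℤ × ℤ` of which only the values on `Ω`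
are ever used. -/
def halfPlane : Set (ℤ × ℤ) := interiorPts ∪ boundaryPts

/-! ### The lattice Green's function -/

/-- The symbol `σ(ξ; s)` of `Δ_d + s`, for a complex spectral parameter `s` (in place of `k²`). -/
def symbol (s : ℂ) (ξ : ℝ × ℝ) : ℂ :=
  s - 6 + 2 * Real.cos ξ.1 + 2 * Real.cos ξ.2 + 2 * Real.cos (ξ.1 - ξ.2)

/-- The resolvent kernel at the spectral parameter `k² + iε`. -/
def resolventKernel (k ε : ℝ) (x : ℤ × ℤ) : ℂ :=
  1 / (4 * (Real.pi : ℂ) ^ 2) *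
    ∫ ξ₁ in (-Real.pi)..Real.pi, ∫ ξ₂ in (-Real.pi)..Real.pi,
      Complex.exp (Complex.I * ((x.1 : ℂ) * ξ₁ + (x.2 : ℂ) * ξ₂)) /
        symbol ((k : ℂ) ^ 2 + Complex.I * ε) (ξ₁, ξ₂)

/-- The lattice Green's function `𝒢(x)`: the pointwise limit of the resolvent kernels
at `k² + iε` as `ε ↓ 0`. -/
def green (k : ℝ) (x : ℤ × ℤ) : ℂ :=
  limUnder (𝓝[>] (0 : ℝ)) (fun ε => resolventKernel k ε x)

/-- The reflected point `x̂ = (x₁ + x₂, -x₂)`. -/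
def reflect (x : ℤ × ℤ) : ℤ × ℤ := (x.1 + x.2, -x.2)

/-- The Dirichlet Green's function of the half-plane, `𝒢⁺(x;y) = 𝒢(x;y) - 𝒢(x̂;y)`,
with `𝒢(x;y) = 𝒢(x - y)`. -/
def greenPlus (k : ℝ) (x y : ℤ × ℤ) : ℂ :=
  green k (x - y) - green k (reflect x - y)

/-! ### Boundary sides and normal derivatives -/

/-- The indices `j` of the sides of `Γ` on which the boundary point `y` lies:
those with `y - e_j` an interior point. -/
def sides (y : ℤ × ℤ) : Finset (Fin 6) :=
  Finset.univ.filter (fun j => 0 < (y - dir j).2)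

/-- The discrete derivative in the outward normal direction `e_j`:
`T w(y) = w(y) - w(y - e_j)` for `y` on the `j`-th side. -/
def normalDeriv (j : Fin 6) (w : ℤ × ℤ → ℂ) (y : ℤ × ℤ) : ℂ :=
  w y - w (y - dir j)

/-- The hexagonal balls: `H₀ = {0}`, and `H_{N+1}` is the union of the closed 7-point
neighbourhoods of the points of `H_N`. -/
def hexBall : ℕ → Finset (ℤ × ℤ)
  | 0 => {0}
  | N + 1 => (hexBall N).biUnion
      (fun x => insert x (Finset.univ.image (fun j : Fin 6 => x + dir j)))

/-! ### The radiation condition -/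

/-- The Euclidean length of `x` in the integer coordinates. -/
def absZ (x : ℤ × ℤ) : ℝ := Real.sqrt ((x.1 : ℝ) ^ 2 + (x.2 : ℝ) ^ 2)

/-- The (open) basic period cell of the symbol. -/
def cell : Set (ℝ × ℝ) := {ξ | |ξ.1| < Real.pi ∧ |ξ.2| < Real.pi}

/-- The half of the cell containing the first of the two closed curves that form the zero set
of the symbol if `8 < k² < 9`. -/
def cellLower : Set (ℝ × ℝ) := {ξ | ξ ∈ cell ∧ ξ.2 < ξ.1}

/-- The half of the cell containing the second of the two closed curves that form the zero set
of the symbol if `8 < k² < 9`. -/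
def cellUpper : Set (ℝ × ℝ) := {ξ | ξ ∈ cell ∧ ξ.1 < ξ.2}

/-- `ξ ∈ D` lies on the zero set of `σ(·; k²)`, and `-∇σ(ξ; k²)` is a positive multiple
of `(cos α, sin α)`. These are the points that contribute to the far field, in the
direction `α`, of the Green's function obtained as the limit from `k² + iε`, `ε > 0`. -/
def IsFarFieldPoint (k : ℝ) (D : Set (ℝ × ℝ)) (α : ℝ) (ξ : ℝ × ℝ) : Prop :=
  ξ ∈ D ∧ symbol ((k : ℂ) ^ 2) ξ = 0 ∧
    ∃ c : ℝ, 0 < c ∧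
      2 * Real.sin ξ.1 + 2 * Real.sin (ξ.1 - ξ.2) = c * Real.cos α ∧
      2 * Real.sin ξ.2 - 2 * Real.sin (ξ.1 - ξ.2) = c * Real.sin α

/-- The far-field point `ξ^*(α, k)` in `D`. The component of the zero set of the symbol in `D`
is a strictly convex closed curve if `D = cell` and `0 < k² < 8`, and if `D` is
`cellLower` or `cellUpper` and `8 < k² < 9`; the far-field point in `D` then exists and is
unique. -/
def farFieldPoint (k : ℝ) (D : Set (ℝ × ℝ)) (α : ℝ) : ℝ × ℝ :=
  Classical.epsilon (IsFarFieldPoint k D α)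

/-- The growth and phase conditions at infinity on the half-plane with far-field points in `D`:
`w(x) = O(|x|^{-1/2})` and `w(x + e_j) = exp(i ξ^*_j(α,k)) w(x) + O(|x|^{-3/2})`, `j = 1, 2`,
where `x = |x| (cos α, sin α)`, `0 ≤ α ≤ π`, uniformly in the direction. -/
def RadiatesIn (k : ℝ) (D : Set (ℝ × ℝ)) (w : ℤ × ℤ → ℂ) : Prop :=
  ∃ C : ℝ, ∀ x ∈ halfPlane, x ≠ 0 → ∀ α ∈ Set.Icc 0 Real.pi,
    (x.1 : ℝ) = absZ x * Real.cos α → (x.2 : ℝ) = absZ x * Real.sin α →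
    ‖w x‖ ≤ C * absZ x ^ (-(1 / 2) : ℝ) ∧
    ‖w (x + (1, 0)) - Complex.exp (Complex.I * ((farFieldPoint k D α).1 : ℂ)) * w x‖
      ≤ C * absZ x ^ (-(3 / 2) : ℝ) ∧
    ‖w (x + (0, 1)) - Complex.exp (Complex.I * ((farFieldPoint k D α).2 : ℂ)) * w x‖
      ≤ C * absZ x ^ (-(3 / 2) : ℝ)

/-- The radiation condition at infinity on the half-plane, for `0 < k² < 8` and for
`8 < k² < 9`. -/
def RadiationCondition (k : ℝ) (u : ℤ × ℤ → ℂ) : Prop :=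
  (k ^ 2 < 8 → RadiatesIn k cell u) ∧
  (8 < k ^ 2 → ∃ u₁ u₂ : ℤ × ℤ → ℂ, (∀ x ∈ halfPlane, u x = u₁ x + u₂ x) ∧
    RadiatesIn k cellLower u₁ ∧ RadiatesIn k cellUpper u₂)

end TriLattice

end

open TriLattice

/-!
The Dirichlet Green's function `greenPlus` represents every finitely supported function that
vanishes below the half-plane (`finsum_greenPlus_mul_helmholtz`). For a radiating `u`, extended by
zero, this is applied to the product with a smooth cut-off to a hexagon of size `N`. Two errors have
to vanish as `N` grows: the commutator of the Helmholtz operator with the cut-off, and the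
difference between the smooth and the sharp cut-off in the sum over the interior. The sources of the
extension on the row below `Γ` give, by reflection, the sum over `Γ` (`hasSum_boundary`). No
asymptotic expansion of the Green's function enters; square sums are enough.

*The Green's function.* For fixed `ξ₁` the symbol is a quadratic polynomial in `exp (i ξ₂)`, divided
by `exp (i ξ₂)`. For `ε > 0` one of its roots, `sliceRoot`, lies inside the unit disc, and the
integral over `ξ₂` is a power of it divided by the square root of the discriminant. The root and the
square root are continuous up to `ε = 0`, and the inverse square root of the discriminant is
integrable since its zeros, as a polynomial in `cos ξ₁`, are simple and different from `1` and `-1`;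
this is where `k² = 8` and `k² = 9` are excluded. Dominated convergence gives the limit
(`tendsto_resolventKernel`). The slice discriminant, viewed as a difference operator `discOp`, turns
the Green's function into one with bounded Fourier densities on the rows, whose square sums over
rows are bounded by Bessel's inequality. The same holds in the other coordinate direction, and the
Helmholtz operator maps the Green's function to a point mass. These three operators generate the
unit ideal of the ring of difference operators, hence the square sums of the Green's function itself
over boxes of size `R` are `O(R)` (`linearGrowth_green`). By Cauchy–Schwarz, a pairing with functions
of size `o(N ^ (-3/2))` on boxes of size `N` then tends to zero.

*The commutator.* It has size `N ^ (-3/2)` on a region of size `N`, so that Cauchy–Schwarz gives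
boundedness only; what remains is a gain of an arbitrarily small factor. Upwards, the Green's
function consists of powers of `sliceRoot`: if `a` is a difference operator in the direction of the
rows with symbol close to `sliceRoot`, then `(shift - a) discOp` nearly annihilates it
(`OutgoingKernel`). The radiating function is asymptotically multiplied by phase factors under
shifts, and the phases vary slowly, because the far-field points depend on the direction in a
Lipschitz way: the components of the zero set of the symbol are level sets of a strongly log-concave
product of three cosines (`WaveComponent.exists_lipschitz`). A difference operator therefore acts on
it as multiplication by the value of its symbol at the far-field point. At the far-field points of
upward directions the vertical phase factor is `sliceRoot` (`exp_eq_sliceRoot`), so that the transpose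
of `(shift - a) discOp`, in which `ξ` is reflected, acts there by a symbol that stays away from zero
off the boundary directions. Near the boundary the radiating function itself is smaller, as is seen
by summing its vertical differences up from `Γ`. Inverting the symbol by a slowly varying multiplier
and transposing the operator onto the Green's function makes the pairing small
(`Outgoing.pairing_tendsto`).

*The sharp cut-off.* The Helmholtz operator applied to `u` is `O(|x| ^ (-3/2))`, the symbol being zero
at the far-field points. The region between the hexagon of radius `N` and its enlargement by the
factor `1 + δ` has `O(δ N²)` points, and by Cauchy–Schwarz the sum over it is `O(√δ)`, uniformly
in `N` (`norm_sum_shell_le`).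

*Two components.* For `k² > 8` the two summands of `u` are treated separately. Only their sum is known
to have finite support on `Γ`, but their horizontal phase factors differ there, whence each of them is
`O(|x| ^ (-3/2))` on `Γ` (`exists_bound_component`), and this suffices for the argument above.
-/

namespace TriLattice

/-! ### Far-field points -/

lemma sub_le_tan_sub_tan {s t : ℝ} (hs : -(Real.pi / 2) < s) (hst : s ≤ t)
    (ht : t < Real.pi / 2) : t - s ≤ Real.tan t - Real.tan s := by
  rcases hst.eq_or_lt with rfl | hlt
  · simp
  obtain ⟨c, ⟨hc1, hc2⟩, hc⟩ := exists_hasDerivAt_eq_slope Real.tan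
    (fun x => 1 / Real.cos x ^ 2) hlt
    (fun x hx => (Real.hasDerivAt_tan (Real.cos_pos_of_mem_Ioo
      ⟨by linarith [hx.1], by linarith [hx.2]⟩).ne').continuousAt.continuousWithinAt)
    (fun x hx => Real.hasDerivAt_tan (Real.cos_pos_of_mem_Ioo
      ⟨by linarith [hx.1], by linarith [hx.2]⟩).ne')
  have hcos : 0 < Real.cos c := Real.cos_pos_of_mem_Ioo ⟨by linarith, by linarith⟩
  have h1 : 1 ≤ 1 / Real.cos c ^ 2 := by
    rw [le_div_iff₀ (by positivity)]
    nlinarith [Real.cos_le_one c]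
  rw [hc, le_div_iff₀ (by linarith)] at h1
  linarith

/-- The function `log ∘ cos` is strongly concave on `(-π/2, π/2)`: it lies below its tangents
by at least half the squared distance. -/
lemma log_cos_le {x y : ℝ} (hx : |x| < Real.pi / 2) (hy : |y| < Real.pi / 2) :
    Real.log (Real.cos y) ≤
      Real.log (Real.cos x) - Real.tan x * (y - x) - (y - x) ^ 2 / 2 := by
  rw [abs_lt] at hx hy
  have hd : ∀ t, -(Real.pi / 2) < t → t < Real.pi / 2 →
      HasDerivAt (fun t => Real.log (Real.cos t) + Real.tan x * (t - x) + (t - x) ^ 2 / 2)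
        (-Real.tan t + Real.tan x + (t - x)) t := by
    intro t h1 h2
    have hc : Real.cos t ≠ 0 := (Real.cos_pos_of_mem_Ioo ⟨h1, h2⟩).ne'
    have e1 := (Real.hasDerivAt_cos t).log hc
    have e2 := ((hasDerivAt_id t).sub_const x).const_mul (Real.tan x)
    have e3 := (((hasDerivAt_id t).sub_const x).pow 2).div_const 2
    refine HasDerivAt.congr_deriv ((e1.add e2).add e3) ?_
    rw [Real.tan_eq_sin_div_cos t]
    simp; ring
  rcases lt_trichotomy x y with h | h | h
  · obtain ⟨c, ⟨hc1, hc2⟩, hc⟩ := exists_hasDerivAt_eq_slope _ _ h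
      (fun t ht => (hd t (by linarith [ht.1]) (by linarith [ht.2])).continuousAt.continuousWithinAt)
      (fun t ht => hd t (by linarith [ht.1]) (by linarith [ht.2]))
    have := sub_le_tan_sub_tan hx.1 hc1.le (by linarith)
    rw [eq_div_iff (by linarith)] at hc
    have h2 : (-Real.tan c + Real.tan x + (c - x)) * (y - x) ≤ 0 :=
      mul_nonpos_of_nonpos_of_nonneg (by linarith) (by linarith)
    simp at hc
    linarith
  · subst h; simp
  · obtain ⟨c, ⟨hc1, hc2⟩, hc⟩ := exists_hasDerivAt_eq_slope _ _ h
      (fun t ht => (hd t (by linarith [ht.1]) (by linarith [ht.2])).continuousAt.continuousWithinAt)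
      (fun t ht => hd t (by linarith [ht.1]) (by linarith [ht.2]))
    have := sub_le_tan_sub_tan (by linarith) hc2.le hx.2
    rw [eq_div_iff (by linarith)] at hc
    have h2 : 0 ≤ (-Real.tan c + Real.tan x + (c - x)) * (x - y) :=
      mul_nonneg (by linarith) (by linarith)
    simp at hc
    linarith

/-- The symbol in product form: with `γ = 1 - k²/8` its zero set is
`cos (ξ₁/2) cos (ξ₂/2) cos ((ξ₁-ξ₂)/2) = γ`. -/
lemma symbol_eq_zero_iff (k : ℝ) (ξ : ℝ × ℝ) :
    symbol ((k : ℂ) ^ 2) ξ = 0 ↔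
      Real.cos (ξ.1 / 2) * Real.cos (ξ.2 / 2) * Real.cos ((ξ.1 - ξ.2) / 2) = 1 - k ^ 2 / 8 := by
  have h : symbol ((k : ℂ) ^ 2) ξ =
      ((k ^ 2 - 6 + 2 * Real.cos ξ.1 + 2 * Real.cos ξ.2 + 2 * Real.cos (ξ.1 - ξ.2) : ℝ) : ℂ) := by
    simp [symbol]
  rw [h, Complex.ofReal_eq_zero]
  have h1 : Real.cos ξ.1 = 2 * Real.cos (ξ.1 / 2) ^ 2 - 1 := by
    rw [← Real.cos_two_mul]; ring_nf
  have h2 : Real.cos ξ.2 = 2 * Real.cos (ξ.2 / 2) ^ 2 - 1 := by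
    rw [← Real.cos_two_mul]; ring_nf
  have h3 : Real.cos (ξ.1 - ξ.2) = 2 * Real.cos ((ξ.1 - ξ.2) / 2) ^ 2 - 1 := by
    rw [← Real.cos_two_mul]; ring_nf
  have h4 : Real.cos ((ξ.1 - ξ.2) / 2) = Real.cos (ξ.1 / 2) * Real.cos (ξ.2 / 2)
      + Real.sin (ξ.1 / 2) * Real.sin (ξ.2 / 2) := by
    rw [← Real.cos_sub]; ring_nf
  have s1 := Real.sin_sq_add_cos_sq (ξ.1 / 2)
  have s2 := Real.sin_sq_add_cos_sq (ξ.2 / 2)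
  rw [h1, h2, h3, h4]
  generalize Real.cos (ξ.1 / 2) = a at *
  generalize Real.cos (ξ.2 / 2) = b at *
  generalize Real.sin (ξ.1 / 2) = c at *
  generalize Real.sin (ξ.2 / 2) = d at *
  have hc : c ^ 2 = 1 - a ^ 2 := by linarith
  have hd : d ^ 2 = 1 - b ^ 2 := by linarith
  have e : (a * b + c * d) ^ 2 = 2 * a * b * (a * b + c * d) + 1 - a ^ 2 - b ^ 2 := by
    have : c ^ 2 * d ^ 2 = (1 - a ^ 2) * (1 - b ^ 2) := by rw [hc, hd]
    linear_combination this
  rw [e]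
  constructor <;> intro h <;> linarith

/-- `WaveComponent k D κ` says that `D` is the part of the cell around one component of the zero
set of the symbol. On this component the three angles `ξ₁/2`, `ξ₂/2`, `(ξ₁-ξ₂)/2 + κ`
lie in `(-π/2, π/2)`. -/
def WaveComponent (k : ℝ) (D : Set (ℝ × ℝ)) (κ : ℝ) : Prop :=
  0 < k ^ 2 ∧ ((k ^ 2 < 8 ∧ D = cell ∧ κ = 0) ∨
    (8 < k ^ 2 ∧ k ^ 2 < 9 ∧ ((D = cellLower ∧ κ = -Real.pi) ∨ (D = cellUpper ∧ κ = Real.pi))))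

/-- The third angle, shifted into `(-π/2, π/2)`. -/
noncomputable def thirdAngle (κ : ℝ) (ξ : ℝ × ℝ) : ℝ := (ξ.1 - ξ.2) / 2 + κ

/-- The product of the cosines of the three angles. -/
noncomputable def cosProd (κ : ℝ) (ξ : ℝ × ℝ) : ℝ :=
  Real.cos (ξ.1 / 2) * Real.cos (ξ.2 / 2) * Real.cos (thirdAngle κ ξ)

/-- The open hexagon on which the three angles are in `(-π/2, π/2)`. -/
def hexagon (κ : ℝ) : Set (ℝ × ℝ) :=
  {ξ | |ξ.1 / 2| < Real.pi / 2 ∧ |ξ.2 / 2| < Real.pi / 2 ∧ |thirdAngle κ ξ| < Real.pi / 2}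

lemma WaveComponent.cos_sq {k : ℝ} {D : Set (ℝ × ℝ)} {κ : ℝ} (h : WaveComponent k D κ) :
    Real.sin κ = 0 ∧ (Real.cos κ) ^ 2 = 1 ∧ 0 < Real.cos κ * (1 - k ^ 2 / 8) := by
  rcases h with ⟨_, ⟨h1, -, rfl⟩ | ⟨h1, _, ⟨-, rfl⟩ | ⟨-, rfl⟩⟩⟩
  · simp; linarith
  · simp; linarith
  · simp; linarith

lemma WaveComponent.cos_thirdAngle {k : ℝ} {D : Set (ℝ × ℝ)} {κ : ℝ} (h : WaveComponent k D κ)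
    (ξ : ℝ × ℝ) : Real.cos (thirdAngle κ ξ) = Real.cos κ * Real.cos ((ξ.1 - ξ.2) / 2) := by
  rw [thirdAngle, Real.cos_add, h.cos_sq.1]; ring

lemma WaveComponent.sin_thirdAngle {k : ℝ} {D : Set (ℝ × ℝ)} {κ : ℝ} (h : WaveComponent k D κ)
    (ξ : ℝ × ℝ) : Real.sin (thirdAngle κ ξ) = Real.cos κ * Real.sin ((ξ.1 - ξ.2) / 2) := by
  rw [thirdAngle, Real.sin_add, h.cos_sq.1]; ring

lemma WaveComponent.symbol_iff {k : ℝ} {D : Set (ℝ × ℝ)} {κ : ℝ} (h : WaveComponent k D κ)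
    (ξ : ℝ × ℝ) : symbol ((k : ℂ) ^ 2) ξ = 0 ↔ cosProd κ ξ = Real.cos κ * (1 - k ^ 2 / 8) := by
  rw [symbol_eq_zero_iff, cosProd, h.cos_thirdAngle]
  have := h.cos_sq.2.1
  constructor
  · intro e
    rw [← e]; ring
  · intro e
    linear_combination Real.cos κ * e + (1 - k ^ 2 / 8 - Real.cos (ξ.1 / 2) * Real.cos (ξ.2 / 2) *
      Real.cos ((ξ.1 - ξ.2) / 2)) * this

lemma WaveComponent.hexagon_subset {k : ℝ} {D : Set (ℝ × ℝ)} {κ : ℝ} (h : WaveComponent k D κ) :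
    hexagon κ ⊆ D := by
  rintro ξ ⟨h1, h2, h3⟩
  have hc : ξ ∈ cell := by
    constructor
    · rw [abs_div, abs_two] at h1; linarith
    · rw [abs_div, abs_two] at h2; linarith
  have hpi := Real.pi_pos
  rw [thirdAngle, abs_lt] at h3
  rcases h with ⟨_, ⟨_, rfl, rfl⟩ | ⟨_, _, ⟨rfl, rfl⟩ | ⟨rfl, rfl⟩⟩⟩
  · exact hc
  · exact ⟨hc, by linarith [h3.1]⟩
  · exact ⟨hc, by linarith [h3.2]⟩

lemma WaveComponent.subset_cell {k : ℝ} {D : Set (ℝ × ℝ)} {κ : ℝ} (h : WaveComponent k D κ) :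
    D ⊆ cell := by
  rcases h with ⟨_, ⟨_, rfl, rfl⟩ | ⟨_, _, ⟨rfl, rfl⟩ | ⟨rfl, rfl⟩⟩⟩
  · exact subset_rfl
  · exact fun ξ h => h.1
  · exact fun ξ h => h.1

/-- On the zero set of the symbol in `D`, the product of the three cosines is positive and the first two
are, hence so is the third; together with `|a₃| < π` this confines the third angle `a₃` to
`(-π/2, π/2)`. -/
lemma WaveComponent.mem_hexagon {k : ℝ} {D : Set (ℝ × ℝ)} {κ : ℝ} (h : WaveComponent k D κ)
    {ξ : ℝ × ℝ} (hξ : ξ ∈ D) (hs : symbol ((k : ℂ) ^ 2) ξ = 0) : ξ ∈ hexagon κ := by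
  obtain ⟨c1, c2⟩ := h.subset_cell hξ
  have hpi := Real.pi_pos
  have a1 : |ξ.1 / 2| < Real.pi / 2 := by rw [abs_div, abs_two]; linarith
  have a2 : |ξ.2 / 2| < Real.pi / 2 := by rw [abs_div, abs_two]; linarith
  refine ⟨a1, a2, ?_⟩
  rw [h.symbol_iff, cosProd] at hs
  rw [abs_lt] at a1 a2
  have p1 := Real.cos_pos_of_mem_Ioo a1
  have p2 := Real.cos_pos_of_mem_Ioo a2
  have p3 : 0 < Real.cos (thirdAngle κ ξ) := by
    have := h.cos_sq.2.2
    rw [← hs] at this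
    exact (pos_iff_pos_of_mul_pos this).1 (mul_pos p1 p2)
  have hb : |thirdAngle κ ξ| < Real.pi := by
    rw [abs_lt, thirdAngle]
    rcases h with ⟨_, ⟨_, rfl, rfl⟩ | ⟨_, _, ⟨rfl, rfl⟩ | ⟨rfl, rfl⟩⟩⟩
    · constructor <;> linarith [a1.1, a1.2, a2.1, a2.2]
    · have := hξ.2
      constructor <;> linarith [a1.1, a1.2, a2.1, a2.2]
    · have := hξ.2
      constructor <;> linarith [a1.1, a1.2, a2.1, a2.2]
  by_contra hcon
  rw [not_lt] at hcon
  rw [← Real.cos_abs] at p3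
  exact absurd p3 (not_lt.2 (Real.cos_nonpos_of_pi_div_two_le_of_le hcon (by linarith)))

/-- On the zero set of the symbol, `-∇σ` in terms of the tangents of the three angles. -/
lemma WaveComponent.neg_grad {k : ℝ} {D : Set (ℝ × ℝ)} {κ : ℝ} (h : WaveComponent k D κ)
    {ξ : ℝ × ℝ} (hξ : ξ ∈ hexagon κ) (hs : cosProd κ ξ = Real.cos κ * (1 - k ^ 2 / 8)) :
    2 * Real.sin ξ.1 + 2 * Real.sin (ξ.1 - ξ.2) =
      4 * (1 - k ^ 2 / 8) * (Real.tan (ξ.1 / 2) + Real.tan (thirdAngle κ ξ)) ∧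
    2 * Real.sin ξ.2 - 2 * Real.sin (ξ.1 - ξ.2) =
      4 * (1 - k ^ 2 / 8) * (Real.tan (ξ.2 / 2) - Real.tan (thirdAngle κ ξ)) := by
  obtain ⟨a1, a2, a3⟩ := hξ
  rw [abs_lt] at a1 a2 a3
  have p1 := Real.cos_pos_of_mem_Ioo a1
  have p2 := Real.cos_pos_of_mem_Ioo a2
  have p3 := Real.cos_pos_of_mem_Ioo a3
  have hk := h.cos_sq.2.1
  have hg : 1 - k ^ 2 / 8 = Real.cos κ * cosProd κ ξ := by
    rw [hs]; linear_combination (-(1 - k ^ 2 / 8)) * hk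
  have e1 : Real.sin ξ.1 = 2 * Real.sin (ξ.1 / 2) * Real.cos (ξ.1 / 2) := by
    rw [← Real.sin_two_mul]; ring_nf
  have e2 : Real.sin ξ.2 = 2 * Real.sin (ξ.2 / 2) * Real.cos (ξ.2 / 2) := by
    rw [← Real.sin_two_mul]; ring_nf
  have e3 : Real.sin (ξ.1 - ξ.2) = 2 * Real.sin (thirdAngle κ ξ) * Real.cos (thirdAngle κ ξ) := by
    rw [h.cos_thirdAngle, h.sin_thirdAngle]
    have : Real.sin (ξ.1 - ξ.2) = 2 * Real.sin ((ξ.1 - ξ.2) / 2) * Real.cos ((ξ.1 - ξ.2) / 2) := by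
      rw [← Real.sin_two_mul]; ring_nf
    rw [this]
    linear_combination (-2 * Real.sin ((ξ.1 - ξ.2) / 2) * Real.cos ((ξ.1 - ξ.2) / 2)) * hk
  -- the three angles satisfy `a₃ = a₁ - a₂ + κ`, and `κ` is a multiple of `π`
  have r3 : Real.cos κ * Real.cos (thirdAngle κ ξ) = Real.cos (ξ.1 / 2) * Real.cos (ξ.2 / 2)
      + Real.sin (ξ.1 / 2) * Real.sin (ξ.2 / 2) := by
    have : Real.cos ((ξ.1 - ξ.2) / 2) = Real.cos (ξ.1 / 2) * Real.cos (ξ.2 / 2)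
      + Real.sin (ξ.1 / 2) * Real.sin (ξ.2 / 2) := by rw [← Real.cos_sub]; ring_nf
    rw [h.cos_thirdAngle, ← this]
    linear_combination (Real.cos ((ξ.1 - ξ.2) / 2)) * hk
  have r3' : Real.cos κ * Real.sin (thirdAngle κ ξ) = Real.sin (ξ.1 / 2) * Real.cos (ξ.2 / 2)
      - Real.cos (ξ.1 / 2) * Real.sin (ξ.2 / 2) := by
    have : Real.sin ((ξ.1 - ξ.2) / 2) = Real.sin (ξ.1 / 2) * Real.cos (ξ.2 / 2)
      - Real.cos (ξ.1 / 2) * Real.sin (ξ.2 / 2) := by rw [← Real.sin_sub]; ring_nf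
    rw [h.sin_thirdAngle, ← this]
    linear_combination (Real.sin ((ξ.1 - ξ.2) / 2)) * hk
  have s1 := Real.sin_sq_add_cos_sq (ξ.1 / 2)
  have s2 := Real.sin_sq_add_cos_sq (ξ.2 / 2)
  rw [hg, cosProd, Real.tan_eq_sin_div_cos, Real.tan_eq_sin_div_cos, Real.tan_eq_sin_div_cos,
    e1, e2, e3]
  generalize Real.cos (ξ.1 / 2) = a at *
  generalize Real.cos (ξ.2 / 2) = b at *
  generalize Real.sin (ξ.1 / 2) = c at *
  generalize Real.sin (ξ.2 / 2) = d at *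
  generalize Real.cos (thirdAngle κ ξ) = C at *
  generalize Real.sin (thirdAngle κ ξ) = S at *
  generalize Real.cos κ = s at *
  have hC : C = s * (a * b + c * d) := by rw [← r3]; linear_combination (-C) * hk
  have hS : S = s * (c * b - a * d) := by rw [← r3']; linear_combination (-S) * hk
  constructor
  · have : 4 * (s * (a * b * C)) * (c / a + S / C) = 4 * s * b * (c * C + a * S) := by
      field_simp
    rw [this]
    have h4 : b * s * (c * C + a * S) = b * (2 * a * b * c + (c ^ 2 - a ^ 2) * d) := by
      rw [hC, hS]; linear_combination (b * (2 * a * b * c + (c ^ 2 - a ^ 2) * d)) * hk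
    have h5 : S * C = (a * b + c * d) * (c * b - a * d) := by
      rw [hC, hS]; linear_combination ((a * b + c * d) * (c * b - a * d)) * hk
    linear_combination 4 * h5 - 4 * h4 - 4 * a * c * s2 + 0 * s1
  · have : 4 * (s * (a * b * C)) * (d / b - S / C) = 4 * s * a * (d * C - b * S) := by
      field_simp
    rw [this]
    have h4 : a * s * (d * C - b * S) = a * (2 * a * b * d + (d ^ 2 - b ^ 2) * c) := by
      rw [hC, hS]; linear_combination (a * (2 * a * b * d + (d ^ 2 - b ^ 2) * c)) * hk
    have h5 : S * C = (a * b + c * d) * (c * b - a * d) := by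
      rw [hC, hS]; linear_combination ((a * b + c * d) * (c * b - a * d)) * hk
    linear_combination -4 * h5 - 4 * h4 - 4 * b * d * s1

/-- The logarithm of `cosProd` is strongly concave on the hexagon. -/
lemma log_cosProd_le {κ : ℝ} {ξ η : ℝ × ℝ} (hξ : ξ ∈ hexagon κ) (hη : η ∈ hexagon κ) :
    Real.log (cosProd κ η) ≤ Real.log (cosProd κ ξ)
      - ((Real.tan (ξ.1 / 2) + Real.tan (thirdAngle κ ξ)) * (η.1 - ξ.1)
        + (Real.tan (ξ.2 / 2) - Real.tan (thirdAngle κ ξ)) * (η.2 - ξ.2)) / 2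
      - ((η.1 - ξ.1) ^ 2 + (η.2 - ξ.2) ^ 2) / 8 := by
  have hpos : ∀ {ζ : ℝ × ℝ}, ζ ∈ hexagon κ → Real.log (cosProd κ ζ) =
      Real.log (Real.cos (ζ.1 / 2)) + Real.log (Real.cos (ζ.2 / 2))
        + Real.log (Real.cos (thirdAngle κ ζ)) := by
    rintro ζ ⟨a1, a2, a3⟩
    rw [abs_lt] at a1 a2 a3
    have p1 := Real.cos_pos_of_mem_Ioo a1
    have p2 := Real.cos_pos_of_mem_Ioo a2
    have p3 := Real.cos_pos_of_mem_Ioo a3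
    rw [cosProd, Real.log_mul (by positivity) (by positivity), Real.log_mul (by positivity)
      (by positivity)]
  rw [hpos hξ, hpos hη]
  have l1 := log_cos_le hξ.1 hη.1
  have l2 := log_cos_le hξ.2.1 hη.2.1
  have l3 := log_cos_le hξ.2.2 hη.2.2
  have e : thirdAngle κ η - thirdAngle κ ξ = ((η.1 - ξ.1) - (η.2 - ξ.2)) / 2 := by
    simp only [thirdAngle]; ring
  rw [e] at l3
  nlinarith [sq_nonneg ((η.1 - ξ.1) - (η.2 - ξ.2))]

/-- The centre of a component: the maximum of `cosProd`. -/
noncomputable def waveCentre (κ : ℝ) : ℝ × ℝ := (-(2 / 3) * κ, 2 / 3 * κ)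

lemma WaveComponent.centre {k : ℝ} {D : Set (ℝ × ℝ)} {κ : ℝ} (h : WaveComponent k D κ) :
    waveCentre κ ∈ hexagon κ ∧
      Real.cos κ * (1 - k ^ 2 / 8) < cosProd κ (waveCentre κ) := by
  have hpi := Real.pi_pos
  have e1 : (waveCentre κ).1 / 2 = -(κ / 3) := by simp only [waveCentre]; ring
  have e2 : (waveCentre κ).2 / 2 = κ / 3 := by simp only [waveCentre]; ring
  have e3 : thirdAngle κ (waveCentre κ) = κ / 3 := by simp only [waveCentre, thirdAngle]; ring
  simp only [hexagon, Set.mem_ofPred_eq, cosProd, e1, e2, e3, Real.cos_neg, abs_neg, and_self]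
  rcases h with ⟨h0, ⟨h1, -, rfl⟩ | ⟨h1, h9, ⟨-, rfl⟩ | ⟨-, rfl⟩⟩⟩
  · constructor
    · simp; positivity
    · simp; linarith
  · have : -Real.pi / 3 = -(Real.pi / 3) := by ring
    rw [this, abs_neg, Real.cos_neg, Real.cos_neg, Real.cos_pi_div_three, abs_of_pos (by positivity),
      Real.cos_pi]
    constructor <;> linarith
  · rw [Real.cos_pi_div_three, abs_of_pos (by positivity), Real.cos_pi]
    constructor <;> linarith

/-- The tangent inequality for `log cosProd` at a point of the zero set whose `-∇σ` is
`c (cos α, sin α)`. -/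
lemma WaveComponent.farField_tan {k : ℝ} {D : Set (ℝ × ℝ)} {κ : ℝ} (h : WaveComponent k D κ)
    {α : ℝ} {ξ : ℝ × ℝ} {c : ℝ} (hD : ξ ∈ D) (hs : symbol ((k : ℂ) ^ 2) ξ = 0)
    (h1 : 2 * Real.sin ξ.1 + 2 * Real.sin (ξ.1 - ξ.2) = c * Real.cos α)
    (h2 : 2 * Real.sin ξ.2 - 2 * Real.sin (ξ.1 - ξ.2) = c * Real.sin α) {η : ℝ × ℝ}
    (hη : η ∈ hexagon κ) :
    Real.log (cosProd κ η) ≤ Real.log (Real.cos κ * (1 - k ^ 2 / 8))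
      - c / (8 * (1 - k ^ 2 / 8)) *
        (Real.cos α * (η.1 - ξ.1) + Real.sin α * (η.2 - ξ.2))
      - ((η.1 - ξ.1) ^ 2 + (η.2 - ξ.2) ^ 2) / 8 := by
  have hm := h.mem_hexagon hD hs
  rw [h.symbol_iff] at hs
  obtain ⟨g1, g2⟩ := h.neg_grad hm hs
  have hγ : 1 - k ^ 2 / 8 ≠ 0 := fun h0 => by
    have := h.cos_sq.2.2
    rw [h0] at this; simp at this
  have := log_cosProd_le hm hη
  rw [hs] at this
  rw [h1] at g1
  rw [h2] at g2
  generalize 1 - k ^ 2 / 8 = γ at *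
  have e1 : Real.tan (ξ.1 / 2) + Real.tan (thirdAngle κ ξ) =
      c / (8 * γ) * Real.cos α * 2 := by
    field_simp; linarith
  have e2 : Real.tan (ξ.2 / 2) - Real.tan (thirdAngle κ ξ) =
      c / (8 * γ) * Real.sin α * 2 := by
    field_simp; linarith
  rw [e1, e2] at this
  linarith

/-- The gradient of the symbol is bounded below on its zero set. -/
lemma WaveComponent.exists_le_grad {k : ℝ} {D : Set (ℝ × ℝ)} {κ : ℝ} (h : WaveComponent k D κ) :
    ∃ c₀ : ℝ, 0 < c₀ ∧ ∀ (α : ℝ) (ξ : ℝ × ℝ) (c : ℝ), ξ ∈ D → symbol ((k : ℂ) ^ 2) ξ = 0 →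
      0 ≤ c → 2 * Real.sin ξ.1 + 2 * Real.sin (ξ.1 - ξ.2) = c * Real.cos α →
      2 * Real.sin ξ.2 - 2 * Real.sin (ξ.1 - ξ.2) = c * Real.sin α → c₀ ≤ c := by
  obtain ⟨hc, hlt⟩ := h.centre
  obtain ⟨-, hk2, hpos⟩ := h.cos_sq
  set γ := 1 - k ^ 2 / 8 with hγ
  set m := Real.log (cosProd κ (waveCentre κ)) - Real.log (Real.cos κ * γ) with hm
  have hm0 : 0 < m := sub_pos.2 (Real.log_lt_log hpos hlt)
  have hγ0 : γ ≠ 0 := fun h0 => by rw [h0] at hpos; simp at hpos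
  have hpi := Real.pi_pos
  refine ⟨m * (8 * |γ|) / (4 * Real.pi), by positivity, ?_⟩
  intro α ξ c hD hs hc0 h1 h2
  have key := h.farField_tan hD hs h1 h2 hc
  have hξ := h.mem_hexagon hD hs
  have b1 : |(waveCentre κ).1 - ξ.1| ≤ 2 * Real.pi := by
    have a := hc.1; have b := hξ.1
    rw [abs_lt] at a b
    rw [abs_le]; constructor <;> linarith [a.1, a.2, b.1, b.2]
  have b2 : |(waveCentre κ).2 - ξ.2| ≤ 2 * Real.pi := by
    have a := hc.2.1; have b := hξ.2.1
    rw [abs_lt] at a b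
    rw [abs_le]; constructor <;> linarith [a.1, a.2, b.1, b.2]
  have b3 : |Real.cos α * ((waveCentre κ).1 - ξ.1) + Real.sin α * ((waveCentre κ).2 - ξ.2)|
      ≤ 4 * Real.pi := by
    refine (abs_add_le _ _).trans ?_
    rw [abs_mul, abs_mul]
    have := mul_le_mul (Real.abs_cos_le_one α) b1 (abs_nonneg _) zero_le_one
    have := mul_le_mul (Real.abs_sin_le_one α) b2 (abs_nonneg _) zero_le_one
    linarith
  have b4 : |c / (8 * γ) * (Real.cos α * ((waveCentre κ).1 - ξ.1)
      + Real.sin α * ((waveCentre κ).2 - ξ.2))| ≤ c / (8 * |γ|) * (4 * Real.pi) := by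
    rw [abs_mul, abs_div, abs_mul, abs_of_nonneg hc0, abs_of_pos (by norm_num : (0:ℝ) < 8)]
    exact mul_le_mul_of_nonneg_left b3 (by positivity)
  -- compare the values of `log cosProd` at the centre and on the zero set
  have b5 : m ≤ c / (8 * |γ|) * (4 * Real.pi) := by
    refine le_trans ?_ b4
    refine le_trans ?_ (neg_le_abs _)
    rw [hm]
    nlinarith [sq_nonneg ((waveCentre κ).1 - ξ.1), sq_nonneg ((waveCentre κ).2 - ξ.2)]
  have hg : 0 < |γ| := abs_pos.2 hγ0
  rw [div_le_iff₀ (by positivity)]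
  rw [div_mul_eq_mul_div, le_div_iff₀ (by positivity)] at b5
  exact b5

lemma grad_le_eight {α c : ℝ} {ξ : ℝ × ℝ}
    (h1 : 2 * Real.sin ξ.1 + 2 * Real.sin (ξ.1 - ξ.2) = c * Real.cos α)
    (h2 : 2 * Real.sin ξ.2 - 2 * Real.sin (ξ.1 - ξ.2) = c * Real.sin α) : c ≤ 8 := by
  have b1 : (c * Real.cos α) ^ 2 ≤ 16 := by
    rw [← h1]
    nlinarith [Real.sin_le_one ξ.1, Real.neg_one_le_sin ξ.1, Real.sin_le_one (ξ.1 - ξ.2),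
      Real.neg_one_le_sin (ξ.1 - ξ.2)]
  have b2 : (c * Real.sin α) ^ 2 ≤ 16 := by
    rw [← h2]
    nlinarith [Real.sin_le_one ξ.2, Real.neg_one_le_sin ξ.2, Real.sin_le_one (ξ.1 - ξ.2),
      Real.neg_one_le_sin (ξ.1 - ξ.2)]
  have b3 : c ^ 2 = (c * Real.cos α) ^ 2 + (c * Real.sin α) ^ 2 := by
    linear_combination (-c ^ 2) * Real.sin_sq_add_cos_sq α
  nlinarith

/-- Far-field points are unique and depend on the direction in a Lipschitz way, since the
components of the zero set are strongly convex. -/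
lemma WaveComponent.exists_lipschitz {k : ℝ} {D : Set (ℝ × ℝ)} {κ : ℝ}
    (h : WaveComponent k D κ) :
    ∃ C : ℝ, 0 < C ∧ ∀ (α β : ℝ) (ξ η : ℝ × ℝ), IsFarFieldPoint k D α ξ →
      IsFarFieldPoint k D β η → ∀ δ : ℝ, |Real.cos α - Real.cos β| ≤ δ →
        |Real.sin α - Real.sin β| ≤ δ → |ξ.1 - η.1| ≤ C * δ ∧ |ξ.2 - η.2| ≤ C * δ := by
  obtain ⟨-, hk2, hpos⟩ := h.cos_sq
  set γ := 1 - k ^ 2 / 8 with hγ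
  have hγ0 : γ ≠ 0 := fun h0 => by rw [h0] at hpos; simp at hpos
  have hg : 0 < |γ| := abs_pos.2 hγ0
  refine ⟨16 / |γ|, by positivity, ?_⟩
  rintro α β ξ η ⟨hξD, hξs, c, hc, hc1, hc2⟩ ⟨hηD, hηs, d, hd, hd1, hd2⟩ δ hδ1 hδ2
  have k1 := h.farField_tan hξD hξs hc1 hc2 (h.mem_hexagon hηD hηs)
  have k2 := h.farField_tan hηD hηs hd1 hd2 (h.mem_hexagon hξD hξs)
  rw [(h.symbol_iff _).1 hηs] at k1
  rw [(h.symbol_iff _).1 hξs] at k2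
  rw [← hγ] at k1 k2
  have c8 := grad_le_eight hc1 hc2
  have d8 := grad_le_eight hd1 hd2
  set x := ξ.1 - η.1 with hx
  set y := ξ.2 - η.2 with hy
  set A := (Real.cos α * x + Real.sin α * y) / γ with hA
  set B := (Real.cos β * x + Real.sin β * y) / γ with hB
  -- the tangent inequalities at `ξ` and at `η`, each evaluated at the other point
  have e1 : (x ^ 2 + y ^ 2) ≤ c * A := by
    have : c / (8 * γ) * (Real.cos α * (η.1 - ξ.1) + Real.sin α * (η.2 - ξ.2)) = - (c * A) / 8 := by
      rw [hA, hx, hy]; field_simp; ring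
    rw [this] at k1
    have e : (η.1 - ξ.1) ^ 2 + (η.2 - ξ.2) ^ 2 = x ^ 2 + y ^ 2 := by rw [hx, hy]; ring
    rw [e] at k1
    linarith
  have e2 : (x ^ 2 + y ^ 2) ≤ -(d * B) := by
    have : d / (8 * γ) * (Real.cos β * (ξ.1 - η.1) + Real.sin β * (ξ.2 - η.2)) = (d * B) / 8 := by
      rw [hB, hx, hy]; field_simp
    rw [this] at k2
    linarith
  have hn : 0 ≤ x ^ 2 + y ^ 2 := by positivity
  have f1 : (x ^ 2 + y ^ 2) / 8 ≤ A := by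
    have : 0 ≤ A := nonneg_of_mul_nonneg_right (hn.trans e1) hc
    have := mul_le_mul_of_nonneg_right c8 this
    linarith
  have f2 : (x ^ 2 + y ^ 2) / 8 ≤ -B := by
    have : 0 ≤ -B := nonneg_of_mul_nonneg_right (by linarith : 0 ≤ d * (-B)) hd
    have := mul_le_mul_of_nonneg_right d8 this
    linarith
  have f3 : A - B ≤ δ * (|x| + |y|) / |γ| := by
    have : A - B = ((Real.cos α - Real.cos β) * x + (Real.sin α - Real.sin β) * y) / γ := by
      rw [hA, hB]; ring
    rw [this]
    refine (le_abs_self _).trans ?_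
    rw [abs_div]
    gcongr
    refine (abs_add_le _ _).trans ?_
    rw [abs_mul, abs_mul, mul_add]
    gcongr
  have f4 : (x ^ 2 + y ^ 2) / 4 ≤ δ * (|x| + |y|) / |γ| := by linarith
  rw [le_div_iff₀ hg] at f4
  have f5 : (|x| + |y|) ^ 2 ≤ 2 * (x ^ 2 + y ^ 2) := by
    rw [← sq_abs x, ← sq_abs y]
    linarith [sq_nonneg (|x| - |y|), add_sq |x| |y|, sub_sq |x| |y|]
  have f6 : |x| + |y| ≤ 16 / |γ| * δ := by
    rcases (add_nonneg (abs_nonneg x) (abs_nonneg y)).eq_or_lt with h0 | h0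
    · rw [← h0]
      have : 0 ≤ δ := (abs_nonneg _).trans hδ1
      positivity
    · rw [div_mul_eq_mul_div, le_div_iff₀ hg]
      have : (|x| + |y|) * ((|x| + |y|) * |γ|) ≤ (|x| + |y|) * (8 * δ) := by
        have := mul_le_mul_of_nonneg_right f5 hg.le
        linarith
      have := le_of_mul_le_mul_left this h0
      have : 0 ≤ δ := (abs_nonneg _).trans hδ1
      linarith
  constructor <;> linarith [abs_nonneg x, abs_nonneg y]

lemma hasStrictFDerivAt_cosProd (κ : ℝ) (ξ : ℝ × ℝ) :
    ∃ L : ℝ × ℝ →L[ℝ] ℝ, HasStrictFDerivAt (cosProd κ) L ξ := by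
  have : ContDiff ℝ 1 (cosProd κ) := by
    unfold cosProd thirdAngle
    fun_prop
  exact ⟨_, this.contDiffAt.hasStrictFDerivAt (by simp)⟩

/-- The derivative of `cosProd` in terms of the tangents of the three angles. -/
lemma hasFDerivAt_cosProd {κ : ℝ} {ξ : ℝ × ℝ} (hξ : ξ ∈ hexagon κ) {L : ℝ × ℝ →L[ℝ] ℝ}
    (hL : HasFDerivAt (cosProd κ) L ξ) :
    ∀ v : ℝ × ℝ, L v = -(cosProd κ ξ / 2) * ((Real.tan (ξ.1 / 2) + Real.tan (thirdAngle κ ξ)) * v.1 +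
      (Real.tan (ξ.2 / 2) - Real.tan (thirdAngle κ ξ)) * v.2) := by
  intro v
  obtain ⟨a1, a2, a3⟩ := hξ
  rw [abs_lt] at a1 a2 a3
  have p1 := (Real.cos_pos_of_mem_Ioo a1).ne'
  have p2 := (Real.cos_pos_of_mem_Ioo a2).ne'
  have p3 := (Real.cos_pos_of_mem_Ioo a3).ne'
  have h0 : HasDerivAt (fun t : ℝ => ξ + t • v) v 0 := by
    simpa using ((hasDerivAt_id (0 : ℝ)).smul_const v).const_add ξ
  have h1 : HasDerivAt (fun t : ℝ => cosProd κ (ξ + t • v)) (L v) 0 := by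
    have : HasFDerivAt (cosProd κ) L (ξ + (0 : ℝ) • v) := by simpa using hL
    exact this.comp_hasDerivAt 0 h0
  have d1 : HasDerivAt (fun t : ℝ => (ξ.1 + t * v.1) / 2) (v.1 / 2) 0 := by
    simpa using (((hasDerivAt_id (0 : ℝ)).mul_const v.1).const_add ξ.1).div_const 2
  have d2 : HasDerivAt (fun t : ℝ => (ξ.2 + t * v.2) / 2) (v.2 / 2) 0 := by
    simpa using (((hasDerivAt_id (0 : ℝ)).mul_const v.2).const_add ξ.2).div_const 2
  have d3 : HasDerivAt (fun t : ℝ => ((ξ.1 + t * v.1) - (ξ.2 + t * v.2)) / 2 + κ)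
      ((v.1 - v.2) / 2) 0 := by
    have := ((((hasDerivAt_id (0 : ℝ)).mul_const v.1).const_add ξ.1).sub
      (((hasDerivAt_id (0 : ℝ)).mul_const v.2).const_add ξ.2)).div_const 2
    simpa using this.add_const κ
  have h2 := (d1.cos.mul d2.cos).mul d3.cos
  have h3 := h1.unique (h2.congr_of_eventuallyEq (Filter.Eventually.of_forall fun t => by
    simp [cosProd, thirdAngle]))
  rw [h3]
  simp only [zero_mul, add_zero]
  simp only [Pi.mul_apply, zero_mul, add_zero, cosProd, Real.tan_eq_sin_div_cos]
  change _ = _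
  have e : (ξ.1 - ξ.2) / 2 + κ = thirdAngle κ ξ := rfl
  rw [e]
  field_simp
  ring

lemma isOpen_hexagon (κ : ℝ) : IsOpen (hexagon κ) := by
  have c1 : IsOpen {ξ : ℝ × ℝ | |ξ.1 / 2| < Real.pi / 2} :=
    isOpen_lt (by fun_prop) (by fun_prop)
  have c2 : IsOpen {ξ : ℝ × ℝ | |ξ.2 / 2| < Real.pi / 2} :=
    isOpen_lt (by fun_prop) (by fun_prop)
  have c3 : IsOpen {ξ : ℝ × ℝ | |thirdAngle κ ξ| < Real.pi / 2} :=
    isOpen_lt (by unfold thirdAngle; fun_prop) (by fun_prop)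
  exact c1.inter (c2.inter c3)

/-- The far-field points exist: the extremal point of the component in a given direction is one,
by Lagrange multipliers. -/
lemma WaveComponent.exists_isFarFieldPoint {k : ℝ} {D : Set (ℝ × ℝ)} {κ : ℝ}
    (h : WaveComponent k D κ) (α : ℝ) : ∃ ξ, IsFarFieldPoint k D α ξ := by
  obtain ⟨hcH, hclt⟩ := h.centre
  obtain ⟨-, hk2, hpos⟩ := h.cos_sq
  set γ := 1 - k ^ 2 / 8 with hγ
  set s := Real.cos κ with hs
  -- the linear functional whose maximum is sought
  let ℓ : ℝ × ℝ →L[ℝ] ℝ := (s * Real.cos α) • ContinuousLinearMap.fst ℝ ℝ ℝ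
    + (s * Real.sin α) • ContinuousLinearMap.snd ℝ ℝ ℝ
  have hℓ : ∀ v : ℝ × ℝ, ℓ v = s * (Real.cos α * v.1 + Real.sin α * v.2) := by
    intro v; simp [ℓ]; ring
  have hℓ0 : ℓ (s * Real.cos α, s * Real.sin α) = 1 := by
    rw [hℓ]
    linear_combination (s ^ 2) * Real.sin_sq_add_cos_sq α + hk2
  -- the solid component, closed up by its bounding hexagon
  let K : Set (ℝ × ℝ) := {ξ | |ξ.1 / 2| ≤ Real.pi / 2 ∧ |ξ.2 / 2| ≤ Real.pi / 2 ∧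
    |thirdAngle κ ξ| ≤ Real.pi / 2 ∧ s * γ ≤ cosProd κ ξ}
  have hKc : IsClosed K := by
    have c1 : IsClosed {ξ : ℝ × ℝ | |ξ.1 / 2| ≤ Real.pi / 2} :=
      isClosed_le (by fun_prop) (by fun_prop)
    have c2 : IsClosed {ξ : ℝ × ℝ | |ξ.2 / 2| ≤ Real.pi / 2} :=
      isClosed_le (by fun_prop) (by fun_prop)
    have c3 : IsClosed {ξ : ℝ × ℝ | |thirdAngle κ ξ| ≤ Real.pi / 2} :=
      isClosed_le (by unfold thirdAngle; fun_prop) (by fun_prop)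
    have c4 : IsClosed {ξ : ℝ × ℝ | s * γ ≤ cosProd κ ξ} :=
      isClosed_le (by fun_prop) (by unfold cosProd thirdAngle; fun_prop)
    exact c1.inter (c2.inter (c3.inter c4))
  have hKb : IsCompact K := by
    refine (isCompact_Icc (a := ((-Real.pi, -Real.pi) : ℝ × ℝ)) (b := (Real.pi, Real.pi))).of_isClosed_subset
      hKc ?_
    rintro ξ ⟨h1, h2, -⟩
    rw [abs_le] at h1 h2
    exact ⟨⟨by linarith [h1.1], by linarith [h2.1]⟩, ⟨by linarith [h1.2], by linarith [h2.2]⟩⟩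
  have hcK : waveCentre κ ∈ K := ⟨hcH.1.le, hcH.2.1.le, hcH.2.2.le, hclt.le⟩
  obtain ⟨ξ, hξK, hmax⟩ := hKb.exists_isMaxOn ⟨_, hcK⟩ ℓ.continuous.continuousOn
  -- `cosProd` vanishes on the boundary of the hexagon, so that only its level set bounds `K`
  have hξH : ξ ∈ hexagon κ := by
    obtain ⟨h1, h2, h3, h4⟩ := hξK
    have hne : cosProd κ ξ ≠ 0 := (hpos.trans_le h4).ne'
    have aux : ∀ x : ℝ, |x| ≤ Real.pi / 2 → Real.cos x ≠ 0 → |x| < Real.pi / 2 := by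
      intro x hx hc
      refine lt_of_le_of_ne hx fun e => hc ?_
      rw [← Real.cos_abs, e, Real.cos_pi_div_two]
    simp only [cosProd, ne_eq, mul_eq_zero, not_or] at hne
    exact ⟨aux _ h1 hne.1.1, aux _ h2 hne.1.2, aux _ h3 hne.2⟩
  have hnhds : hexagon κ ∈ 𝓝 ξ := (isOpen_hexagon κ).mem_nhds hξH
  obtain ⟨L, hL⟩ := hasStrictFDerivAt_cosProd κ ξ
  have hLv := hasFDerivAt_cosProd hξH hL.hasFDerivAt
  have hcont : Continuous (cosProd κ) := by unfold cosProd thirdAngle; fun_prop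
  -- a nonzero linear functional has no local maximum in the interior
  have hlev : cosProd κ ξ = s * γ := by
    refine le_antisymm ?_ hξK.2.2.2
    by_contra hlt
    rw [not_le] at hlt
    have hloc : IsLocalMax ℓ ξ := by
      have : {η | s * γ < cosProd κ η} ∈ 𝓝 ξ := (isOpen_lt continuous_const hcont).mem_nhds hlt
      filter_upwards [hnhds, this] with η h1 h2
      exact hmax ⟨h1.1.le, h1.2.1.le, h1.2.2.le, le_of_lt h2⟩
    have := hloc.hasFDerivAt_eq_zero ℓ.hasFDerivAt
    rw [this] at hℓ0
    simp at hℓ0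
  have hext : IsLocalExtrOn ℓ {η | cosProd κ η = cosProd κ ξ} ξ := by
    refine Or.inr ?_
    filter_upwards [mem_nhdsWithin_of_mem_nhds hnhds, self_mem_nhdsWithin] with η h1 h2
    refine hmax ⟨h1.1.le, h1.2.1.le, h1.2.2.le, ?_⟩
    rw [← hlev]
    exact (show cosProd κ η = cosProd κ ξ from h2).ge
  obtain ⟨a, b, hab, hlag⟩ := hext.exists_multipliers_of_hasStrictFDerivAt_1d hL
    ℓ.hasStrictFDerivAt
  have hlag' : ∀ v, a * L v + b * ℓ v = 0 := fun v => by
    simpa using congrArg (fun T : ℝ × ℝ →L[ℝ] ℝ => T v) hlag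
  -- the derivative towards the centre is positive
  have hLc : 0 < L (waveCentre κ - ξ) := by
    have hcon := log_cosProd_le hξH hcH
    have := Real.log_lt_log hpos hclt
    rw [hlev] at hcon
    rw [hLv, hlev]
    simp only [Prod.fst_sub, Prod.snd_sub]
    nlinarith [sq_nonneg ((waveCentre κ).1 - ξ.1), sq_nonneg ((waveCentre κ).2 - ξ.2)]
  have hℓc : ℓ (waveCentre κ - ξ) ≤ 0 := by
    rw [map_sub, sub_nonpos]; exact hmax hcK
  have ha : a ≠ 0 := by
    rintro rfl
    have := hlag' (s * Real.cos α, s * Real.sin α)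
    rw [hℓ0] at this
    simp at this
    exact hab (by simp [this])
  have hb : b ≠ 0 := by
    rintro rfl
    have := hlag' (waveCentre κ - ξ)
    rw [zero_mul, add_zero] at this
    exact hLc.ne' ((mul_eq_zero.1 this).resolve_left ha)
  -- `L = -t ℓ` with `t > 0`
  obtain ⟨t, ht⟩ : ∃ t, t = b / a := ⟨_, rfl⟩
  have hLt : ∀ v, L v = -(t * ℓ v) := fun v => by
    have := hlag' v
    rw [ht]; field_simp; linarith
  have htpos : 0 < t := by
    have h1 := hLt (waveCentre κ - ξ)
    have h2 : t ≠ 0 := by rw [ht]; exact div_ne_zero hb ha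
    by_contra hcon
    have h3 : t ≤ 0 := not_lt.1 hcon
    nlinarith [mul_nonneg_of_nonpos_of_nonpos h3 hℓc]
  obtain ⟨g1, g2⟩ := h.neg_grad hξH hlev
  have hg1 : γ * (Real.tan (ξ.1 / 2) + Real.tan (thirdAngle κ ξ)) = 2 * t * Real.cos α := by
    have := hLt (1, 0)
    rw [hLv, hℓ, hlev] at this
    simp only [mul_one, mul_zero, add_zero] at this
    linear_combination (-2 * s) * this - (γ * (Real.tan (ξ.1 / 2) + Real.tan (thirdAngle κ ξ))
      - 2 * t * Real.cos α) * hk2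
  have hg2 : γ * (Real.tan (ξ.2 / 2) - Real.tan (thirdAngle κ ξ)) = 2 * t * Real.sin α := by
    have := hLt (0, 1)
    rw [hLv, hℓ, hlev] at this
    simp only [mul_one, mul_zero, zero_add] at this
    linear_combination (-2 * s) * this - (γ * (Real.tan (ξ.2 / 2) - Real.tan (thirdAngle κ ξ))
      - 2 * t * Real.sin α) * hk2
  refine ⟨ξ, h.hexagon_subset hξH, (h.symbol_iff ξ).2 hlev, 8 * t, by positivity, ?_, ?_⟩
  · rw [g1]; linear_combination 4 * hg1
  · rw [g2]; linear_combination 4 * hg2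

lemma WaveComponent.isFarFieldPoint {k : ℝ} {D : Set (ℝ × ℝ)} {κ : ℝ}
    (h : WaveComponent k D κ) (α : ℝ) : IsFarFieldPoint k D α (farFieldPoint k D α) :=
  Classical.epsilon_spec (h.exists_isFarFieldPoint α)

/-! ### The root of the symbol on a slice -/

/-- The square root with values in the closed first quadrant, for arguments in the closed upper
half-plane; it is continuous up to the real axis. -/
noncomputable def upperSqrt (z : ℂ) : ℂ :=
  (Real.sqrt ((‖z‖ + z.re) / 2) : ℂ) + Real.sqrt ((‖z‖ - z.re) / 2) * Complex.I

lemma continuous_upperSqrt : Continuous upperSqrt := by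
  unfold upperSqrt
  have h1 : Continuous fun z : ℂ => Real.sqrt ((‖z‖ + z.re) / 2) :=
    Real.continuous_sqrt.comp ((continuous_norm.add Complex.continuous_re).div_const 2)
  have h2 : Continuous fun z : ℂ => Real.sqrt ((‖z‖ - z.re) / 2) :=
    Real.continuous_sqrt.comp ((continuous_norm.sub Complex.continuous_re).div_const 2)
  exact (Complex.continuous_ofReal.comp h1).add
    ((Complex.continuous_ofReal.comp h2).mul continuous_const)

lemma upperSqrt_sq {z : ℂ} (hz : 0 ≤ z.im) : upperSqrt z ^ 2 = z := by
  have h1 : 0 ≤ (‖z‖ + z.re) / 2 := by linarith [neg_abs_le z.re, Complex.abs_re_le_norm z]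
  have h2 : 0 ≤ (‖z‖ - z.re) / 2 := by linarith [le_abs_self z.re, Complex.abs_re_le_norm z]
  have e1 := Real.sq_sqrt h1
  have e2 := Real.sq_sqrt h2
  have e3 : Real.sqrt ((‖z‖ + z.re) / 2) * Real.sqrt ((‖z‖ - z.re) / 2) = z.im / 2 := by
    rw [← Real.sqrt_mul h1, show (‖z‖ + z.re) / 2 * ((‖z‖ - z.re) / 2) = (z.im / 2) ^ 2 by
      have := Complex.sq_norm_sub_sq_re z
      linarith, Real.sqrt_sq (by linarith)]
  rw [upperSqrt]
  generalize Real.sqrt ((‖z‖ + z.re) / 2) = a at *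
  generalize Real.sqrt ((‖z‖ - z.re) / 2) = b at *
  apply Complex.ext
  · simp [pow_two]; nlinarith
  · simp [pow_two]; linarith

lemma upperSqrt_re_nonneg (z : ℂ) : 0 ≤ (upperSqrt z).re := by
  simp only [upperSqrt, Complex.add_re, Complex.ofReal_re, Complex.re_ofReal_mul, Complex.I_re,
    mul_zero, add_zero]
  positivity

lemma upperSqrt_im_nonneg (z : ℂ) : 0 ≤ (upperSqrt z).im := by
  simp only [upperSqrt, Complex.add_im, Complex.ofReal_im, Complex.im_ofReal_mul, Complex.I_im,
    mul_one, zero_add]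
  positivity

/-- With `b = 6 - k²` and `z = exp (i ξ₂)` the symbol at `k² + iε` and `ξ₁ = θ` is
`-A + (1 + exp (-iθ)) z + (1 + exp (iθ)) / z`, where `A = b - 2 cos θ - iε`. -/
noncomputable def sliceA (b ε θ : ℝ) : ℂ := ((b - 2 * Real.cos θ : ℝ) : ℂ) - Complex.I * ε

/-- The square of this number is `4 |1 + exp (iθ)|²`. -/
noncomputable def sliceRadius (θ : ℝ) : ℝ := Real.sqrt (8 + 8 * Real.cos θ)

/-- The square root of the discriminant of the symbol as a quadratic polynomial in
`exp (i ξ₂)`, on the branch that tends to the outgoing one as `ε ↓ 0`. -/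
noncomputable def sliceW (b ε θ : ℝ) : ℂ :=
  upperSqrt (((sliceRadius θ - (b - 2 * Real.cos θ) : ℝ) : ℂ) + ε * Complex.I) *
    (starRingEnd ℂ) (upperSqrt (((sliceRadius θ + (b - 2 * Real.cos θ) : ℝ) : ℂ) + ε * Complex.I))

/-- The root `exp (i ξ₂)` of the symbol on the slice `ξ₁ = θ` that lies inside the unit disc
if `ε > 0`. -/
noncomputable def sliceRoot (b ε θ : ℝ) : ℂ :=
  2 * (1 + Complex.exp (Complex.I * θ)) / (sliceA b ε θ - Complex.I * sliceW b ε θ)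

/-- The discriminant at `ε = 0`. -/
noncomputable def sliceDisc (b θ : ℝ) : ℝ := 8 + 8 * Real.cos θ - (b - 2 * Real.cos θ) ^ 2

lemma sliceRadius_sq (θ : ℝ) : sliceRadius θ ^ 2 = 8 + 8 * Real.cos θ :=
  Real.sq_sqrt (by linarith [Real.neg_one_le_cos θ])

lemma norm_one_add_exp_sq (θ : ℝ) :
    ‖2 * (1 + Complex.exp (Complex.I * θ))‖ ^ 2 = sliceRadius θ ^ 2 := by
  rw [sliceRadius_sq, ← Complex.normSq_eq_norm_sq, mul_comm Complex.I, Complex.normSq_apply]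
  have h1 : (2 * (1 + Complex.exp (θ * Complex.I))).re = 2 * (1 + Real.cos θ) := by
    simp [Complex.exp_ofReal_mul_I_re]
  have h2 : (2 * (1 + Complex.exp (θ * Complex.I))).im = 2 * Real.sin θ := by
    simp [Complex.exp_ofReal_mul_I_im]
  rw [h1, h2]
  nlinarith [Real.sin_sq_add_cos_sq θ]

lemma sliceA_re (b ε θ : ℝ) : (sliceA b ε θ).re = b - 2 * Real.cos θ := by
  rw [sliceA, Complex.sub_re, Complex.ofReal_re]; simp

lemma sliceA_im (b ε θ : ℝ) : (sliceA b ε θ).im = -ε := by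
  rw [sliceA, Complex.sub_im, Complex.ofReal_im]; simp

lemma sliceW_sq {ε : ℝ} (hε : 0 ≤ ε) (b θ : ℝ) :
    sliceW b ε θ ^ 2 = (sliceRadius θ : ℂ) ^ 2 - sliceA b ε θ ^ 2 := by
  rw [sliceW, mul_pow, ← map_pow, upperSqrt_sq (by simpa using hε), upperSqrt_sq (by simpa using hε),
    sliceA]
  simp only [map_add, map_mul, Complex.conj_ofReal, Complex.conj_I]
  push_cast
  linear_combination (-(ε : ℂ) ^ 2) * Complex.I_sq + ε ^ 2 * Complex.I_sq

lemma sliceW_re_nonneg (b ε θ : ℝ) : 0 ≤ (sliceW b ε θ).re := by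
  rw [sliceW, Complex.mul_re, Complex.conj_re, Complex.conj_im]
  have := mul_nonneg (upperSqrt_re_nonneg
    (((sliceRadius θ - (b - 2 * Real.cos θ) : ℝ) : ℂ) + ε * Complex.I)) (upperSqrt_re_nonneg
    (((sliceRadius θ + (b - 2 * Real.cos θ) : ℝ) : ℂ) + ε * Complex.I))
  have := mul_nonneg (upperSqrt_im_nonneg
    (((sliceRadius θ - (b - 2 * Real.cos θ) : ℝ) : ℂ) + ε * Complex.I)) (upperSqrt_im_nonneg
    (((sliceRadius θ + (b - 2 * Real.cos θ) : ℝ) : ℂ) + ε * Complex.I))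
  linarith

lemma continuous_sliceRadius : Continuous sliceRadius := by
  unfold sliceRadius; fun_prop

lemma continuous_sliceA (b : ℝ) : Continuous fun p : ℝ × ℝ => sliceA b p.1 p.2 := by
  unfold sliceA; fun_prop

lemma continuous_sliceW (b : ℝ) : Continuous fun p : ℝ × ℝ => sliceW b p.1 p.2 := by
  have h := continuous_upperSqrt
  have hr := continuous_sliceRadius
  unfold sliceW
  fun_prop

lemma norm_sq_sub_norm_sq (A w : ℂ) :
    ‖A - Complex.I * w‖ ^ 2 - ‖A + Complex.I * w‖ ^ 2 =
      4 * (A.re * w.im - A.im * w.re) := by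
  rw [← Complex.normSq_eq_norm_sq, ← Complex.normSq_eq_norm_sq, Complex.normSq_apply,
    Complex.normSq_apply]
  simp
  ring

/-- For `ε > 0` the two roots have different moduli; the branch of `sliceW` is the one for which
`sliceRoot` is the smaller root. -/
lemma norm_lt_norm_of_pos {ε : ℝ} (hε : 0 < ε) (b θ : ℝ) :
    ‖sliceA b ε θ + Complex.I * sliceW b ε θ‖ < ‖sliceA b ε θ - Complex.I * sliceW b ε θ‖ := by
  have hsq := sliceW_sq hε.le b θ
  have hre := sliceW_re_nonneg b ε θ
  have hAre := sliceA_re b ε θ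
  have hAim := sliceA_im b ε θ
  have e1 := congrArg Complex.re hsq
  have e2 := congrArg Complex.im hsq
  simp only [pow_two, Complex.mul_re, Complex.mul_im, Complex.sub_re, Complex.sub_im,
    Complex.ofReal_re, Complex.ofReal_im, hAre, hAim] at e1 e2
  have key := norm_sq_sub_norm_sq (sliceA b ε θ) (sliceW b ε θ)
  rw [hAre, hAim] at key
  generalize (sliceW b ε θ).re = x at *
  generalize (sliceW b ε θ).im = y at *
  generalize b - 2 * Real.cos θ = a at *
  have hx : 0 < x := by
    refine lt_of_le_of_ne hre fun h0 => ?_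
    subst h0
    have ha : a = 0 := by
      have : ε * a = 0 := by linarith
      exact (mul_eq_zero.1 this).resolve_left hε.ne'
    subst ha
    nlinarith [sq_nonneg (sliceRadius θ), sq_nonneg y, mul_pos hε hε]
  have hay : 0 ≤ a * y := by
    have : ε * (a * y) = x * y ^ 2 := by linear_combination (-y / 2) * e2
    have h2 : 0 ≤ ε * (a * y) := by rw [this]; positivity
    exact nonneg_of_mul_nonneg_right h2 hε
  have h3 : 0 < ε * x := mul_pos hε hx
  refine lt_of_pow_lt_pow_left₀ 2 (norm_nonneg _) ?_
  linarith

lemma norm_le_norm_of_nonneg {ε : ℝ} (hε : 0 ≤ ε) (b θ : ℝ) :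
    ‖sliceA b ε θ + Complex.I * sliceW b ε θ‖ ≤ ‖sliceA b ε θ - Complex.I * sliceW b ε θ‖ := by
  -- at `ε = 0` by continuity
  rcases hε.eq_or_lt with rfl | h
  · have hA : Continuous fun ε : ℝ => sliceA b ε θ :=
      Continuous.comp (g := fun p : ℝ × ℝ => sliceA b p.1 p.2) (f := fun ε => (ε, θ))
        (continuous_sliceA b) (by fun_prop)
    have hW : Continuous fun ε : ℝ => sliceW b ε θ :=
      Continuous.comp (g := fun p : ℝ × ℝ => sliceW b p.1 p.2) (f := fun ε => (ε, θ))
        (continuous_sliceW b) (by fun_prop)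
    have c1 : Continuous fun ε : ℝ => ‖sliceA b ε θ + Complex.I * sliceW b ε θ‖ := by fun_prop
    have c2 : Continuous fun ε : ℝ => ‖sliceA b ε θ - Complex.I * sliceW b ε θ‖ := by fun_prop
    refine le_of_tendsto_of_tendsto (b := 𝓝[>] (0 : ℝ)) ((c1.tendsto 0).mono_left nhdsWithin_le_nhds)
      ((c2.tendsto 0).mono_left nhdsWithin_le_nhds) ?_
    filter_upwards [self_mem_nhdsWithin] with ε hε
    exact (norm_lt_norm_of_pos hε b θ).le
  · exact (norm_lt_norm_of_pos h b θ).le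

lemma mul_conj_slice {ε : ℝ} (hε : 0 ≤ ε) (b θ : ℝ) :
    (sliceA b ε θ + Complex.I * sliceW b ε θ) * (sliceA b ε θ - Complex.I * sliceW b ε θ) =
      (sliceRadius θ : ℂ) ^ 2 := by
  have := sliceW_sq hε b θ
  linear_combination this - sliceW b ε θ ^ 2 * Complex.I_sq

/-- The denominator of `sliceRoot` does not vanish, unless `b = -2`, which is `k² = 8`. -/
lemma slice_denom_ne_zero {b : ℝ} (hb : b ≠ -2) {ε : ℝ} (hε : 0 ≤ ε) (θ : ℝ) :
    sliceA b ε θ - Complex.I * sliceW b ε θ ≠ 0 := by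
  intro h0
  have h1 := norm_le_norm_of_nonneg hε b θ
  rw [h0, norm_zero, norm_le_zero_iff] at h1
  have hA : sliceA b ε θ = 0 := by linear_combination (h0 + h1) / 2
  have h2 := mul_conj_slice hε b θ
  rw [h0, mul_zero] at h2
  have h3 : sliceRadius θ ^ 2 = 0 := by exact_mod_cast h2.symm
  rw [sliceRadius_sq] at h3
  have hAre := sliceA_re b ε θ
  rw [hA] at hAre
  simp at hAre
  exact hb (by linarith)

lemma norm_sliceRoot_le {b : ℝ} (hb : b ≠ -2) {ε : ℝ} (hε : 0 ≤ ε) (θ : ℝ) :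
    ‖sliceRoot b ε θ‖ ≤ 1 := by
  have h0 := norm_pos_iff.2 (slice_denom_ne_zero hb hε θ)
  rw [sliceRoot, norm_div, div_le_one h0]
  refine le_of_sq_le_sq ?_ (norm_nonneg _) 
  rw [norm_one_add_exp_sq]
  have h1 := congrArg norm (mul_conj_slice hε b θ)
  rw [norm_mul, norm_pow, Complex.norm_real, Real.norm_eq_abs, sq_abs] at h1
  rw [← h1, pow_two]
  exact mul_le_mul_of_nonneg_right (norm_le_norm_of_nonneg hε b θ) (norm_nonneg _)

lemma norm_sliceRoot_lt {b : ℝ} (hb : b ≠ -2) {ε : ℝ} (hε : 0 < ε) (θ : ℝ) :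
    ‖sliceRoot b ε θ‖ < 1 := by
  have h0 := norm_pos_iff.2 (slice_denom_ne_zero hb hε.le θ)
  rw [sliceRoot, norm_div, div_lt_one h0]
  refine lt_of_pow_lt_pow_left₀ 2 (norm_nonneg _) ?_
  rw [norm_one_add_exp_sq]
  have h1 := congrArg norm (mul_conj_slice hε.le b θ)
  rw [norm_mul, norm_pow, Complex.norm_real, Real.norm_eq_abs, sq_abs] at h1
  rw [← h1, pow_two]
  exact mul_lt_mul_of_pos_right (norm_lt_norm_of_pos hε b θ) h0

lemma sliceW_neg (b ε θ : ℝ) : sliceW b ε (-θ) = sliceW b ε θ := by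
  simp [sliceW, sliceRadius]

lemma sliceA_neg (b ε θ : ℝ) : sliceA b ε (-θ) = sliceA b ε θ := by
  simp [sliceA]

lemma sliceRoot_neg (b ε θ : ℝ) :
    sliceRoot b ε (-θ) = Complex.exp (-(Complex.I * θ)) * sliceRoot b ε θ := by
  rw [sliceRoot, sliceRoot, sliceA_neg, sliceW_neg, ← mul_div_assoc]
  congr 1
  have : Complex.exp (-(Complex.I * θ)) * Complex.exp (Complex.I * θ) = 1 := by
    rw [← Complex.exp_add]; simp
  push_cast
  rw [mul_neg]
  linear_combination (-2) * this

lemma sliceW_sq_zero (b θ : ℝ) : sliceW b 0 θ ^ 2 = sliceDisc b θ := by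
  rw [sliceW_sq le_rfl, sliceDisc, sliceA, ← Complex.ofReal_pow, sliceRadius_sq]
  push_cast
  ring

lemma abs_sliceDisc_le {ε : ℝ} (hε : 0 ≤ ε) (b θ : ℝ) :
    |sliceDisc b θ| ≤ ‖sliceW b ε θ‖ ^ 2 := by
  rw [← norm_pow, sliceW, mul_pow, ← map_pow, upperSqrt_sq (by simpa using hε),
    upperSqrt_sq (by simpa using hε), norm_mul, RCLike.norm_conj]
  have h : sliceDisc b θ = (sliceRadius θ - (b - 2 * Real.cos θ)) *
      (sliceRadius θ + (b - 2 * Real.cos θ)) := by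
    rw [sliceDisc, ← sliceRadius_sq]; ring
  rw [h, abs_mul]
  refine mul_le_mul ?_ ?_ (abs_nonneg _) (norm_nonneg _)
  · refine le_trans (le_of_eq ?_) (Complex.abs_re_le_norm _)
    simp [-Complex.ofReal_cos, -Complex.ofReal_sub, -Complex.ofReal_add, -Complex.ofReal_mul]
  · refine le_trans (le_of_eq ?_) (Complex.abs_re_le_norm _)
    simp [-Complex.ofReal_cos, -Complex.ofReal_sub, -Complex.ofReal_add, -Complex.ofReal_mul]

lemma norm_inv_sliceW_le {ε : ℝ} (hε : 0 ≤ ε) {b θ : ℝ} (h : sliceDisc b θ ≠ 0) :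
    ‖(Complex.I * sliceW b ε θ)⁻¹‖ ≤ (Real.sqrt |sliceDisc b θ|)⁻¹ := by
  rw [norm_inv, norm_mul, Complex.norm_I, one_mul]
  refine inv_anti₀ (Real.sqrt_pos.2 (abs_pos.2 h)) ?_
  exact Real.sqrt_le_iff.2 ⟨norm_nonneg _, abs_sliceDisc_le hε b θ⟩

lemma sliceW_ne_zero {ε : ℝ} (hε : 0 < ε) (b θ : ℝ) : sliceW b ε θ ≠ 0 := by
  intro h
  have := norm_lt_norm_of_pos hε b θ
  rw [h] at this
  simp at this

/-! ### Integrability of the inverse square root of the discriminant -/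

/-- Two factors that do not vanish simultaneously: the inverse square root of their product is
dominated by the sum of the inverse square roots. -/
lemma inv_sqrt_mul_le {a b d : ℝ} (ha : 0 ≤ a) (hd : 0 < d) (h : d ≤ a + b) :
    (Real.sqrt (a * b))⁻¹ ≤ (Real.sqrt (d / 2))⁻¹ * ((Real.sqrt a)⁻¹ + (Real.sqrt b)⁻¹) := by
  have hd2 : 0 < Real.sqrt (d / 2) := Real.sqrt_pos.2 (by linarith)
  rw [Real.sqrt_mul ha, mul_inv]
  have na : 0 ≤ (Real.sqrt a)⁻¹ := by positivity
  have nb : 0 ≤ (Real.sqrt b)⁻¹ := by positivity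
  rcases le_total (d / 2) a with h1 | h1
  · have : (Real.sqrt a)⁻¹ ≤ (Real.sqrt (d / 2))⁻¹ := inv_anti₀ hd2 (Real.sqrt_le_sqrt h1)
    have := mul_le_mul_of_nonneg_right this nb
    have : 0 ≤ (Real.sqrt (d / 2))⁻¹ * (Real.sqrt a)⁻¹ := by positivity
    linarith
  · have h2 : d / 2 ≤ b := by linarith
    have : (Real.sqrt b)⁻¹ ≤ (Real.sqrt (d / 2))⁻¹ := inv_anti₀ hd2 (Real.sqrt_le_sqrt h2)
    have := mul_le_mul_of_nonneg_left this na
    have : 0 ≤ (Real.sqrt (d / 2))⁻¹ * (Real.sqrt b)⁻¹ := by positivity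
    linarith

lemma measurable_inv_sqrt_abs {f : ℝ → ℝ} (hf : Continuous f) :
    Measurable fun x => (Real.sqrt |f x|)⁻¹ :=
  (Real.continuous_sqrt.comp hf.abs).measurable.inv

lemma intervalIntegrable_of_le {f g : ℝ → ℝ} {a b : ℝ} (hg : IntervalIntegrable g MeasureTheory.volume a b)
    (hf : Measurable f) (h : ∀ x ∈ Set.uIoc a b, |f x| ≤ g x) :
    IntervalIntegrable f MeasureTheory.volume a b :=
  hg.mono_fun' hf.aestronglyMeasurable
    ((MeasureTheory.ae_restrict_iff' measurableSet_uIoc).2 (Filter.Eventually.of_forall h))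

lemma intervalIntegrable_inv_sqrt_sin_half (c a b : ℝ) :
    IntervalIntegrable (fun θ => (Real.sqrt |Real.sin ((θ - c) / 2)|)⁻¹)
      MeasureTheory.volume a b := by
  have hper : Function.Periodic (fun θ => (Real.sqrt |Real.sin ((θ - c) / 2)|)⁻¹) (2 * Real.pi) := by
    intro θ
    have : (θ + 2 * Real.pi - c) / 2 = (θ - c) / 2 + Real.pi := by ring
    simp only [this, Real.sin_add_pi, abs_neg]
  refine hper.intervalIntegrable (t := c - Real.pi) (by positivity) ?_ a b
  have hmeas : Measurable fun θ => (Real.sqrt |Real.sin ((θ - c) / 2)|)⁻¹ :=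
    measurable_inv_sqrt_abs (by fun_prop)
  have hpi := Real.pi_pos
  have key : ∀ θ, |θ - c| ≤ Real.pi → (Real.sqrt |Real.sin ((θ - c) / 2)|)⁻¹ ≤
      (Real.sqrt Real.pi) * |θ - c| ^ (-(1 / 2) : ℝ) := by
    intro θ hθ
    have h1 := Real.mul_abs_le_abs_sin (x := (θ - c) / 2) (by
      rw [abs_div, abs_two]; linarith)
    rw [abs_div, abs_two] at h1
    have h2 : |θ - c| / Real.pi ≤ |Real.sin ((θ - c) / 2)| := by
      refine le_trans (le_of_eq ?_) h1
      field_simp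
    rcases (abs_nonneg (θ - c)).eq_or_lt with h0 | h0
    · have : θ - c = 0 := abs_eq_zero.1 h0.symm
      simp [this]
    · rw [Real.rpow_neg h0.le, ← Real.sqrt_eq_rpow]
      refine (inv_anti₀ (Real.sqrt_pos.2 (by positivity)) (Real.sqrt_le_sqrt h2)).trans ?_
      rw [Real.sqrt_div h0.le, inv_div, div_eq_mul_inv]
  have e : c - Real.pi + 2 * Real.pi = c + Real.pi := by ring
  rw [e]
  have i1 : IntervalIntegrable (fun x : ℝ => x ^ (-(1 / 2) : ℝ)) MeasureTheory.volume 0 Real.pi :=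
    intervalIntegral.intervalIntegrable_rpow' (by norm_num)
  have i2 : IntervalIntegrable (fun θ : ℝ => Real.sqrt Real.pi * (θ - c) ^ (-(1 / 2) : ℝ))
      MeasureTheory.volume c (c + Real.pi) := by
    have := (i1.const_mul (Real.sqrt Real.pi)).comp_sub_right c
    simpa [add_comm] using this
  have i3 : IntervalIntegrable (fun θ : ℝ => Real.sqrt Real.pi * (c - θ) ^ (-(1 / 2) : ℝ))
      MeasureTheory.volume (c - Real.pi) c := by
    have := (i1.const_mul (Real.sqrt Real.pi)).comp_sub_left c
    simpa using this.symm
  refine IntervalIntegrable.trans (b := c) (intervalIntegrable_of_le i3 hmeas ?_)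
    (intervalIntegrable_of_le i2 hmeas ?_)
  · intro x hx
    rw [Set.uIoc_of_le (by linarith)] at hx
    rw [abs_of_nonneg (by positivity)]
    have := key x (by rw [abs_le]; constructor <;> linarith [hx.1, hx.2])
    rwa [abs_sub_comm x c, abs_of_nonneg (show 0 ≤ c - x by linarith [hx.2])] at this
  · intro x hx
    rw [Set.uIoc_of_le (by linarith)] at hx
    rw [abs_of_nonneg (by positivity)]
    have := key x (by rw [abs_le]; constructor <;> linarith [hx.1, hx.2])
    rwa [abs_of_nonneg (show 0 ≤ x - c by linarith [hx.1])] at this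

lemma intervalIntegrable_inv_sqrt_cos_sub {x : ℝ} (hx1 : x ≠ 1) (hx2 : x ≠ -1) (a b : ℝ) :
    IntervalIntegrable (fun θ => (Real.sqrt |Real.cos θ - x|)⁻¹) MeasureTheory.volume a b := by
  have hmeas : Measurable fun θ => (Real.sqrt |Real.cos θ - x|)⁻¹ :=
    measurable_inv_sqrt_abs (by fun_prop)
  by_cases hx : |x| < 1
  · rw [abs_lt] at hx
    obtain ⟨β, hβ⟩ : ∃ β, β = Real.arccos x := ⟨_, rfl⟩
    have hcos : Real.cos β = x := by rw [hβ, Real.cos_arccos hx.1.le hx.2.le]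
    have hsin : 0 < Real.sin β := by
      rw [hβ, Real.sin_arccos]
      exact Real.sqrt_pos.2 (by nlinarith)
    refine intervalIntegrable_of_le ((((intervalIntegrable_inv_sqrt_sin_half (-β) a b).add
      (intervalIntegrable_inv_sqrt_sin_half β a b)).const_mul
        ((Real.sqrt (Real.sin β / 2))⁻¹)).const_mul ((Real.sqrt 2)⁻¹)) hmeas ?_
    intro θ _
    rw [abs_of_nonneg (by positivity), ← hcos, Real.cos_sub_cos, abs_mul, abs_mul, abs_neg, abs_two,
      mul_assoc, Real.sqrt_mul (by norm_num), mul_inv]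
    refine mul_le_mul_of_nonneg_left ?_ (by positivity)
    rw [sub_neg_eq_add]
    refine inv_sqrt_mul_le (abs_nonneg _) hsin ?_
    have e : Real.sin β = Real.sin ((θ + β) / 2) * Real.cos ((θ - β) / 2)
        - Real.cos ((θ + β) / 2) * Real.sin ((θ - β) / 2) := by
      rw [← Real.sin_sub]; ring_nf
    rw [e]
    refine (le_abs_self _).trans ((abs_sub _ _).trans ?_)
    rw [abs_mul, abs_mul]
    have h1 := mul_le_mul_of_nonneg_left (Real.abs_cos_le_one ((θ - β) / 2))
      (abs_nonneg (Real.sin ((θ + β) / 2)))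
    have h2 := mul_le_mul_of_nonneg_right (Real.abs_cos_le_one ((θ + β) / 2))
      (abs_nonneg (Real.sin ((θ - β) / 2)))
    linarith
  · have hx' : 1 < |x| := by
      refine lt_of_le_of_ne (not_lt.1 hx) fun h => ?_
      rcases eq_or_eq_neg_of_abs_eq h.symm with h | h
      · exact hx1 h
      · exact hx2 h
    refine intervalIntegrable_of_le (g := fun _ => (Real.sqrt (|x| - 1))⁻¹) intervalIntegrable_const
      hmeas ?_
    intro θ _
    rw [abs_of_nonneg (by positivity)]
    refine inv_anti₀ (Real.sqrt_pos.2 (by linarith)) (Real.sqrt_le_sqrt ?_)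
    have := abs_sub_abs_le_abs_sub x (Real.cos θ)
    rw [abs_sub_comm] at this
    linarith [Real.abs_cos_le_one θ]

/-- The discriminant as a quadratic polynomial in `cos θ` with two simple roots. -/
lemma sliceDisc_eq {b : ℝ} (hb : -3 < b) (θ : ℝ) :
    sliceDisc b θ = -4 * (Real.cos θ - (1 + b / 2 + Real.sqrt (3 + b))) *
      (Real.cos θ - (1 + b / 2 - Real.sqrt (3 + b))) := by
  have := Real.sq_sqrt (show 0 ≤ 3 + b by linarith)
  rw [sliceDisc]
  linear_combination (-4) * this

lemma sliceDisc_roots_ne {b : ℝ} (hb : -3 < b) (hb2 : b ≠ -2) (hb6 : b ≠ 6) :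
    1 + b / 2 + Real.sqrt (3 + b) ≠ 1 ∧ 1 + b / 2 + Real.sqrt (3 + b) ≠ -1 ∧
    1 + b / 2 - Real.sqrt (3 + b) ≠ 1 ∧ 1 + b / 2 - Real.sqrt (3 + b) ≠ -1 := by
  have h := Real.sq_sqrt (show 0 ≤ 3 + b by linarith)
  have key : ∀ s : ℝ, s ^ 2 = 3 + b → b / 2 + s ≠ 0 ∧ 2 + b / 2 + s ≠ 0 := by
    intro s hs
    constructor
    · intro h0
      have e : s = - (b / 2) := by linarith
      rw [e] at hs
      have : (b - 6) * (b + 2) = 0 := by linarith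
      rcases mul_eq_zero.1 this with h | h
      · exact hb6 (by linarith)
      · exact hb2 (by linarith)
    · intro h0
      have e : s = - (b / 2) - 2 := by linarith
      rw [e] at hs
      have : (b + 2) ^ 2 = 0 := by linarith
      exact hb2 (by have := pow_eq_zero_iff (two_ne_zero) |>.1 this; linarith)
  obtain ⟨a1, a2⟩ := key _ h
  obtain ⟨a3, a4⟩ := key (-Real.sqrt (3 + b)) (by rw [neg_sq, h])
  refine ⟨fun h => a1 ?_, fun h => a2 ?_, fun h => a3 ?_, fun h => a4 ?_⟩ <;> linarith

lemma intervalIntegrable_inv_sqrt_sliceDisc {b : ℝ} (hb : -3 < b) (hb2 : b ≠ -2) (hb6 : b ≠ 6)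
    (x y : ℝ) :
    IntervalIntegrable (fun θ => (Real.sqrt |sliceDisc b θ|)⁻¹) MeasureTheory.volume x y := by
  obtain ⟨r1, r2, r3, r4⟩ := sliceDisc_roots_ne hb hb2 hb6
  have hs : 0 < Real.sqrt (3 + b) := Real.sqrt_pos.2 (by linarith)
  refine intervalIntegrable_of_le ((((intervalIntegrable_inv_sqrt_cos_sub r1 r2 x y).add
    (intervalIntegrable_inv_sqrt_cos_sub r3 r4 x y)).const_mul
      ((Real.sqrt (2 * Real.sqrt (3 + b) / 2))⁻¹)).const_mul ((Real.sqrt 4)⁻¹))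
    (measurable_inv_sqrt_abs (by unfold sliceDisc; fun_prop)) ?_
  intro θ _
  rw [abs_of_nonneg (by positivity), sliceDisc_eq hb, abs_mul, abs_mul, abs_neg,
    abs_of_pos (by norm_num : (0 : ℝ) < 4), mul_assoc, Real.sqrt_mul (by norm_num), mul_inv]
  refine mul_le_mul_of_nonneg_left ?_ (by positivity)
  refine inv_sqrt_mul_le (abs_nonneg _) (by positivity) ?_
  generalize Real.cos θ = z
  have h1 := abs_sub (z - (1 + b / 2 - Real.sqrt (3 + b))) (z - (1 + b / 2 + Real.sqrt (3 + b)))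
  have h2 : (z - (1 + b / 2 - Real.sqrt (3 + b))) - (z - (1 + b / 2 + Real.sqrt (3 + b)))
    = 2 * Real.sqrt (3 + b) := by ring
  rw [h2, abs_of_pos (by positivity)] at h1
  linarith

lemma ae_cos_ne (x : ℝ) : ∀ᵐ θ : ℝ, Real.cos θ ≠ x := by
  by_cases hx : ∃ β, Real.cos β = x
  · obtain ⟨β, rfl⟩ := hx
    have hc : ((Set.range fun n : ℤ => 2 * n * Real.pi + β) ∪
        (Set.range fun n : ℤ => 2 * n * Real.pi - β)).Countable :=
      (Set.countable_range _).union (Set.countable_range _)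
    refine MeasureTheory.measure_mono_null ?_ (hc.measure_zero MeasureTheory.volume)
    intro θ hθ
    have hθ' : Real.cos β = Real.cos θ := by
      by_contra h
      exact hθ (fun h' => h h'.symm)
    obtain ⟨n, hn⟩ := Real.cos_eq_cos_iff.1 hθ'
    rcases hn with h | h
    · exact Or.inl ⟨n, h.symm⟩
    · exact Or.inr ⟨n, h.symm⟩
  · exact Filter.Eventually.of_forall fun θ h => hx ⟨θ, h⟩

lemma ae_sliceDisc_ne_zero {b : ℝ} (hb : -3 < b) : ∀ᵐ θ : ℝ, sliceDisc b θ ≠ 0 := by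
  filter_upwards [ae_cos_ne (1 + b / 2 + Real.sqrt (3 + b)),
    ae_cos_ne (1 + b / 2 - Real.sqrt (3 + b))] with θ h1 h2
  rw [sliceDisc_eq hb]
  simp [sub_ne_zero.2 h1, sub_ne_zero.2 h2]

/-! ### The limit of the resolvent kernels -/

lemma integral_exp_int (n : ℤ) :
    ∫ η in (-Real.pi)..Real.pi, Complex.exp (Complex.I * (n * η)) =
      if n = 0 then 2 * (Real.pi : ℂ) else 0 := by
  split_ifs with h
  · subst h
    simp
    ring
  · have hc : Complex.I * n ≠ 0 := mul_ne_zero Complex.I_ne_zero (by exact_mod_cast h)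
    have := integral_exp_mul_complex (a := -Real.pi) (b := Real.pi) hc
    simp only [mul_assoc] at this
    rw [this]
    have e : Complex.exp (Complex.I * (n * (Real.pi : ℂ))) =
        Complex.exp (Complex.I * (n * ((-Real.pi : ℝ) : ℂ))) := by
      rw [Complex.exp_eq_exp_iff_exists_int]
      exact ⟨n, by push_cast; ring⟩
    rw [e]; simp

lemma norm_exp_I_mul (x : ℝ) : ‖Complex.exp (Complex.I * x)‖ = 1 := by
  rw [mul_comm, Complex.norm_exp_ofReal_mul_I]

lemma one_sub_mul_exp_ne_zero {a : ℂ} (ha : ‖a‖ < 1) (x : ℝ) :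
    1 - a * Complex.exp (Complex.I * x) ≠ 0 := by
  intro h
  have : ‖a * Complex.exp (Complex.I * x)‖ = 1 := by
    rw [← sub_eq_zero.1 h]; simp
  rw [norm_mul, norm_exp_I_mul, mul_one] at this
  linarith

/-- The Fourier coefficients of a geometric series. -/
lemma integral_exp_mul_inv_one_sub {a : ℂ} (ha : ‖a‖ < 1) (m : ℤ) :
    ∫ η in (-Real.pi)..Real.pi, Complex.exp (Complex.I * (m * η)) *
        (1 - a * Complex.exp (Complex.I * (-η : ℝ)))⁻¹ =
      if 0 ≤ m then 2 * (Real.pi : ℂ) * a ^ m.toNat else 0 := by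
  have hnorm : ∀ η : ℝ, ‖Complex.exp (Complex.I * (m * η))‖ = 1 := fun η => by
    have := norm_exp_I_mul (m * η)
    push_cast at this
    exact this
  have hgeom : ∀ η : ℝ, HasSum (fun n : ℕ => Complex.exp (Complex.I * (m * η)) *
      (a * Complex.exp (Complex.I * (-η : ℝ))) ^ n) (Complex.exp (Complex.I * (m * η)) *
        (1 - a * Complex.exp (Complex.I * (-η : ℝ)))⁻¹) := fun η => by
    have h1 : ‖a * Complex.exp (Complex.I * (-η : ℝ))‖ < 1 := by
      rw [norm_mul, norm_exp_I_mul, mul_one]; exact ha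
    exact (hasSum_geometric_of_norm_lt_one h1).mul_left _
  have hbound : ∀ (n : ℕ) (η : ℝ), ‖Complex.exp (Complex.I * (m * η)) *
      (a * Complex.exp (Complex.I * (-η : ℝ))) ^ n‖ ≤ ‖a‖ ^ n := fun n η => by
    rw [norm_mul, norm_pow, norm_mul, hnorm, norm_exp_I_mul]; simp
  have hsum : Summable fun n : ℕ => ‖a‖ ^ n := summable_geometric_of_lt_one (norm_nonneg _) ha
  have hs : HasSum (fun n : ℕ => ∫ η in (-Real.pi)..Real.pi, Complex.exp (Complex.I * (m * η)) *
      (a * Complex.exp (Complex.I * (-η : ℝ))) ^ n) (∫ η in (-Real.pi)..Real.pi,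
        Complex.exp (Complex.I * (m * η)) * (1 - a * Complex.exp (Complex.I * (-η : ℝ)))⁻¹) :=
    intervalIntegral.hasSum_integral_of_dominated_convergence (fun n _ => ‖a‖ ^ n)
      (fun n => Continuous.aestronglyMeasurable (by fun_prop))
      (fun n => Filter.Eventually.of_forall fun η _ => hbound n η)
      (Filter.Eventually.of_forall fun η _ => hsum) intervalIntegrable_const
      (Filter.Eventually.of_forall fun η _ => hgeom η)
  have hterm : ∀ n : ℕ, ∫ η in (-Real.pi)..Real.pi, Complex.exp (Complex.I * (m * η)) *
      (a * Complex.exp (Complex.I * (-η : ℝ))) ^ n =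
      if m = n then 2 * (Real.pi : ℂ) * a ^ n else 0 := by
    intro n
    have : ∀ η : ℝ, Complex.exp (Complex.I * (m * η)) *
      (a * Complex.exp (Complex.I * (-η : ℝ))) ^ n =
        a ^ n * Complex.exp (Complex.I * (((m - n : ℤ) : ℂ) * η)) := by
      intro η
      rw [mul_pow, ← Complex.exp_nat_mul, mul_left_comm, ← Complex.exp_add]
      congr 2
      push_cast
      ring
    simp only [this]
    rw [intervalIntegral.integral_const_mul, integral_exp_int]
    by_cases h : m = n
    · simp [h]; ring
    · simp [h, sub_ne_zero.2 h]
  simp only [hterm] at hs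
  refine hs.unique ?_
  split_ifs with h
  · obtain ⟨n, rfl⟩ := Int.eq_ofNat_of_zero_le h
    have := hasSum_ite_eq n (2 * (Real.pi : ℂ) * a ^ n)
    simp only [Int.toNat_natCast]
    convert this using 2 with i
    by_cases hi : i = n
    · simp [hi]
    · simp [hi, Ne.symm hi]
  · convert hasSum_zero with n
    rw [if_neg]
    rintro rfl
    exact h (Int.natCast_nonneg n)

lemma symbol_eq (k ε θ η : ℝ) :
    symbol ((k : ℂ) ^ 2 + Complex.I * ε) (θ, η) =
      -sliceA (6 - k ^ 2) ε θ + (1 + Complex.exp (-(Complex.I * θ))) * Complex.exp (Complex.I * η) +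
        (1 + Complex.exp (Complex.I * θ)) * Complex.exp (Complex.I * (-η : ℝ)) := by
  simp only [symbol, sliceA]
  push_cast
  rw [Complex.two_cos, Complex.two_cos, Complex.two_cos, add_mul, add_mul, one_mul, one_mul,
    ← Complex.exp_add, ← Complex.exp_add]
  have e1 : -(Complex.I * (θ : ℂ)) + Complex.I * η = -(θ - η) * Complex.I := by ring
  have e2 : Complex.I * (θ : ℂ) + Complex.I * -η = (θ - η) * Complex.I := by ring
  rw [e1, e2, mul_comm Complex.I, mul_comm Complex.I]
  ring_nf

lemma symbol_ne_zero {ε : ℝ} (hε : ε ≠ 0) (k : ℝ) (ξ : ℝ × ℝ) :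
    symbol ((k : ℂ) ^ 2 + Complex.I * ε) ξ ≠ 0 := by
  intro h
  have h1 : symbol ((k : ℂ) ^ 2 + Complex.I * ε) ξ =
    ((k ^ 2 - 6 + 2 * Real.cos ξ.1 + 2 * Real.cos ξ.2 + 2 * Real.cos (ξ.1 - ξ.2) : ℝ) : ℂ)
      + ε * Complex.I := by
    simp only [symbol]; push_cast; ring
  rw [h1] at h
  have := congrArg Complex.im h
  rw [Complex.add_im, Complex.ofReal_im] at this
  simp at this
  exact hε this

/-- Partial fractions for the inverse of the symbol on a slice. -/
lemma inv_symbol_eq {k : ℝ} (hk : k ^ 2 ≠ 8) {ε : ℝ} (hε : 0 < ε) (θ η : ℝ) :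
    (symbol ((k : ℂ) ^ 2 + Complex.I * ε) (θ, η))⁻¹ =
      (Complex.I * sliceW (6 - k ^ 2) ε θ)⁻¹ *
        ((1 - sliceRoot (6 - k ^ 2) ε θ * Complex.exp (Complex.I * (-η : ℝ)))⁻¹ +
          (1 - sliceRoot (6 - k ^ 2) ε (-θ) * Complex.exp (Complex.I * η))⁻¹ - 1) := by
  have hb : 6 - k ^ 2 ≠ -2 := fun h => hk (by linarith)
  have n1 := one_sub_mul_exp_ne_zero (norm_sliceRoot_lt hb hε θ) (-η)
  have n2 := one_sub_mul_exp_ne_zero (norm_sliceRoot_lt hb hε (-θ)) η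
  have hσ := symbol_ne_zero hε.ne' k (θ, η)
  have hB := slice_denom_ne_zero hb hε.le θ
  have hw := sliceW_ne_zero hε (6 - k ^ 2) θ
  have hm := mul_conj_slice hε.le (6 - k ^ 2) θ
  -- the squared radius is four times the product of the outer coefficients of the quadratic
  have hr : (sliceRadius θ : ℂ) ^ 2 =
      4 * ((1 + Complex.exp (Complex.I * θ)) * (1 + Complex.exp (-(Complex.I * θ)))) := by
    rw [← Complex.ofReal_pow, sliceRadius_sq]
    have : Complex.exp (-(Complex.I * θ)) * Complex.exp (Complex.I * θ) = 1 := by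
      rw [← Complex.exp_add]; simp
    push_cast
    have e : 8 * Complex.cos θ = 4 * (2 * Complex.cos θ) := by ring
    rw [e, Complex.two_cos]
    rw [mul_comm Complex.I] at *
    rw [neg_mul]
    linear_combination (-4) * this
  rw [hr] at hm
  have hz : Complex.exp (Complex.I * η) * Complex.exp (Complex.I * (-η : ℝ)) = 1 := by
    rw [← Complex.exp_add]; simp
  rw [symbol_eq] at hσ ⊢
  have l1 : sliceRoot (6 - k ^ 2) ε θ * (sliceA (6 - k ^ 2) ε θ -
      Complex.I * sliceW (6 - k ^ 2) ε θ) = 2 * (1 + Complex.exp (Complex.I * θ)) := by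
    rw [sliceRoot, div_mul_cancel₀ _ hB]
  have l2 : sliceRoot (6 - k ^ 2) ε (-θ) * (sliceA (6 - k ^ 2) ε θ -
      Complex.I * sliceW (6 - k ^ 2) ε θ) = 2 * (1 + Complex.exp (-(Complex.I * θ))) := by
    rw [sliceRoot, sliceA_neg, sliceW_neg, div_mul_cancel₀ _ hB]
    push_cast
    rw [mul_neg]
  generalize sliceRoot (6 - k ^ 2) ε θ = a at *
  generalize sliceRoot (6 - k ^ 2) ε (-θ) = a' at *
  generalize sliceA (6 - k ^ 2) ε θ = A at *
  generalize sliceW (6 - k ^ 2) ε θ = w at *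
  generalize Complex.exp (Complex.I * θ) = e at *
  generalize Complex.exp (-(Complex.I * θ)) = e' at *
  generalize Complex.exp (Complex.I * η) = z at *
  generalize Complex.exp (Complex.I * (-η : ℝ)) = z' at *
  have hI := Complex.I_ne_zero
  -- the product of the two linear factors is `-2 σ / (A - i w)`
  have p1 : (A - Complex.I * w) * ((1 - a * z') * (1 - a' * z)) =
      -2 * (-A + (1 + e') * z + (1 + e) * z') := by
    have haa : a * a' * (A - Complex.I * w) = A + Complex.I * w := by
      apply mul_right_cancel₀ hB
      linear_combination a' * (A - Complex.I * w) * l1 + 2 * (1 + e) * l2 - hm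
    linear_combination (-z') * l1 - z * l2 + z * z' * haa + (A + Complex.I * w) * hz
  -- the numerator of the sum of the partial fractions
  have p2 : (A - Complex.I * w) * ((1 - a * z') + (1 - a' * z) - (1 - a * z') * (1 - a' * z)) =
      -2 * (Complex.I * w) := by
    have haa : a * a' * (A - Complex.I * w) = A + Complex.I * w := by
      apply mul_right_cancel₀ hB
      linear_combination a' * (A - Complex.I * w) * l1 + 2 * (1 + e) * l2 - hm
    linear_combination (-(z * z')) * haa - (A + Complex.I * w) * hz
  have p3 : (1 - a * z')⁻¹ + (1 - a' * z)⁻¹ - 1 =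
      ((1 - a * z') + (1 - a' * z) - (1 - a * z') * (1 - a' * z)) /
        ((1 - a * z') * (1 - a' * z)) := by
    field_simp
    ring
  rw [p3, ← one_div, ← one_div, div_mul_div_comm, one_mul,
    div_eq_div_iff hσ (mul_ne_zero (mul_ne_zero hI hw) (mul_ne_zero n1 n2))]
  apply mul_left_cancel₀ hB
  linear_combination Complex.I * w * p1 - (-A + (1 + e') * z + (1 + e) * z') * p2

/-- The function of `θ` to which the integral over `ξ₂` leads, up to a factor: a power of the
decaying root upwards, and of its mirror image downwards. -/
noncomputable def slicePow (b ε : ℝ) (t : ℤ) (θ : ℝ) : ℂ :=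
  if 0 ≤ t then sliceRoot b ε θ ^ t.toNat else sliceRoot b ε (-θ) ^ (-t).toNat

lemma slice_integral {k : ℝ} (hk : k ^ 2 ≠ 8) {ε : ℝ} (hε : 0 < ε) (θ : ℝ) (m : ℤ) :
    ∫ η in (-Real.pi)..Real.pi, Complex.exp (Complex.I * (m * η)) *
      (symbol ((k : ℂ) ^ 2 + Complex.I * ε) (θ, η))⁻¹ =
    2 * Real.pi * (slicePow (6 - k ^ 2) ε m θ * (Complex.I * sliceW (6 - k ^ 2) ε θ)⁻¹) := by
  have hb : 6 - k ^ 2 ≠ -2 := fun h => hk (by linarith)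
  have h1 := norm_sliceRoot_lt hb hε θ
  have h2 := norm_sliceRoot_lt hb hε (-θ)
  have n1 := fun η => one_sub_mul_exp_ne_zero h1 (-η)
  have n2 := one_sub_mul_exp_ne_zero h2
  simp only [inv_symbol_eq hk hε]
  set a := sliceRoot (6 - k ^ 2) ε θ with ha
  set a' := sliceRoot (6 - k ^ 2) ε (-θ) with ha'
  set w := sliceW (6 - k ^ 2) ε θ
  have c1 : Continuous fun η : ℝ => Complex.exp (Complex.I * (m * η)) *
      (1 - a * Complex.exp (Complex.I * (-η : ℝ)))⁻¹ :=
    Continuous.mul (by fun_prop) (Continuous.inv₀ (by fun_prop) n1)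
  have c2 : Continuous fun η : ℝ => Complex.exp (Complex.I * (m * η)) *
      (1 - a' * Complex.exp (Complex.I * η))⁻¹ :=
    Continuous.mul (by fun_prop) (Continuous.inv₀ (by fun_prop) n2)
  have c3 : Continuous fun η : ℝ => Complex.exp (Complex.I * (m * η)) := by fun_prop
  have e : ∀ η : ℝ, Complex.exp (Complex.I * (m * η)) * ((Complex.I * w)⁻¹ *
      ((1 - a * Complex.exp (Complex.I * (-η : ℝ)))⁻¹ +
        (1 - a' * Complex.exp (Complex.I * η))⁻¹ - 1)) =
      (Complex.I * w)⁻¹ * (Complex.exp (Complex.I * (m * η)) *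
        (1 - a * Complex.exp (Complex.I * (-η : ℝ)))⁻¹ + Complex.exp (Complex.I * (m * η)) *
        (1 - a' * Complex.exp (Complex.I * η))⁻¹ - Complex.exp (Complex.I * (m * η))) := by
    intro η; ring
  simp only [e]
  rw [intervalIntegral.integral_const_mul, intervalIntegral.integral_sub
    ((c1.intervalIntegrable _ _).add (c2.intervalIntegrable _ _)) (c3.intervalIntegrable _ _),
    intervalIntegral.integral_add (c1.intervalIntegrable _ _) (c2.intervalIntegrable _ _),
    integral_exp_mul_inv_one_sub h1, integral_exp_int]
  have e2 : ∫ η in (-Real.pi)..Real.pi, Complex.exp (Complex.I * (m * η)) *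
      (1 - a' * Complex.exp (Complex.I * η))⁻¹ =
      if 0 ≤ -m then 2 * (Real.pi : ℂ) * a' ^ (-m).toNat else 0 := by
    rw [← integral_exp_mul_inv_one_sub h2]
    have := intervalIntegral.integral_comp_neg (a := -Real.pi) (b := Real.pi)
      (fun η : ℝ => Complex.exp (Complex.I * (((-m : ℤ) : ℂ) * η)) *
        (1 - a' * Complex.exp (Complex.I * (-η : ℝ)))⁻¹)
    rw [neg_neg] at this
    rw [← this]
    refine intervalIntegral.integral_congr fun η _ => ?_
    simp
  rw [e2]
  rcases lt_trichotomy m 0 with h | h | h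
  · have q1 : ¬ (0 ≤ m) := by omega
    have q2 : 0 ≤ -m := by omega
    simp only [slicePow, q1, q2, h.ne, if_true, if_false]
    ring
  · subst h
    simp [slicePow]
    ring
  · have q1 : 0 ≤ m := h.le
    have q2 : ¬ (0 ≤ -m) := by omega
    simp only [slicePow, q1, q2, h.ne', if_true, if_false]
    ring

/-- The resolvent kernel as a single integral: the integral over `ξ₂` is a Fourier coefficient
of two geometric series. -/
lemma resolventKernel_eq {k : ℝ} (hk : k ^ 2 ≠ 8) {ε : ℝ} (hε : 0 < ε) (x : ℤ × ℤ) :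
    resolventKernel k ε x = (2 * (Real.pi : ℂ))⁻¹ * ∫ θ in (-Real.pi)..Real.pi,
      Complex.exp (Complex.I * (x.1 * θ)) *
        (slicePow (6 - k ^ 2) ε x.2 θ * (Complex.I * sliceW (6 - k ^ 2) ε θ)⁻¹) := by
  have h : ∀ θ : ℝ, ∫ η in (-Real.pi)..Real.pi,
      Complex.exp (Complex.I * ((x.1 : ℂ) * θ + (x.2 : ℂ) * η)) /
        symbol ((k : ℂ) ^ 2 + Complex.I * ε) (θ, η) =
      2 * Real.pi * (Complex.exp (Complex.I * (x.1 * θ)) *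
        (slicePow (6 - k ^ 2) ε x.2 θ * (Complex.I * sliceW (6 - k ^ 2) ε θ)⁻¹)) := by
    intro θ
    have e : ∀ η : ℝ, Complex.exp (Complex.I * ((x.1 : ℂ) * θ + (x.2 : ℂ) * η)) /
        symbol ((k : ℂ) ^ 2 + Complex.I * ε) (θ, η) =
        Complex.exp (Complex.I * (x.1 * θ)) * (Complex.exp (Complex.I * (x.2 * η)) *
          (symbol ((k : ℂ) ^ 2 + Complex.I * ε) (θ, η))⁻¹) := by
      intro η
      rw [mul_add, Complex.exp_add, div_eq_mul_inv, mul_assoc]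
    simp only [e]
    rw [intervalIntegral.integral_const_mul, slice_integral hk hε]
    ring
  rw [resolventKernel]
  simp only [h]
  rw [intervalIntegral.integral_const_mul, ← mul_assoc]
  congr 1
  have : (Real.pi : ℂ) ≠ 0 := by exact_mod_cast Real.pi_ne_zero
  field_simp
  ring

/-! ### Limiting absorption -/

/-- The wave numbers under consideration, in terms of `k²`. -/
def Admissible (k : ℝ) : Prop := 0 < k ^ 2 ∧ k ^ 2 < 9 ∧ k ^ 2 ≠ 8

lemma Admissible.ne {k : ℝ} (hk : Admissible k) : 6 - k ^ 2 ≠ -2 := fun h => hk.2.2 (by linarith)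

lemma Admissible.lt {k : ℝ} (hk : Admissible k) : -3 < 6 - k ^ 2 := by linarith [hk.2.1]

lemma Admissible.ne_six {k : ℝ} (hk : Admissible k) : 6 - k ^ 2 ≠ 6 := fun h => by
  linarith [hk.1]

lemma continuous_sliceRoot {b : ℝ} (hb : b ≠ -2) {ε : ℝ} (hε : 0 ≤ ε) :
    Continuous (sliceRoot b ε) := by
  have hA : Continuous fun θ : ℝ => sliceA b ε θ :=
    Continuous.comp (g := fun p : ℝ × ℝ => sliceA b p.1 p.2) (f := fun θ => (ε, θ))
      (continuous_sliceA b) (by fun_prop)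
  have hW : Continuous fun θ : ℝ => sliceW b ε θ :=
    Continuous.comp (g := fun p : ℝ × ℝ => sliceW b p.1 p.2) (f := fun θ => (ε, θ))
      (continuous_sliceW b) (by fun_prop)
  unfold sliceRoot
  exact Continuous.div (by fun_prop) (by fun_prop) (slice_denom_ne_zero hb hε)

lemma continuous_sliceW_right (b ε : ℝ) : Continuous (sliceW b ε) :=
  Continuous.comp (g := fun p : ℝ × ℝ => sliceW b p.1 p.2) (f := fun θ => (ε, θ))
    (continuous_sliceW b) (by fun_prop)

lemma tendsto_sliceW (b θ : ℝ) : Tendsto (fun ε => sliceW b ε θ) (𝓝[>] 0) (𝓝 (sliceW b 0 θ)) :=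
  ((Continuous.comp (g := fun p : ℝ × ℝ => sliceW b p.1 p.2) (f := fun ε => (ε, θ))
    (continuous_sliceW b) (by fun_prop)).tendsto 0).mono_left nhdsWithin_le_nhds

lemma tendsto_sliceRoot {b : ℝ} (hb : b ≠ -2) (θ : ℝ) :
    Tendsto (fun ε => sliceRoot b ε θ) (𝓝[>] 0) (𝓝 (sliceRoot b 0 θ)) := by
  have hA : Tendsto (fun ε => sliceA b ε θ) (𝓝[>] 0) (𝓝 (sliceA b 0 θ)) :=
    ((Continuous.comp (g := fun p : ℝ × ℝ => sliceA b p.1 p.2) (f := fun ε => (ε, θ))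
      (continuous_sliceA b) (by fun_prop)).tendsto 0).mono_left nhdsWithin_le_nhds
  unfold sliceRoot
  exact tendsto_const_nhds.div (hA.sub ((tendsto_sliceW b θ).const_mul _))
    (slice_denom_ne_zero hb le_rfl θ)

lemma continuous_slicePow {b : ℝ} (hb : b ≠ -2) {ε : ℝ} (hε : 0 ≤ ε) (t : ℤ) :
    Continuous (slicePow b ε t) := by
  have := continuous_sliceRoot hb hε
  unfold slicePow
  split_ifs <;> fun_prop

lemma tendsto_slicePow {b : ℝ} (hb : b ≠ -2) (t : ℤ) (θ : ℝ) :
    Tendsto (fun ε => slicePow b ε t θ) (𝓝[>] 0) (𝓝 (slicePow b 0 t θ)) := by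
  unfold slicePow
  split_ifs
  · exact (tendsto_sliceRoot hb θ).pow _
  · exact (tendsto_sliceRoot hb (-θ)).pow _

lemma norm_slicePow_le {b : ℝ} (hb : b ≠ -2) {ε : ℝ} (hε : 0 ≤ ε) (t : ℤ) (θ : ℝ) :
    ‖slicePow b ε t θ‖ ≤ 1 := by
  unfold slicePow
  split_ifs
  · rw [norm_pow]; exact pow_le_one₀ (norm_nonneg _) (norm_sliceRoot_le hb hε _)
  · rw [norm_pow]; exact pow_le_one₀ (norm_nonneg _) (norm_sliceRoot_le hb hε _)

lemma norm_exp_int_mul (m : ℤ) (θ : ℝ) : ‖Complex.exp (Complex.I * (m * θ))‖ = 1 := by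
  have := norm_exp_I_mul (m * θ)
  push_cast at this
  exact this

lemma sliceW_zero_ne_zero {b θ : ℝ} (h : sliceDisc b θ ≠ 0) : sliceW b 0 θ ≠ 0 := by
  intro h0
  have := sliceW_sq_zero b θ
  rw [h0] at this
  exact h (by exact_mod_cast (show ((sliceDisc b θ : ℝ) : ℂ) = 0 by rw [← this]; simp))

/-- The integrand, in `θ = ξ₁`, of the Fourier representation of the Green's function after
integration over `ξ₂`. -/
noncomputable def greenIntegrand (k : ℝ) (x : ℤ × ℤ) (θ : ℝ) : ℂ :=
  Complex.exp (Complex.I * (x.1 * θ)) *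
    (slicePow (6 - k ^ 2) 0 x.2 θ * (Complex.I * sliceW (6 - k ^ 2) 0 θ)⁻¹)

lemma norm_integrand_le {k : ℝ} (hk : Admissible k) {ε : ℝ} (hε : 0 ≤ ε) (x : ℤ × ℤ) {θ : ℝ}
    (h : sliceDisc (6 - k ^ 2) θ ≠ 0) :
    ‖Complex.exp (Complex.I * (x.1 * θ)) *
      (slicePow (6 - k ^ 2) ε x.2 θ * (Complex.I * sliceW (6 - k ^ 2) ε θ)⁻¹)‖ ≤
      (Real.sqrt |sliceDisc (6 - k ^ 2) θ|)⁻¹ := by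
  rw [norm_mul, norm_exp_int_mul, one_mul, norm_mul]
  have h1 := norm_slicePow_le hk.ne hε x.2 θ
  have h2 := norm_inv_sliceW_le hε h
  calc _ ≤ 1 * (Real.sqrt |sliceDisc (6 - k ^ 2) θ|)⁻¹ :=
        mul_le_mul h1 h2 (norm_nonneg _) zero_le_one
    _ = _ := one_mul _

lemma measurable_greenIntegrand {k : ℝ} (hk : Admissible k) {ε : ℝ} (hε : 0 ≤ ε) (x : ℤ × ℤ) :
    Measurable fun θ : ℝ => Complex.exp (Complex.I * (x.1 * θ)) *
      (slicePow (6 - k ^ 2) ε x.2 θ * (Complex.I * sliceW (6 - k ^ 2) ε θ)⁻¹) := by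
  have h1 := (continuous_slicePow hk.ne hε x.2).measurable
  have h2 := (continuous_sliceW_right (6 - k ^ 2) ε).measurable
  have h3 : Measurable fun θ : ℝ => Complex.exp (Complex.I * (x.1 * θ)) :=
    Continuous.measurable (by fun_prop)
  exact h3.mul (h1.mul (measurable_const.mul h2).inv)

lemma intervalIntegrable_greenIntegrand {k : ℝ} (hk : Admissible k) (x : ℤ × ℤ) :
    IntervalIntegrable (greenIntegrand k x) MeasureTheory.volume (-Real.pi) Real.pi := by
  refine (intervalIntegrable_inv_sqrt_sliceDisc hk.lt hk.ne hk.ne_six _ _).mono_fun'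
    (measurable_greenIntegrand hk le_rfl x).aestronglyMeasurable ?_
  filter_upwards [MeasureTheory.ae_restrict_of_ae (ae_sliceDisc_ne_zero hk.lt)] with θ hθ
  exact norm_integrand_le hk le_rfl x hθ

lemma tendsto_resolventKernel_integral {k : ℝ} (hk : Admissible k) (x : ℤ × ℤ) :
    Tendsto (fun ε => resolventKernel k ε x) (𝓝[>] 0)
      (𝓝 ((2 * (Real.pi : ℂ))⁻¹ * ∫ θ in (-Real.pi)..Real.pi, greenIntegrand k x θ)) := by
  have h : Tendsto (fun ε : ℝ => (2 * (Real.pi : ℂ))⁻¹ * ∫ θ in (-Real.pi)..Real.pi,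
      Complex.exp (Complex.I * (x.1 * θ)) *
        (slicePow (6 - k ^ 2) ε x.2 θ * (Complex.I * sliceW (6 - k ^ 2) ε θ)⁻¹)) (𝓝[>] 0)
      (𝓝 ((2 * (Real.pi : ℂ))⁻¹ * ∫ θ in (-Real.pi)..Real.pi, greenIntegrand k x θ)) := by
    refine Tendsto.const_mul _ ?_
    refine intervalIntegral.tendsto_integral_filter_of_dominated_convergence
      (fun θ => (Real.sqrt |sliceDisc (6 - k ^ 2) θ|)⁻¹) ?_ ?_
      (intervalIntegrable_inv_sqrt_sliceDisc hk.lt hk.ne hk.ne_six _ _) ?_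
    · filter_upwards [self_mem_nhdsWithin] with ε hε
      exact (measurable_greenIntegrand hk (le_of_lt hε) x).aestronglyMeasurable
    · filter_upwards [self_mem_nhdsWithin] with ε hε
      filter_upwards [ae_sliceDisc_ne_zero hk.lt] with θ hθ _
      exact norm_integrand_le hk (le_of_lt hε) x hθ
    · filter_upwards [ae_sliceDisc_ne_zero hk.lt] with θ hθ _
      refine Tendsto.const_mul _ ((tendsto_slicePow hk.ne x.2 θ).mul (Tendsto.inv₀
        ((tendsto_sliceW _ θ).const_mul _) (mul_ne_zero Complex.I_ne_zero
          (sliceW_zero_ne_zero hθ))))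
  refine h.congr' ?_
  filter_upwards [self_mem_nhdsWithin] with ε hε
  exact (resolventKernel_eq hk.2.2 hε x).symm

lemma green_eq {k : ℝ} (hk : Admissible k) (x : ℤ × ℤ) :
    green k x = (2 * (Real.pi : ℂ))⁻¹ * ∫ θ in (-Real.pi)..Real.pi, greenIntegrand k x θ :=
  (tendsto_resolventKernel_integral hk x).limUnder_eq

/-- The limiting absorption principle for the lattice Green's function: the slice integrands are
dominated by the inverse square root of the discriminant, uniformly in `ε`. -/
lemma tendsto_resolventKernel {k : ℝ} (hk : Admissible k) (x : ℤ × ℤ) :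
    Tendsto (fun ε => resolventKernel k ε x) (𝓝[>] 0) (𝓝 (green k x)) := by
  rw [green_eq hk]
  exact tendsto_resolventKernel_integral hk x

/-! ### Symmetries of the Green's function -/

lemma slicePow_neg (b ε : ℝ) (t : ℤ) (θ : ℝ) : slicePow b ε (-t) θ = slicePow b ε t (-θ) := by
  rcases lt_trichotomy t 0 with h | h | h
  · have h1 : ¬ (0 ≤ t) := by omega
    have h2 : 0 ≤ -t := by omega
    simp [slicePow, h1, h.le]
  · subst h; simp [slicePow]
  · have h2 : ¬ (0 ≤ -t) := by omega
    simp [slicePow, h.le, h.not_ge]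

lemma slicePow_reflect (b ε : ℝ) (t : ℤ) (θ : ℝ) :
    slicePow b ε t (-θ) = Complex.exp (-(Complex.I * (t * θ))) * slicePow b ε t θ := by
  unfold slicePow
  split_ifs with h
  · obtain ⟨n, rfl⟩ := Int.eq_ofNat_of_zero_le h
    rw [sliceRoot_neg, mul_pow, ← Complex.exp_nat_mul]
    congr 2
    simp
    ring
  · obtain ⟨n, hn⟩ := Int.eq_ofNat_of_zero_le (show 0 ≤ -t by omega)
    have ht : t = -(n : ℤ) := by omega
    subst ht
    simp only [neg_neg, Int.toNat_natCast]
    rw [sliceRoot_neg, mul_pow, ← Complex.exp_nat_mul,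
      ← mul_assoc, ← Complex.exp_add]
    have : -(Complex.I * (((-(n : ℤ) : ℤ) : ℂ) * θ)) + n * -(Complex.I * θ) = 0 := by
      push_cast; ring
    rw [this]; simp

lemma green_neg {k : ℝ} (hk : Admissible k) (x : ℤ × ℤ) : green k (-x) = green k x := by
  rw [green_eq hk, green_eq hk]
  congr 1
  have := intervalIntegral.integral_comp_neg (a := -Real.pi) (b := Real.pi) (greenIntegrand k x)
  rw [neg_neg] at this
  rw [← this]
  refine intervalIntegral.integral_congr fun θ _ => ?_
  simp [greenIntegrand, slicePow_neg, sliceW_neg]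

lemma green_reflect {k : ℝ} (hk : Admissible k) (x : ℤ × ℤ) :
    green k (reflect x) = green k x := by
  rw [green_eq hk, green_eq hk]
  congr 1
  refine intervalIntegral.integral_congr fun θ _ => ?_
  simp only [greenIntegrand, reflect]
  rw [slicePow_neg, slicePow_reflect]
  have h1 : Complex.exp (Complex.I * (((x.1 + x.2 : ℤ) : ℂ) * θ)) *
      Complex.exp (-(Complex.I * (x.2 * θ))) = Complex.exp (Complex.I * (x.1 * θ)) := by
    rw [← Complex.exp_add]; congr 1; push_cast; ring
  rw [← h1]
  ring

lemma resolventKernel_swap (k : ℝ) {ε : ℝ} (hε : ε ≠ 0) (x : ℤ × ℤ) :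
    resolventKernel k ε x.swap = resolventKernel k ε x := by
  unfold resolventKernel
  congr 1
  have hc : Continuous fun p : ℝ × ℝ =>
      Complex.exp (Complex.I * ((x.1 : ℂ) * p.1 + (x.2 : ℂ) * p.2)) /
        symbol ((k : ℂ) ^ 2 + Complex.I * ε) (p.1, p.2) := by
    refine Continuous.div (by fun_prop) ?_ (fun p => symbol_ne_zero hε k _)
    unfold symbol
    fun_prop
  have hint : MeasureTheory.IntegrableOn (Function.uncurry fun ξ₁ ξ₂ : ℝ =>
      Complex.exp (Complex.I * ((x.1 : ℂ) * ξ₁ + (x.2 : ℂ) * ξ₂)) /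
        symbol ((k : ℂ) ^ 2 + Complex.I * ε) (ξ₁, ξ₂))
      (Set.uIoc (-Real.pi) Real.pi ×ˢ Set.uIoc (-Real.pi) Real.pi) := by
    refine MeasureTheory.IntegrableOn.mono_set ?_ (Set.prod_mono Set.uIoc_subset_uIcc
      Set.uIoc_subset_uIcc)
    exact ContinuousOn.integrableOn_compact (isCompact_uIcc.prod isCompact_uIcc)
      (by exact hc.continuousOn)
  rw [MeasureTheory.intervalIntegral_intervalIntegral_swap hint]
  refine intervalIntegral.integral_congr fun ξ₂ _ => ?_
  refine intervalIntegral.integral_congr fun ξ₁ _ => ?_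
  simp only [Prod.fst_swap, Prod.snd_swap, symbol]
  have e1 : Real.cos (ξ₂ - ξ₁) = Real.cos (ξ₁ - ξ₂) := by rw [← Real.cos_neg, neg_sub]
  rw [e1]
  congr 1
  · congr 2; ring
  · ring

lemma green_swap {k : ℝ} (hk : Admissible k) (x : ℤ × ℤ) : green k x.swap = green k x := by
  refine tendsto_nhds_unique (tendsto_resolventKernel hk x.swap)
    ((tendsto_resolventKernel hk x).congr' ?_)
  filter_upwards [self_mem_nhdsWithin] with ε hε
  exact (resolventKernel_swap k (ne_of_gt hε) x).symm

/-! ### The equation for the Green's function -/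

lemma sliceRoot_quadratic {b : ℝ} (hb : b ≠ -2) {ε : ℝ} (hε : 0 ≤ ε) (θ : ℝ) :
    (1 + Complex.exp (-(Complex.I * θ))) * sliceRoot b ε θ ^ 2 - sliceA b ε θ * sliceRoot b ε θ +
      (1 + Complex.exp (Complex.I * θ)) = 0 ∧
    2 * (1 + Complex.exp (-(Complex.I * θ))) * sliceRoot b ε θ =
      sliceA b ε θ + Complex.I * sliceW b ε θ := by
  have hB := slice_denom_ne_zero hb hε θ
  have hm := mul_conj_slice hε b θ
  have l1 : sliceRoot b ε θ * (sliceA b ε θ - Complex.I * sliceW b ε θ) =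
      2 * (1 + Complex.exp (Complex.I * θ)) := by
    rw [sliceRoot, div_mul_cancel₀ _ hB]
  have hr : (sliceRadius θ : ℂ) ^ 2 =
      4 * ((1 + Complex.exp (Complex.I * θ)) * (1 + Complex.exp (-(Complex.I * θ)))) := by
    rw [← Complex.ofReal_pow, sliceRadius_sq]
    have : Complex.exp (-(Complex.I * θ)) * Complex.exp (Complex.I * θ) = 1 := by
      rw [← Complex.exp_add]; simp
    push_cast
    have e : 8 * Complex.cos θ = 4 * (2 * Complex.cos θ) := by ring
    rw [e, Complex.two_cos]
    rw [mul_comm Complex.I] at *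
    rw [neg_mul]
    linear_combination (-4) * this
  rw [hr] at hm
  have h2 : 2 * (1 + Complex.exp (-(Complex.I * θ))) * sliceRoot b ε θ =
      sliceA b ε θ + Complex.I * sliceW b ε θ := by
    apply mul_right_cancel₀ hB
    linear_combination 2 * (1 + Complex.exp (-(Complex.I * θ))) * l1 - hm
  refine ⟨?_, h2⟩
  linear_combination (sliceRoot b ε θ / 2) * h2 - l1 / 2

lemma slicePow_recurrence {b : ℝ} (hb : b ≠ -2) {ε : ℝ} (hε : 0 ≤ ε) (θ : ℝ) (t : ℤ) :
    (1 + Complex.exp (-(Complex.I * θ))) * slicePow b ε (t + 1) θ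
      + (1 + Complex.exp (Complex.I * θ)) * slicePow b ε (t - 1) θ
      - sliceA b ε θ * slicePow b ε t θ = if t = 0 then Complex.I * sliceW b ε θ else 0 := by
  have q1 := sliceRoot_quadratic hb hε θ
  have q2 := sliceRoot_quadratic hb hε (-θ)
  rw [sliceA_neg, sliceW_neg] at q2
  push_cast at q2
  rw [mul_neg, neg_neg] at q2
  rcases lt_trichotomy t 0 with h | h | h
  · obtain ⟨n, hn⟩ := Int.eq_ofNat_of_zero_le (show 0 ≤ -t - 1 by omega)
    have ht : t = -((n + 1 : ℕ) : ℤ) := by push_cast; omega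
    have e1 : slicePow b ε (t + 1) θ = sliceRoot b ε (-θ) ^ n := by
      have : t + 1 = -(n : ℤ) := by omega
      rw [this, slicePow_neg, slicePow, if_pos (by omega)]; simp
    have e2 : slicePow b ε t θ = sliceRoot b ε (-θ) ^ (n + 1) := by
      rw [ht, slicePow_neg, slicePow, if_pos (by omega), Int.toNat_natCast]
    have e3 : slicePow b ε (t - 1) θ = sliceRoot b ε (-θ) ^ (n + 2) := by
      have : t - 1 = -((n + 2 : ℕ) : ℤ) := by push_cast; omega
      rw [this, slicePow_neg, slicePow, if_pos (by omega), Int.toNat_natCast]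
    rw [e1, e2, e3, if_neg h.ne]
    linear_combination sliceRoot b ε (-θ) ^ n * q2.1
  · subst h
    have e1 : slicePow b ε (0 + 1) θ = sliceRoot b ε θ := by simp [slicePow]
    have e2 : slicePow b ε 0 θ = 1 := by simp [slicePow]
    have e3 : slicePow b ε (0 - 1) θ = sliceRoot b ε (-θ) := by simp [slicePow]
    rw [e1, e2, e3, if_pos rfl]
    linear_combination q1.2 / 2 + q2.2 / 2
  · obtain ⟨n, hn⟩ := Int.eq_ofNat_of_zero_le (show 0 ≤ t - 1 by omega)
    have e1 : slicePow b ε (t + 1) θ = sliceRoot b ε θ ^ (n + 2) := by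
      have : t + 1 = ((n + 2 : ℕ) : ℤ) := by push_cast; omega
      rw [this, slicePow, if_pos (by omega), Int.toNat_natCast]
    have e2 : slicePow b ε t θ = sliceRoot b ε θ ^ (n + 1) := by
      have : t = ((n + 1 : ℕ) : ℤ) := by push_cast; omega
      rw [this, slicePow, if_pos (by omega), Int.toNat_natCast]
    have e3 : slicePow b ε (t - 1) θ = sliceRoot b ε θ ^ n := by
      rw [hn, slicePow, if_pos (by omega)]; simp
    rw [e1, e2, e3, if_neg h.ne']
    linear_combination sliceRoot b ε θ ^ n * q1.1

lemma exp_int_add (m n : ℤ) (θ : ℝ) : Complex.exp (Complex.I * (((m + n : ℤ) : ℂ) * θ)) =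
    Complex.exp (Complex.I * (m * θ)) * Complex.exp (Complex.I * (n * θ)) := by
  rw [← Complex.exp_add]; congr 1; push_cast; ring

lemma helmholtz_green {k : ℝ} (hk : Admissible k) (x : ℤ × ℤ) :
    helmholtz k (green k) x = if x = 0 then 1 else 0 := by
  have hI := intervalIntegrable_greenIntegrand hk
  have e : helmholtz k (green k) x = (2 * (Real.pi : ℂ))⁻¹ * ∫ θ in (-Real.pi)..Real.pi,
      ((∑ j : Fin 6, greenIntegrand k (x + dir j) θ) +
        ((k : ℂ) ^ 2 - 6) * greenIntegrand k x θ) := by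
    rw [intervalIntegral.integral_add (by
        have := IntervalIntegrable.sum (Finset.univ : Finset (Fin 6)) (fun j _ => hI (x + dir j))
        rwa [Finset.sum_fn] at this)
      ((hI x).const_mul _),
      intervalIntegral.integral_finsetSum (fun j _ => hI (x + dir j)),
      intervalIntegral.integral_const_mul, helmholtz, laplacian, mul_add, Finset.mul_sum]
    simp only [green_eq hk]
    ring
  have e2 : ∫ θ in (-Real.pi)..Real.pi, ((∑ j : Fin 6, greenIntegrand k (x + dir j) θ) +
        ((k : ℂ) ^ 2 - 6) * greenIntegrand k x θ) = ∫ θ in (-Real.pi)..Real.pi,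
        if x.2 = 0 then Complex.exp (Complex.I * (x.1 * θ)) else 0 := by
    refine intervalIntegral.integral_congr_ae ?_
    filter_upwards [ae_sliceDisc_ne_zero hk.lt] with θ hθ _
    have hw := sliceW_zero_ne_zero hθ
    have hrec := slicePow_recurrence hk.ne le_rfl θ x.2
    have hA : (k : ℂ) ^ 2 - 6 + Complex.exp (Complex.I * θ) + Complex.exp (-(Complex.I * θ)) =
        -sliceA (6 - k ^ 2) 0 θ := by
      rw [sliceA]
      push_cast
      rw [Complex.two_cos, mul_comm Complex.I, neg_mul]
      ring
    simp only [Fin.sum_univ_six, greenIntegrand, dir, Prod.fst_add, Prod.snd_add, exp_int_add]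
    simp only [Matrix.cons_val, add_zero, ← sub_eq_add_neg, Int.cast_one, Int.cast_zero, zero_mul,
      mul_zero, Complex.exp_zero, mul_one, one_mul, Int.cast_neg]
    have e5 : Complex.I * (-1 * (θ : ℂ)) = -(Complex.I * θ) := by ring
    rw [e5]
    generalize Complex.exp (Complex.I * (x.1 * θ)) = E at *
    generalize Complex.exp (Complex.I * θ) = e at *
    generalize Complex.exp (-(Complex.I * θ)) = e' at *
    split_ifs at hrec ⊢ with h0
    · field_simp
      linear_combination E * hrec + E * slicePow (6 - k ^ 2) 0 x.2 θ * hA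
    · field_simp
      linear_combination E * hrec + E * slicePow (6 - k ^ 2) 0 x.2 θ * hA
  rw [e, e2]
  have hpi : (2 * (Real.pi : ℂ)) ≠ 0 := by
    simp [Real.pi_ne_zero]
  by_cases h2 : x.2 = 0
  · simp only [h2, if_true]
    rw [integral_exp_int]
    by_cases h1 : x.1 = 0
    · rw [if_pos h1, if_pos (Prod.ext h1 h2), inv_mul_cancel₀ hpi]
    · rw [if_neg h1, if_neg (fun h => h1 (by rw [h]; rfl)), mul_zero]
  · rw [if_neg (fun h => h2 (by rw [h]; rfl))]
    simp [h2]

/-! ### Finite difference operators -/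

/-- The Laurent polynomials in two variables, as the algebra of finite difference operators. -/
abbrev DiffOp : Type := AddMonoidAlgebra ℂ (ℤ × ℤ)

/-- Translation of functions on the lattice. -/
noncomputable def translation : Multiplicative (ℤ × ℤ) →* Module.End ℂ (ℤ × ℤ → ℂ) where
  toFun m := LinearMap.funLeft ℂ ℂ (fun y => y + m.toAdd)
  map_one' := by ext F y; simp [LinearMap.funLeft_apply]
  map_mul' m n := by
    ext F y
    simp [LinearMap.funLeft_apply, add_assoc]

/-- The action of finite difference operators on functions. -/
noncomputable def diffAct : DiffOp →ₐ[ℂ] Module.End ℂ (ℤ × ℤ → ℂ) :=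
  AddMonoidAlgebra.lift ℂ _ _ translation

/-- The shift by `m`. -/
noncomputable def shift (m : ℤ × ℤ) : DiffOp := AddMonoidAlgebra.single m 1

lemma diffAct_single (m : ℤ × ℤ) (c : ℂ) (F : ℤ × ℤ → ℂ) (y : ℤ × ℤ) :
    diffAct (AddMonoidAlgebra.single m c) F y = c * F (y + m) := by
  simp [diffAct, AddMonoidAlgebra.lift_single, translation, LinearMap.funLeft_apply]

lemma diffAct_shift (m : ℤ × ℤ) (F : ℤ × ℤ → ℂ) (y : ℤ × ℤ) :
    diffAct (shift m) F y = F (y + m) := by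
  simp [shift, diffAct_single]

lemma shift_mul_shift (m n : ℤ × ℤ) : shift m * shift n = shift (m + n) := by
  simp [shift, AddMonoidAlgebra.single_mul_single]

lemma shift_zero : shift 0 = 1 := rfl

lemma diffOp_induction {motive : DiffOp → Prop} (a : DiffOp)
    (single : ∀ m c, motive (AddMonoidAlgebra.single m c))
    (add : ∀ a b, motive a → motive b → motive (a + b)) : motive a := by
  induction a using AddMonoidAlgebra.induction_linear with
  | zero => simpa using single 0 0
  | add a b ha hb => exact add a b ha hb
  | single m c => exact single m c

/-- The operator with symbol `2 cos ξ₁`. -/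
noncomputable def opX : DiffOp := shift (1, 0) + shift (-1, 0)

/-- The operator with symbol `2 cos ξ₂`. -/
noncomputable def opY : DiffOp := shift (0, 1) + shift (0, -1)

/-- The operator with symbol `2 cos (ξ₁ - ξ₂)`. -/
noncomputable def opZ : DiffOp := shift (1, -1) + shift (-1, 1)

/-- The discriminant of the symbol on the slices in direction `x`, as a finite difference
operator. -/
noncomputable def discOp (b : ℝ) (x : DiffOp) : DiffOp :=
  8 + 4 * x - (algebraMap ℂ DiffOp b - x) ^ 2

lemma opXYZ_relation :
    opX ^ 2 + opY ^ 2 + opZ ^ 2 - opX * opY * opZ - 4 = 0 := by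
  have h1 : shift (1, 0) * shift (-1, 0) = 1 := by rw [shift_mul_shift]; exact shift_zero
  have h2 : shift (0, 1) * shift (0, -1) = 1 := by rw [shift_mul_shift]; exact shift_zero
  have h3 : shift (1, -1) = shift (1, 0) * shift (0, -1) := by rw [shift_mul_shift]; rfl
  have h4 : shift (-1, 1) = shift (-1, 0) * shift (0, 1) := by rw [shift_mul_shift]; rfl
  rw [opX, opY, opZ, h3, h4]
  generalize shift (1, 0) = a at *
  generalize shift (-1, 0) = a' at *
  generalize shift (0, 1) = c at *
  generalize shift (0, -1) = c' at *
  linear_combination (2 - c ^ 2 - c' ^ 2) * h1 + (2 - a ^ 2 - a' ^ 2) * h2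

/-- The slice discriminants in two directions and the symbol have no common zero: they generate
the unit ideal. With `b = 6 - k²` and `x`, `y`, `z` twice the cosines of `ξ₁`, `ξ₂`, `ξ₁ - ξ₂`, the
last hypothesis is the addition theorem. -/
lemma one_eq_zero_of_relations {Q : Type*} [CommRing Q] [Algebra ℂ Q] {b : ℝ} (hb1 : b ≠ -2)
    (hb2 : b ≠ 6) (hb3 : b ≠ -3) {x y z : Q}
    (hx : 8 + 4 * x - (algebraMap ℂ Q b - x) ^ 2 = 0)
    (hy : 8 + 4 * y - (algebraMap ℂ Q b - y) ^ 2 = 0)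
    (hs : x + y + z - algebraMap ℂ Q b = 0)
    (hR : x ^ 2 + y ^ 2 + z ^ 2 - x * y * z - 4 = 0) : (1 : Q) = 0 := by
  have hunit : ∀ c : ℂ, c ≠ 0 → ∀ q : Q, algebraMap ℂ Q c * q = 0 → q = 0 := by
    intro c hc q h
    have : algebraMap ℂ Q c⁻¹ * (algebraMap ℂ Q c * q) = q := by
      rw [← mul_assoc, ← map_mul, inv_mul_cancel₀ hc, map_one, one_mul]
    rw [← this, h, mul_zero]
  have hz : z = algebraMap ℂ Q b - x - y := by linear_combination hs
  subst hz
  -- modulo the discriminant in `x`, the addition theorem makes `2 y + x - b` nilpotent, as `2 + x` is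
  -- invertible for `b ≠ -2`
  have nil : ∀ x y : Q, 8 + 4 * x - (algebraMap ℂ Q b - x) ^ 2 = 0 →
      x ^ 2 + y ^ 2 + (algebraMap ℂ Q b - x - y) ^ 2 - x * y * (algebraMap ℂ Q b - x - y) - 4 = 0 →
      (2 * y + x - algebraMap ℂ Q b) ^ 2 = 0 := by
    intro x y hx hR
    have h1 : (2 + x) * (2 * y + x - algebraMap ℂ Q b) ^ 2 = 0 := by
      linear_combination 4 * hR + (2 - x) * hx
    refine hunit ((b + 2) ^ 2) (pow_ne_zero 2 fun h => hb1 ?_) _ ?_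
    · have : ((b + 2 : ℝ) : ℂ) = 0 := by push_cast; exact h
      have := Complex.ofReal_eq_zero.1 this
      linarith
    · rw [map_pow, map_add, map_ofNat]
      linear_combination (4 + 2 * (algebraMap ℂ Q b + 2) - (2 + x)) * h1
        - (2 * y + x - algebraMap ℂ Q b) ^ 2 * hx
  have n1 := nil x y hx hR
  have n2 := nil y x hy (by linear_combination hR)
  set β := algebraMap ℂ Q b with hβ
  -- both differences being nilpotent, `3 x - b` is nilpotent
  have hν : (3 * x - β) ^ 3 = 0 := by
    have e : 3 * x - β = 2 * (2 * x + y - β) - (2 * y + x - β) := by ring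
    rw [e]
    generalize 2 * x + y - β = u at *
    generalize 2 * y + x - β = v at *
    linear_combination (8 * u - 12 * v) * n2 + (6 * u - v) * n1
  -- but modulo `3 x - b` the discriminant is the nonzero constant `4 (6 - b) (3 + b) / 9`
  have hd : 4 * (6 - β) * (3 + β) = -((3 * x - β) * (12 + 4 * β - (3 * x - β))) := by
    linear_combination 9 * hx
  have hd3 : (4 * (6 - β) * (3 + β)) ^ 3 = 0 := by
    rw [hd]; linear_combination (-(12 + 4 * β - (3 * x - β)) ^ 3) * hν
  refine hunit ((4 * (6 - b) * (3 + b)) ^ 3) (pow_ne_zero 3 ?_) 1 ?_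
  · have h : ((4 * (6 - b) * (3 + b) : ℝ) : ℂ) ≠ 0 := by
      rw [Complex.ofReal_ne_zero]
      exact mul_ne_zero (mul_ne_zero (by norm_num) (fun h => hb2 (by linarith)))
        (fun h => hb3 (by linarith))
    push_cast at h
    exact h
  · rw [mul_one]
    simp only [map_pow, map_mul, map_sub, map_add, map_ofNat]
    exact hd3

/-! ### Square sums over slices and boxes -/

/-- Bessel's inequality for the Fourier coefficients on `(-π, π)`. -/
lemma bessel {φ : ℝ → ℂ} (hφ : Continuous φ) {M : ℝ} (hM : ∀ θ, ‖φ θ‖ ^ 2 ≤ M) (F : Finset ℤ) :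
    ∑ m ∈ F, ‖(2 * (Real.pi : ℂ))⁻¹ * ∫ θ in (-Real.pi)..Real.pi,
      Complex.exp (Complex.I * (m * θ)) * φ θ‖ ^ 2 ≤ M := by
  have hpi := Real.pi_pos
  have hab : -Real.pi < Real.pi := by linarith
  have hL2 : MeasureTheory.MemLp φ 2 (MeasureTheory.volume.restrict (Set.Ioc (-Real.pi) Real.pi)) := by
    refine (MeasureTheory.MemLp.of_bound (C := Real.sqrt M) hφ.aestronglyMeasurable
      (Filter.Eventually.of_forall fun θ => ?_))
    exact Real.le_sqrt_of_sq_le (hM θ)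
  have hP := hasSum_sq_fourierCoeffOn hab hL2
  have hcoef : ∀ m : ℤ, (2 * (Real.pi : ℂ))⁻¹ * ∫ θ in (-Real.pi)..Real.pi,
      Complex.exp (Complex.I * (m * θ)) * φ θ = fourierCoeffOn hab φ (-m) := by
    intro m
    rw [fourierCoeffOn_eq_integral]
    have e : (1 / (Real.pi - -Real.pi) : ℝ) = (2 * Real.pi)⁻¹ := by rw [one_div]; ring_nf
    rw [e, Complex.real_smul]
    push_cast
    congr 1
    refine intervalIntegral.integral_congr fun θ _ => ?_
    simp only [neg_neg, fourier_coe_apply, smul_eq_mul]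
    congr 2
    have : (Real.pi : ℂ) ≠ 0 := by exact_mod_cast hpi.ne'
    push_cast
    field_simp
    ring
  have hle : ∑ m ∈ F, ‖fourierCoeffOn hab φ (-m)‖ ^ 2 ≤
      (Real.pi - -Real.pi)⁻¹ • ∫ x in (-Real.pi)..Real.pi, ‖φ x‖ ^ 2 := by
    have := (Equiv.neg ℤ).hasSum_iff.2 hP
    exact sum_le_hasSum F (fun i _ => by positivity) this
  simp only [hcoef]
  refine hle.trans ?_
  have hi : ∫ x in (-Real.pi)..Real.pi, ‖φ x‖ ^ 2 ≤ ∫ x in (-Real.pi)..Real.pi, M :=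
    intervalIntegral.integral_mono hab.le (Continuous.intervalIntegrable (by fun_prop) _ _)
      intervalIntegrable_const (fun θ => hM θ)
  rw [intervalIntegral.integral_const, smul_eq_mul] at hi
  rw [smul_eq_mul, inv_mul_le_iff₀ (by linarith)]
  exact hi

/-- The box of half-width `R`. -/
noncomputable def box (R : ℕ) : Finset (ℤ × ℤ) := Finset.Icc (-(R : ℤ)) R ×ˢ Finset.Icc (-(R : ℤ)) R

lemma mem_box {R : ℕ} {y : ℤ × ℤ} : y ∈ box R ↔ |y.1| ≤ R ∧ |y.2| ≤ R := by
  simp [box, abs_le]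

/-- Functions whose square sums over boxes grow at most linearly. -/
def LinearGrowth (F : ℤ × ℤ → ℂ) : Prop :=
  ∃ C : ℝ, 0 ≤ C ∧ ∀ R : ℕ, ∑ y ∈ box R, ‖F y‖ ^ 2 ≤ C * (R + 1)

lemma LinearGrowth.add {F G : ℤ × ℤ → ℂ} (hF : LinearGrowth F) (hG : LinearGrowth G) :
    LinearGrowth (F + G) := by
  obtain ⟨C, hC, h1⟩ := hF
  obtain ⟨D, hD, h2⟩ := hG
  refine ⟨2 * C + 2 * D, by positivity, fun R => ?_⟩
  calc ∑ y ∈ box R, ‖(F + G) y‖ ^ 2 ≤ ∑ y ∈ box R, (2 * ‖F y‖ ^ 2 + 2 * ‖G y‖ ^ 2) := by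
        refine Finset.sum_le_sum fun y _ => ?_
        have := norm_add_le (F y) (G y)
        rw [Pi.add_apply]
        nlinarith [sq_nonneg (‖F y‖ - ‖G y‖), norm_nonneg (F y + G y)]
    _ ≤ _ := by
        rw [Finset.sum_add_distrib, ← Finset.mul_sum, ← Finset.mul_sum]
        linarith [h1 R, h2 R]

lemma LinearGrowth.const_mul_translate {F : ℤ × ℤ → ℂ} (hF : LinearGrowth F) (c : ℂ) (m : ℤ × ℤ) :
    LinearGrowth (fun y => c * F (y + m)) := by
  obtain ⟨C, hC, h1⟩ := hF
  set K := m.1.natAbs + m.2.natAbs with hK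
  refine ⟨‖c‖ ^ 2 * (C * (K + 1)), by positivity, fun R => ?_⟩
  simp only [norm_mul, mul_pow]
  rw [← Finset.mul_sum, mul_assoc]
  refine mul_le_mul_of_nonneg_left ?_ (by positivity)
  have hinj : Function.Injective fun y : ℤ × ℤ => y + m := add_left_injective m
  have h2 : ∑ y ∈ box R, ‖F (y + m)‖ ^ 2 = ∑ y ∈ (box R).image (fun y => y + m), ‖F y‖ ^ 2 :=
    (Finset.sum_image (f := fun y => ‖F y‖ ^ 2) (fun _ _ _ _ h => hinj h)).symm
  have h3 : (box R).image (fun y => y + m) ⊆ box (R + K) := by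
    intro y hy
    obtain ⟨z, hz, rfl⟩ := Finset.mem_image.1 hy
    rw [mem_box, abs_le, abs_le] at hz
    rw [mem_box, abs_le, abs_le]
    simp only [Prod.fst_add, Prod.snd_add]
    omega
  rw [h2]
  refine (Finset.sum_le_sum_of_subset_of_nonneg h3 fun _ _ _ => by positivity).trans ((h1 _).trans ?_)
  push_cast
  rw [mul_assoc]
  refine mul_le_mul_of_nonneg_left ?_ hC
  have : (0 : ℝ) ≤ R := by positivity
  have : (0 : ℝ) ≤ (m.1.natAbs : ℝ) + m.2.natAbs := by positivity
  rw [hK]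
  push_cast
  nlinarith

lemma LinearGrowth.diffAct {F : ℤ × ℤ → ℂ} (hF : LinearGrowth F) (a : DiffOp) :
    LinearGrowth (diffAct a F) := by
  induction a using diffOp_induction with
  | single m c =>
    have : TriLattice.diffAct (AddMonoidAlgebra.single m c) F = fun y => c * F (y + m) := by
      ext y; rw [diffAct_single]
    rw [this]
    exact hF.const_mul_translate c m
  | add a b ha hb =>
    rw [map_add, LinearMap.add_apply]
    exact ha.add hb

/-- The operators that take `F` to a function of linear growth. -/
noncomputable def growthIdeal (F : ℤ × ℤ → ℂ) : Ideal DiffOp where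
  carrier := {a | LinearGrowth (diffAct a F)}
  add_mem' {a b} ha hb := by
    change LinearGrowth _
    rw [map_add, LinearMap.add_apply]
    exact LinearGrowth.add ha hb
  zero_mem' := by
    refine ⟨0, le_rfl, fun R => ?_⟩
    simp
  smul_mem' c a ha := by
    change LinearGrowth _
    rw [smul_eq_mul, map_mul, Module.End.mul_apply]
    exact LinearGrowth.diffAct ha c

/-- The operators that map `F` to a function of linear growth form an ideal; it is enough to find
generators of the unit ideal in it. -/
lemma linearGrowth_of_discOp {b : ℝ} (hb1 : b ≠ -2) (hb2 : b ≠ 6) (hb3 : b ≠ -3)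
    {F : ℤ × ℤ → ℂ} (hX : LinearGrowth (diffAct (discOp b opX) F))
    (hY : LinearGrowth (diffAct (discOp b opY) F))
    (hs : LinearGrowth (diffAct (opX + opY + opZ - algebraMap ℂ DiffOp b) F)) :
    LinearGrowth F := by
  have key : (1 : DiffOp ⧸ growthIdeal F) = 0 := by
    have mX : Ideal.Quotient.mk (growthIdeal F) (discOp b opX) = 0 :=
      Ideal.Quotient.eq_zero_iff_mem.2 hX
    have mY : Ideal.Quotient.mk (growthIdeal F) (discOp b opY) = 0 :=
      Ideal.Quotient.eq_zero_iff_mem.2 hY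
    have ms : Ideal.Quotient.mk (growthIdeal F) (opX + opY + opZ - algebraMap ℂ DiffOp b) = 0 :=
      Ideal.Quotient.eq_zero_iff_mem.2 hs
    have mR := congrArg (Ideal.Quotient.mk (growthIdeal F)) opXYZ_relation
    simp only [discOp, map_sub, map_add, map_mul, map_pow, map_ofNat, map_zero] at mX mY ms mR
    exact one_eq_zero_of_relations hb1 hb2 hb3 mX mY ms mR
  have h1 : (1 : DiffOp) ∈ growthIdeal F := by
    rw [← Ideal.Quotient.eq_zero_iff_mem, map_one]; exact key
  have h2 : LinearGrowth (diffAct 1 F) := h1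
  rwa [map_one] at h2

/-! ### Symbols of difference operators and operators along the rows -/

/-- The character `m ↦ exp(i m·ξ)` of the lattice. -/
noncomputable def character (ξ : ℝ × ℝ) : Multiplicative (ℤ × ℤ) →* ℂ where
  toFun m := Complex.exp (Complex.I * (m.toAdd.1 * ξ.1 + m.toAdd.2 * ξ.2))
  map_one' := by simp
  map_mul' m n := by
    rw [← Complex.exp_add]
    congr 1
    simp only [toAdd_mul, Prod.fst_add, Prod.snd_add]
    push_cast
    ring

/-- The symbol of a finite difference operator. -/
noncomputable def opSymbol (ξ : ℝ × ℝ) : DiffOp →ₐ[ℂ] ℂ :=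
  AddMonoidAlgebra.lift ℂ _ _ (character ξ)

lemma opSymbol_single (ξ : ℝ × ℝ) (m : ℤ × ℤ) (c : ℂ) :
    opSymbol ξ (AddMonoidAlgebra.single m c) =
      c * Complex.exp (Complex.I * (m.1 * ξ.1 + m.2 * ξ.2)) := by
  simp [opSymbol, AddMonoidAlgebra.lift_single, character]

lemma opSymbol_shift (ξ : ℝ × ℝ) (m : ℤ × ℤ) :
    opSymbol ξ (shift m) = Complex.exp (Complex.I * (m.1 * ξ.1 + m.2 * ξ.2)) := by
  rw [shift, opSymbol_single, one_mul]

lemma continuous_opSymbol (a : DiffOp) : Continuous fun ξ => opSymbol ξ a := by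
  induction a using diffOp_induction with
  | single m c =>
    simp only [opSymbol_single]
    fun_prop
  | add a b ha hb =>
    simp only [map_add]
    exact ha.add hb

lemma two_cos_eq (θ : ℝ) : Complex.exp (Complex.I * θ) + Complex.exp (-(Complex.I * θ)) =
    2 * Real.cos θ := by
  rw [Complex.ofReal_cos, Complex.cos]
  ring_nf

lemma opSymbol_opX (ξ : ℝ × ℝ) : opSymbol ξ opX = 2 * Real.cos ξ.1 := by
  rw [← two_cos_eq, opX, map_add, opSymbol_shift, opSymbol_shift]
  simp

lemma opSymbol_opY (ξ : ℝ × ℝ) : opSymbol ξ opY = 2 * Real.cos ξ.2 := by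
  rw [← two_cos_eq, opY, map_add, opSymbol_shift, opSymbol_shift]
  simp

lemma opSymbol_opZ (ξ : ℝ × ℝ) : opSymbol ξ opZ = 2 * Real.cos (ξ.1 - ξ.2) := by
  rw [← two_cos_eq, opZ, map_add, opSymbol_shift, opSymbol_shift]
  push_cast
  ring_nf

lemma opSymbol_discOp (b : ℝ) (ξ : ℝ × ℝ) : opSymbol ξ (discOp b opX) = sliceDisc b ξ.1 := by
  simp only [discOp, map_sub, map_add, map_mul, map_pow, map_ofNat, opSymbol_opX,
    AlgHom.commutes, Algebra.algebraMap_self, RingHom.id_apply, sliceDisc]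
  push_cast
  ring

/-- The Helmholtz operator as a finite difference operator. -/
noncomputable def helmholtzOp (k : ℝ) : DiffOp :=
  opX + opY + opZ - algebraMap ℂ DiffOp ((6 - k ^ 2 : ℝ) : ℂ)

lemma diffAct_algebraMap (c : ℂ) (F : ℤ × ℤ → ℂ) (y : ℤ × ℤ) :
    diffAct (algebraMap ℂ DiffOp c) F y = c * F y := by
  rw [AlgHom.commutes, Module.algebraMap_end_apply, Pi.smul_apply, smul_eq_mul]

lemma diffAct_helmholtzOp (k : ℝ) (F : ℤ × ℤ → ℂ) : diffAct (helmholtzOp k) F = helmholtz k F := by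
  ext y
  simp only [helmholtzOp, opX, opY, opZ, map_sub, map_add, LinearMap.sub_apply,
    LinearMap.add_apply, Pi.sub_apply, Pi.add_apply, diffAct_shift, diffAct_algebraMap, helmholtz,
    laplacian, Fin.sum_univ_six, dir]
  simp
  ring

lemma opSymbol_helmholtzOp (k : ℝ) (ξ : ℝ × ℝ) :
    opSymbol ξ (helmholtzOp k) = symbol ((k : ℂ) ^ 2) ξ := by
  simp only [helmholtzOp, map_sub, map_add, opSymbol_opX, opSymbol_opY, opSymbol_opZ,
    AlgHom.commutes, Algebra.algebraMap_self, RingHom.id_apply, symbol]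
  push_cast
  ring

/-- The difference operators in the direction of the rows `y₂ = const`. -/
noncomputable def rowOps : Subalgebra ℂ DiffOp :=
  Algebra.adjoin ℂ (Set.range fun n : ℤ => shift (n, 0))

lemma shift_mem_rowOps (n : ℤ) : shift (n, 0) ∈ rowOps := Algebra.subset_adjoin ⟨n, rfl⟩

lemma discOp_mem_rowOps (b : ℝ) : discOp b opX ∈ rowOps := by
  have hX : opX ∈ rowOps := add_mem (shift_mem_rowOps 1) (shift_mem_rowOps (-1))
  have h8 : (8 : DiffOp) ∈ rowOps := ofNat_mem rowOps 8
  have h4 : (4 : DiffOp) ∈ rowOps := ofNat_mem rowOps 4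
  exact sub_mem (add_mem h8 (mul_mem h4 hX))
    (pow_mem (sub_mem (Subalgebra.algebraMap_mem _ _) hX) 2)

/-- The function on the lattice whose rows have the Fourier densities `Φ t`. -/
noncomputable def rowSynth (Φ : ℤ → ℝ → ℂ) (y : ℤ × ℤ) : ℂ :=
  (2 * (Real.pi : ℂ))⁻¹ * ∫ θ in (-Real.pi)..Real.pi, Complex.exp (Complex.I * (y.1 * θ)) * Φ y.2 θ

lemma intervalIntegrable_exp_mul {φ : ℝ → ℂ}
    (h : IntervalIntegrable φ MeasureTheory.volume (-Real.pi) Real.pi) (n : ℤ) :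
    IntervalIntegrable (fun θ => Complex.exp (Complex.I * (n * θ)) * φ θ) MeasureTheory.volume
      (-Real.pi) Real.pi :=
  h.continuousOn_mul (Continuous.continuousOn (by fun_prop))

lemma diffAct_rowSynth {a : DiffOp} (ha : a ∈ rowOps) {Φ : ℤ → ℝ → ℂ}
    (hΦ : ∀ t, IntervalIntegrable (Φ t) MeasureTheory.volume (-Real.pi) Real.pi) :
    diffAct a (rowSynth Φ) = rowSynth fun t θ => opSymbol (θ, 0) a * Φ t θ := by
  have hint : ∀ (a : DiffOp) {Φ : ℤ → ℝ → ℂ},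
      (∀ t, IntervalIntegrable (Φ t) MeasureTheory.volume (-Real.pi) Real.pi) →
      ∀ t, IntervalIntegrable (fun θ => opSymbol (θ, 0) a * Φ t θ) MeasureTheory.volume
        (-Real.pi) Real.pi := fun a Φ h t =>
    (h t).continuousOn_mul
      ((continuous_opSymbol a).comp (by fun_prop : Continuous fun θ : ℝ => (θ, (0 : ℝ)))).continuousOn
  induction ha using Algebra.adjoin_induction generalizing Φ with
  | mem x hx =>
    obtain ⟨n, rfl⟩ := hx
    ext y
    simp only [diffAct_shift, rowSynth, Prod.fst_add, Prod.snd_add, add_zero]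
    congr 1
    refine intervalIntegral.integral_congr fun θ _ => ?_
    simp only [exp_int_add, opSymbol_shift]
    simp only [Complex.ofReal_zero, mul_zero, add_zero]
    ring
  | algebraMap r =>
    ext y
    rw [diffAct_algebraMap]
    simp only [rowSynth, AlgHom.commutes, Algebra.algebraMap_self, RingHom.id_apply]
    rw [mul_left_comm, ← intervalIntegral.integral_const_mul]
    congr 1
    refine intervalIntegral.integral_congr fun θ _ => ?_
    ring
  | add x y _ _ hx hy =>
    ext z
    rw [map_add, LinearMap.add_apply, hx hΦ, hy hΦ, Pi.add_apply]
    simp only [rowSynth]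
    rw [← mul_add, ← intervalIntegral.integral_add (intervalIntegrable_exp_mul (hint x hΦ _) _)
      (intervalIntegrable_exp_mul (hint y hΦ _) _)]
    congr 1
    refine intervalIntegral.integral_congr fun θ _ => ?_
    simp only [map_add]
    ring
  | mul x y _ _ hx hy =>
    rw [map_mul, Module.End.mul_apply, hy hΦ, hx (hint y hΦ)]
    simp only [map_mul, mul_assoc]

/-- Continuous `2π`-periodic functions are uniformly approximated by symbols of row operators. -/
lemma exists_rowOp_approx {f : ℝ → ℂ} (hf : Continuous f) (hp : ∀ θ, f (θ + 2 * Real.pi) = f θ)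
    {τ : ℝ} (hτ : 0 < τ) : ∃ a ∈ rowOps, ∀ ξ : ℝ × ℝ, ‖f ξ.1 - opSymbol ξ a‖ ≤ τ := by
  have : Fact (0 < 2 * Real.pi) := ⟨by positivity⟩
  have hper : Function.Periodic f (2 * Real.pi) := hp
  let g : C(AddCircle (2 * Real.pi), ℂ) :=
    ⟨hper.lift, continuous_coinduced_dom.2 hf⟩
  have hg : g ∈ (Submodule.span ℂ (Set.range (@fourier (2 * Real.pi)))).topologicalClosure := by
    rw [span_fourier_closure_eq_top]; trivial
  obtain ⟨p, hp, hd⟩ := Metric.mem_closure_iff.1 hg τ hτ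
  have key : ∃ a ∈ rowOps, ∀ ξ : ℝ × ℝ, opSymbol ξ a = p (ξ.1 : AddCircle (2 * Real.pi)) := by
    clear hd
    induction hp using Submodule.span_induction with
    | mem x hx =>
      obtain ⟨n, rfl⟩ := hx
      refine ⟨shift (n, 0), shift_mem_rowOps n, fun ξ => ?_⟩
      rw [opSymbol_shift, fourier_coe_apply]
      congr 1
      have : (Real.pi : ℂ) ≠ 0 := by exact_mod_cast Real.pi_pos.ne'
      push_cast
      field_simp
      ring
    | zero => exact ⟨0, zero_mem _, fun ξ => by simp⟩
    | add x y _ _ hx hy =>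
      obtain ⟨a, ha, ha'⟩ := hx
      obtain ⟨c, hc, hc'⟩ := hy
      exact ⟨a + c, add_mem ha hc, fun ξ => by simp [ha', hc']⟩
    | smul r x _ hx =>
      obtain ⟨a, ha, ha'⟩ := hx
      exact ⟨r • a, Subalgebra.smul_mem _ ha r, fun ξ => by simp [ha']⟩
  obtain ⟨a, ha, ha'⟩ := key
  refine ⟨a, ha, fun ξ => ?_⟩
  rw [ha' ξ, ← dist_eq_norm]
  exact (ContinuousMap.dist_apply_le_dist (f := g) (g := p) (ξ.1 : AddCircle (2 * Real.pi))).trans hd.le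

/-! ### Square sums of the Green's function -/

/-- The density `sliceRoot ^ t / (i sliceW)` of the Green's function on the row `t`. -/
noncomputable def greenDensity (k : ℝ) (t : ℤ) (θ : ℝ) : ℂ :=
  slicePow (6 - k ^ 2) 0 t θ * (Complex.I * sliceW (6 - k ^ 2) 0 θ)⁻¹

/-- The density of `discOp` applied to the Green's function: multiplication by the discriminant
turns the singular factor `1 / (i sliceW)` into a bounded one. -/
noncomputable def regularDensity (k : ℝ) (t : ℤ) (θ : ℝ) : ℂ :=
  slicePow (6 - k ^ 2) 0 t θ * (-Complex.I * sliceW (6 - k ^ 2) 0 θ)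

lemma green_eq_rowSynth {k : ℝ} (hk : Admissible k) : green k = rowSynth (greenDensity k) := by
  ext x
  rw [green_eq hk]
  rfl

lemma intervalIntegrable_greenDensity {k : ℝ} (hk : Admissible k) (t : ℤ) :
    IntervalIntegrable (greenDensity k t) MeasureTheory.volume (-Real.pi) Real.pi := by
  refine (intervalIntegrable_greenIntegrand hk (0, t)).congr fun θ _ => ?_
  simp [greenIntegrand, greenDensity]

lemma continuous_regularDensity {k : ℝ} (hk : Admissible k) (t : ℤ) :
    Continuous (regularDensity k t) := by
  have h1 := continuous_slicePow hk.ne le_rfl t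
  have h2 := continuous_sliceW_right (6 - k ^ 2) 0
  unfold regularDensity
  fun_prop

lemma diffAct_discOp_green {k : ℝ} (hk : Admissible k) :
    diffAct (discOp (6 - k ^ 2) opX) (green k) = rowSynth (regularDensity k) := by
  rw [green_eq_rowSynth hk, diffAct_rowSynth (discOp_mem_rowOps _)
    (intervalIntegrable_greenDensity hk)]
  congr 1
  ext t θ
  rw [opSymbol_discOp]
  simp only [greenDensity, regularDensity]
  rw [← sliceW_sq_zero]
  by_cases h : sliceW (6 - k ^ 2) 0 θ = 0
  · simp [h]
  · field_simp
    linear_combination slicePow (6 - k ^ 2) 0 t θ * Complex.I_sq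

lemma exists_sliceW_sq_le (b : ℝ) : ∃ M : ℝ, 0 < M ∧ ∀ θ, ‖sliceW b 0 θ‖ ^ 2 ≤ M := by
  refine ⟨16 + (|b| + 2) ^ 2, by positivity, fun θ => ?_⟩
  rw [← norm_pow, sliceW_sq_zero, Complex.norm_real, Real.norm_eq_abs, sliceDisc, abs_le]
  have h1 := Real.neg_one_le_cos θ
  have h2 := Real.cos_le_one θ
  have h3 : (b - 2 * Real.cos θ) ^ 2 ≤ (|b| + 2) ^ 2 := by
    rw [sq_le_sq, abs_of_nonneg (by positivity : 0 ≤ |b| + 2), abs_le]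
    constructor <;> linarith [neg_abs_le b, le_abs_self b]
  constructor <;> nlinarith

lemma exists_row_sum_regular_le {k : ℝ} (hk : Admissible k) : ∃ M : ℝ, 0 < M ∧
    ∀ (t : ℤ) (F : Finset ℤ), ∑ m ∈ F, ‖rowSynth (regularDensity k) (m, t)‖ ^ 2 ≤ M := by
  obtain ⟨M, hM, h⟩ := exists_sliceW_sq_le (6 - k ^ 2)
  refine ⟨M, hM, fun t F => bessel (continuous_regularDensity hk t) (fun θ => ?_) F⟩
  rw [regularDensity, norm_mul, mul_pow, norm_mul, norm_neg, Complex.norm_I, one_mul]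
  have h1 := norm_slicePow_le hk.ne le_rfl t θ
  have h2 : ‖slicePow (6 - k ^ 2) 0 t θ‖ ^ 2 ≤ 1 := pow_le_one₀ (norm_nonneg _) h1
  nlinarith [h θ, sq_nonneg ‖sliceW (6 - k ^ 2) 0 θ‖]

lemma sum_box_le_of_row_sum {F : ℤ × ℤ → ℂ} {M : ℝ} (hM : 0 ≤ M)
    (h : ∀ (t : ℤ) (A : Finset ℤ), ∑ m ∈ A, ‖F (m, t)‖ ^ 2 ≤ M) (R : ℕ) :
    ∑ y ∈ box R, ‖F y‖ ^ 2 ≤ 2 * M * (R + 1) := by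
  rw [box, Finset.sum_product_right]
  refine (Finset.sum_le_card_nsmul _ _ M fun t _ => h t _).trans ?_
  rw [Int.card_Icc, nsmul_eq_mul]
  have : (((R : ℤ) + 1 - -R).toNat : ℝ) = 2 * R + 1 := by
    have : ((R : ℤ) + 1 - -R).toNat = 2 * R + 1 := by omega
    rw [this]; push_cast; ring
  rw [this]
  nlinarith

lemma linearGrowth_of_row_sum {F : ℤ × ℤ → ℂ} {M : ℝ} (hM : 0 ≤ M)
    (h : ∀ (t : ℤ) (A : Finset ℤ), ∑ m ∈ A, ‖F (m, t)‖ ^ 2 ≤ M) : LinearGrowth F :=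
  ⟨2 * M, by positivity, sum_box_le_of_row_sum hM h⟩

lemma diffAct_discOp_swap (b : ℝ) (F : ℤ × ℤ → ℂ) (y : ℤ × ℤ) :
    diffAct (discOp b opY) F y = diffAct (discOp b opX) (fun z => F z.swap) y.swap := by
  have h8 : (8 : DiffOp) = algebraMap ℂ DiffOp 8 := (map_ofNat _ 8).symm
  have h4 : (4 : DiffOp) = algebraMap ℂ DiffOp 4 := (map_ofNat _ 4).symm
  simp only [discOp, h8, h4, opX, opY, map_sub, map_add, map_mul, pow_two, LinearMap.sub_apply,
    LinearMap.add_apply, Pi.sub_apply, Pi.add_apply, Module.End.mul_apply, diffAct_shift,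
    diffAct_algebraMap, Prod.swap, Prod.mk_add_mk, Prod.mk.eta]
  obtain ⟨p, q⟩ := y
  simp

/-- The square sums of the Green's function over boxes grow linearly: on the rows for `discOp` in
the first direction by Bessel, in the second direction by symmetry, and the Helmholtz operator
maps the Green's function to a point mass. -/
lemma linearGrowth_green {k : ℝ} (hk : Admissible k) : LinearGrowth (green k) := by
  obtain ⟨M, hM, h⟩ := exists_row_sum_regular_le hk
  have hX : LinearGrowth (diffAct (discOp (6 - k ^ 2) opX) (green k)) := by
    rw [diffAct_discOp_green hk]
    exact linearGrowth_of_row_sum hM.le h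
  refine linearGrowth_of_discOp hk.ne hk.ne_six (by linarith [hk.lt]) hX ?_ ?_
  · obtain ⟨C, hC, h1⟩ := hX
    refine ⟨C, hC, fun R => le_of_eq_of_le ?_ (h1 R)⟩
    refine Finset.sum_bij' (fun y _ => y.swap) (fun y _ => y.swap) ?_ ?_ ?_ ?_ ?_
    · intro y hy; rw [mem_box] at hy ⊢; exact ⟨hy.2, hy.1⟩
    · intro y hy; rw [mem_box] at hy ⊢; exact ⟨hy.2, hy.1⟩
    · intro y _; exact y.swap_swap
    · intro y _; exact y.swap_swap
    · intro y _
      rw [diffAct_discOp_swap]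
      have : (fun z : ℤ × ℤ => green k z.swap) = green k := funext (green_swap hk)
      rw [this]
  · have e : opX + opY + opZ - algebraMap ℂ DiffOp ((6 - k ^ 2 : ℝ) : ℂ) = helmholtzOp k := rfl
    rw [e, diffAct_helmholtzOp]
    refine ⟨1, zero_le_one, fun R => ?_⟩
    have e : ∀ y : ℤ × ℤ, ‖helmholtz k (green k) y‖ ^ 2 = if y = 0 then 1 else 0 := by
      intro y
      rw [helmholtz_green hk]
      split_ifs <;> simp
    simp only [e]
    rw [Finset.sum_ite_eq']
    have : (0 : ℝ) ≤ R := by positivity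
    split_ifs <;> linarith

lemma continuous_opSymbol_row (a : DiffOp) : Continuous fun θ : ℝ => opSymbol (θ, 0) a :=
  (continuous_opSymbol a).comp (by fun_prop : Continuous fun θ : ℝ => (θ, (0 : ℝ)))

lemma slicePow_succ {b : ℝ} {t : ℤ} (ht : 0 ≤ t) (θ : ℝ) :
    slicePow b 0 (t + 1) θ = sliceRoot b 0 θ * slicePow b 0 t θ := by
  have h1 : (t + 1).toNat = t.toNat + 1 := by omega
  rw [slicePow, slicePow, if_pos ht, if_pos (by omega : 0 ≤ t + 1), h1, pow_succ']

lemma sliceRoot_periodic (b θ : ℝ) : sliceRoot b 0 (θ + 2 * Real.pi) = sliceRoot b 0 θ := by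
  have h : Complex.exp (Complex.I * ((θ + 2 * Real.pi : ℝ) : ℂ)) = Complex.exp (Complex.I * θ) := by
    rw [← Complex.exp_periodic (Complex.I * θ)]
    congr 1
    push_cast
    ring
  simp only [sliceRoot, h, sliceA, sliceW, sliceRadius, Real.cos_add_two_pi]

/-- A kernel is outgoing in the upward direction if its square sums grow linearly and if, on the
rows above some height, the operator `(shift - a) discOp` nearly annihilates it, for row
operators `a` with symbols close to the decaying root `sliceRoot`. -/
def OutgoingKernel (b : ℝ) (F : ℤ × ℤ → ℂ) : Prop :=
  LinearGrowth F ∧ ∃ (s : ℤ) (M : ℝ), 0 < M ∧ ∀ τ : ℝ, 0 < τ → ∃ a : DiffOp,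
    (∀ ξ : ℝ × ℝ, ‖sliceRoot b 0 ξ.1 - opSymbol ξ a‖ ≤ τ) ∧
    ∀ t : ℤ, s ≤ t → ∀ A : Finset ℤ,
      ∑ m ∈ A, ‖diffAct ((shift (0, 1) - a) * discOp b opX) F (m, t)‖ ^ 2 ≤ M * τ ^ 2

/-- On the upper half of the lattice each row is obtained from the one below by multiplication of the
density with `sliceRoot`, so that the operator `shift - a` leaves the small factor
`sliceRoot - a`. -/
lemma outgoingKernel_green {k : ℝ} (hk : Admissible k) : OutgoingKernel (6 - k ^ 2) (green k) := by
  obtain ⟨M, hM, hW⟩ := exists_sliceW_sq_le (6 - k ^ 2)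
  refine ⟨linearGrowth_green hk, 0, M, hM, fun τ hτ => ?_⟩
  obtain ⟨a, ha, hd⟩ := exists_rowOp_approx (continuous_sliceRoot hk.ne le_rfl)
    (sliceRoot_periodic (6 - k ^ 2)) hτ
  refine ⟨a, hd, fun t ht A => ?_⟩
  have hint : ∀ t, IntervalIntegrable (regularDensity k t) MeasureTheory.volume
      (-Real.pi) Real.pi := fun t => (continuous_regularDensity hk t).intervalIntegrable _ _
  have e : ∀ m : ℤ, diffAct ((shift (0, 1) - a) * discOp (6 - k ^ 2) opX) (green k) (m, t) =
      (2 * (Real.pi : ℂ))⁻¹ * ∫ θ in (-Real.pi)..Real.pi, Complex.exp (Complex.I * (m * θ)) *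
        ((sliceRoot (6 - k ^ 2) 0 θ - opSymbol (θ, 0) a) * regularDensity k t θ) := by
    intro m
    rw [map_mul, Module.End.mul_apply, diffAct_discOp_green hk, map_sub, LinearMap.sub_apply,
      Pi.sub_apply, diffAct_shift, diffAct_rowSynth ha hint]
    simp only [rowSynth, Prod.mk_add_mk, add_zero]
    rw [← mul_sub, ← intervalIntegral.integral_sub (intervalIntegrable_exp_mul (hint _) _)
      (intervalIntegrable_exp_mul ((hint t).continuousOn_mul
        (continuous_opSymbol_row a).continuousOn) _)]
    congr 1
    refine intervalIntegral.integral_congr fun θ _ => ?_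
    simp only [regularDensity, slicePow_succ ht]
    ring
  simp only [e]
  refine bessel ?_ (fun θ => ?_) A
  · exact ((continuous_sliceRoot hk.ne le_rfl).sub (continuous_opSymbol_row a)).mul
      (continuous_regularDensity hk t)
  · have h1 := norm_slicePow_le hk.ne le_rfl t θ
    have h2 := hd (θ, 0)
    rw [regularDensity, norm_mul, norm_mul, norm_mul, norm_neg, Complex.norm_I, one_mul, mul_pow,
      mul_pow]
    have h3 : ‖slicePow (6 - k ^ 2) 0 t θ‖ ^ 2 ≤ 1 := pow_le_one₀ (norm_nonneg _) h1
    have h4 : ‖sliceRoot (6 - k ^ 2) 0 θ - opSymbol (θ, 0) a‖ ^ 2 ≤ τ ^ 2 :=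
      pow_le_pow_left₀ (norm_nonneg _) h2 2
    have h5 : ‖slicePow (6 - k ^ 2) 0 t θ‖ ^ 2 * ‖sliceW (6 - k ^ 2) 0 θ‖ ^ 2 ≤ M := by
      nlinarith [hW θ, sq_nonneg ‖sliceW (6 - k ^ 2) 0 θ‖]
    rw [mul_comm M]
    exact mul_le_mul h4 h5 (by positivity) (by positivity)

lemma diffAct_translate (a : DiffOp) (F : ℤ × ℤ → ℂ) (z y : ℤ × ℤ) :
    diffAct a (fun y => F (y + z)) y = diffAct a F (y + z) := by
  induction a using diffOp_induction with
  | single m c => rw [diffAct_single, diffAct_single, add_right_comm]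
  | add a b ha hb => simp only [map_add, LinearMap.add_apply, Pi.add_apply, ha, hb]

lemma OutgoingKernel.translate {b : ℝ} {F : ℤ × ℤ → ℂ} (hF : OutgoingKernel b F) (z : ℤ × ℤ) :
    OutgoingKernel b (fun y => F (y + z)) := by
  obtain ⟨hL, s, M, hM, h⟩ := hF
  refine ⟨by simpa using hL.const_mul_translate 1 z, s - z.2, M, hM, fun τ hτ => ?_⟩
  obtain ⟨a, ha, h⟩ := h τ hτ
  refine ⟨a, ha, fun t ht A => ?_⟩
  simp only [diffAct_translate]
  have e := h (t + z.2) (by omega) (A.image (· + z.1))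
  rw [Finset.sum_image (fun _ _ _ _ h => add_left_injective z.1 h)] at e
  exact e

/-! ### Decaying functions and slowly varying multipliers -/

/-- The weight `1 + |y₁| + |y₂|`. -/
noncomputable def nrm (y : ℤ × ℤ) : ℝ := 1 + |(y.1 : ℝ)| + |(y.2 : ℝ)|

lemma one_le_nrm (y : ℤ × ℤ) : 1 ≤ nrm y := by
  have := abs_nonneg (y.1 : ℝ)
  have := abs_nonneg (y.2 : ℝ)
  unfold nrm
  linarith

lemma nrm_pos (y : ℤ × ℤ) : 0 < nrm y := zero_lt_one.trans_le (one_le_nrm y)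

lemma nrm_neg (y : ℤ × ℤ) : nrm (-y) = nrm y := by simp [nrm]

lemma nrm_add_le (y a : ℤ × ℤ) : nrm (y + a) ≤ nrm a * nrm y := by
  have h1 := abs_add_le (y.1 : ℝ) a.1
  have h2 := abs_add_le (y.2 : ℝ) a.2
  have := abs_nonneg (y.1 : ℝ)
  have := abs_nonneg (y.2 : ℝ)
  have := abs_nonneg (a.1 : ℝ)
  have := abs_nonneg (a.2 : ℝ)
  simp only [nrm, Prod.fst_add, Prod.snd_add]
  push_cast
  nlinarith [mul_nonneg (add_nonneg (abs_nonneg (y.1 : ℝ)) (abs_nonneg (y.2 : ℝ)))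
    (add_nonneg (abs_nonneg (a.1 : ℝ)) (abs_nonneg (a.2 : ℝ)))]

lemma nrm_le_add (y a : ℤ × ℤ) : nrm y ≤ nrm a * nrm (y + a) := by
  have := nrm_add_le (y + a) (-a)
  rwa [add_neg_cancel_right, nrm_neg] at this

lemma nrm_rpow_add_le {p : ℝ} (hp : 0 ≤ p) (y a : ℤ × ℤ) :
    nrm (y + a) ^ (-p) ≤ nrm a ^ p * nrm y ^ (-p) := by
  have h1 := Real.rpow_le_rpow (nrm_pos y).le (nrm_le_add y a) hp
  rw [Real.mul_rpow (nrm_pos a).le (nrm_pos _).le] at h1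
  have h2 := Real.rpow_pos_of_pos (nrm_pos y) p
  have h3 := Real.rpow_pos_of_pos (nrm_pos (y + a)) p
  rw [Real.rpow_neg (nrm_pos _).le, Real.rpow_neg (nrm_pos _).le]
  rw [← div_eq_mul_inv, le_div_iff₀ h2, inv_mul_le_iff₀ h3, mul_comm]
  exact h1

/-- `f = O(nrm ^ (-p))`. -/
def Decay (p : ℝ) (f : ℤ × ℤ → ℂ) : Prop := ∃ C : ℝ, 0 ≤ C ∧ ∀ y, ‖f y‖ ≤ C * nrm y ^ (-p)

lemma Decay.zero (p : ℝ) : Decay p (fun _ => 0) := ⟨0, le_rfl, fun y => by simp⟩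

lemma Decay.add {p : ℝ} {f g : ℤ × ℤ → ℂ} (hf : Decay p f) (hg : Decay p g) :
    Decay p (fun y => f y + g y) := by
  obtain ⟨C, hC, h1⟩ := hf
  obtain ⟨D, hD, h2⟩ := hg
  refine ⟨C + D, by positivity, fun y => (norm_add_le _ _).trans ?_⟩
  rw [add_mul]
  exact add_le_add (h1 y) (h2 y)

lemma Decay.mul {p q : ℝ} {f g : ℤ × ℤ → ℂ} (hf : Decay p f) (hg : Decay q g) :
    Decay (p + q) (fun y => f y * g y) := by
  obtain ⟨C, hC, h1⟩ := hf
  obtain ⟨D, hD, h2⟩ := hg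
  refine ⟨C * D, by positivity, fun y => ?_⟩
  rw [norm_mul, neg_add, Real.rpow_add (nrm_pos y), mul_mul_mul_comm]
  have := Real.rpow_pos_of_pos (nrm_pos y) (-p)
  exact mul_le_mul (h1 y) (h2 y) (norm_nonneg _) (by positivity)

lemma Decay.const (c : ℂ) : Decay 0 (fun _ => c) := ⟨‖c‖, norm_nonneg _, fun y => by simp⟩

lemma Decay.bdd_mul {p : ℝ} {f g : ℤ × ℤ → ℂ} (hf : Decay 0 f) (hg : Decay p g) :
    Decay p (fun y => f y * g y) := by
  simpa using hf.mul hg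

lemma Decay.const_mul {p : ℝ} {g : ℤ × ℤ → ℂ} (hg : Decay p g) (c : ℂ) :
    Decay p (fun y => c * g y) := (Decay.const c).bdd_mul hg

lemma Decay.translate {p : ℝ} (hp : 0 ≤ p) {f : ℤ × ℤ → ℂ} (hf : Decay p f) (a : ℤ × ℤ) :
    Decay p (fun y => f (y + a)) := by
  obtain ⟨C, hC, h1⟩ := hf
  have := Real.rpow_nonneg (nrm_pos a).le p
  refine ⟨C * nrm a ^ p, by positivity, fun y => (h1 _).trans ?_⟩
  rw [mul_assoc]
  exact mul_le_mul_of_nonneg_left (nrm_rpow_add_le hp y a) hC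

lemma Decay.congr_le {p : ℝ} {f g : ℤ × ℤ → ℂ} (hf : Decay p f) (h : ∀ y, ‖g y‖ ≤ ‖f y‖) :
    Decay p g := by
  obtain ⟨C, hC, h1⟩ := hf
  exact ⟨C, hC, fun y => (h y).trans (h1 y)⟩

/-- Bounded functions on the half-plane whose increments decay like `1 / nrm`. -/
def Slow (M : ℤ × ℤ → ℂ) : Prop :=
  Decay 0 M ∧ ∀ a : ℤ × ℤ, ∃ C : ℝ, 0 ≤ C ∧
    ∀ y : ℤ × ℤ, 0 ≤ y.2 → 0 ≤ (y + a).2 → ‖M (y + a) - M y‖ ≤ C * nrm y ^ (-1 : ℝ)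

lemma Decay.exists_bound {f : ℤ × ℤ → ℂ} (h : Decay 0 f) : ∃ C : ℝ, 0 ≤ C ∧ ∀ y, ‖f y‖ ≤ C := by
  obtain ⟨C, hC, h⟩ := h
  exact ⟨C, hC, fun y => by simpa using h y⟩

lemma Slow.const (c : ℂ) : Slow (fun _ => c) :=
  ⟨Decay.const c, fun a => ⟨0, le_rfl, fun y _ _ => by simp⟩⟩

lemma Slow.add {M N : ℤ × ℤ → ℂ} (hM : Slow M) (hN : Slow N) : Slow (fun y => M y + N y) := by
  refine ⟨hM.1.add hN.1, fun a => ?_⟩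
  obtain ⟨C, hC, h1⟩ := hM.2 a
  obtain ⟨D, hD, h2⟩ := hN.2 a
  refine ⟨C + D, by positivity, fun y hy hya => ?_⟩
  rw [add_mul, add_sub_add_comm]
  exact (norm_add_le _ _).trans (add_le_add (h1 y hy hya) (h2 y hy hya))

lemma Slow.mul {M N : ℤ × ℤ → ℂ} (hM : Slow M) (hN : Slow N) : Slow (fun y => M y * N y) := by
  refine ⟨hM.1.bdd_mul hN.1, fun a => ?_⟩
  obtain ⟨C, hC, h1⟩ := hM.2 a
  obtain ⟨D, hD, h2⟩ := hN.2 a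
  obtain ⟨A, hA, h3⟩ := hM.1.exists_bound
  obtain ⟨B, hB, h4⟩ := hN.1.exists_bound
  refine ⟨C * B + A * D, by positivity, fun y hy hya => ?_⟩
  have e : M (y + a) * N (y + a) - M y * N y =
      (M (y + a) - M y) * N (y + a) + M y * (N (y + a) - N y) := by ring
  have hn := Real.rpow_pos_of_pos (nrm_pos y) (-1)
  rw [e, add_mul]
  refine (norm_add_le _ _).trans (add_le_add ?_ ?_)
  · rw [norm_mul, mul_right_comm]
    exact mul_le_mul (h1 y hy hya) (h4 _) (norm_nonneg _) (by positivity)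
  · rw [norm_mul, mul_assoc]
    exact mul_le_mul (h3 y) (h2 y hy hya) (norm_nonneg _) hA

lemma Slow.conj {M : ℤ × ℤ → ℂ} (hM : Slow M) : Slow (fun y => (starRingEnd ℂ) (M y)) := by
  refine ⟨hM.1.congr_le fun y => by simp, fun a => ?_⟩
  obtain ⟨C, hC, h1⟩ := hM.2 a
  refine ⟨C, hC, fun y hy hya => ?_⟩
  rw [← map_sub, RCLike.norm_conj]
  exact h1 y hy hya

lemma Slow.inv {M : ℤ × ℤ → ℂ} (hM : Slow M) {m : ℝ} (hm : 0 < m) (h : ∀ y, m ≤ ‖M y‖) :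
    Slow (fun y => (M y)⁻¹) := by
  have hinv : ∀ y, ‖(M y)⁻¹‖ ≤ m⁻¹ := fun y => by
    rw [norm_inv]; exact inv_anti₀ hm (h y)
  refine ⟨⟨m⁻¹, by positivity, fun y => by simpa using hinv y⟩, fun a => ?_⟩
  obtain ⟨C, hC, h1⟩ := hM.2 a
  refine ⟨m⁻¹ * C * m⁻¹, by positivity, fun y hy hya => ?_⟩
  have ne : ∀ y, M y ≠ 0 := fun y h0 => by
    have := h y
    rw [h0, norm_zero] at this
    linarith
  have e : (M (y + a))⁻¹ - (M y)⁻¹ = -((M (y + a))⁻¹ * (M (y + a) - M y) * (M y)⁻¹) := by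
    have := ne y
    have := ne (y + a)
    field_simp
    ring
  have hn := Real.rpow_pos_of_pos (nrm_pos y) (-1)
  rw [e, norm_neg, norm_mul, norm_mul]
  calc _ ≤ m⁻¹ * (C * nrm y ^ (-1 : ℝ)) * m⁻¹ := by
        have := h1 y hy hya
        gcongr
        · exact hinv _
        · exact hinv _
    _ = _ := by ring

/-- Phase functions whose increments on the half-plane decay like `1 / nrm`. -/
def SlowPhase (ξ : ℤ × ℤ → ℝ × ℝ) : Prop := ∀ a : ℤ × ℤ, ∃ C : ℝ, 0 ≤ C ∧
  ∀ y : ℤ × ℤ, 0 ≤ y.2 → 0 ≤ (y + a).2 →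
    |(ξ (y + a)).1 - (ξ y).1| ≤ C * nrm y ^ (-1 : ℝ) ∧
    |(ξ (y + a)).2 - (ξ y).2| ≤ C * nrm y ^ (-1 : ℝ)

lemma norm_exp_I_sub_le (s t : ℝ) :
    ‖Complex.exp (Complex.I * s) - Complex.exp (Complex.I * t)‖ ≤ |s - t| := by
  have e : Complex.exp (Complex.I * s) - Complex.exp (Complex.I * t) =
      Complex.exp (Complex.I * t) * (Complex.exp (Complex.I * ((s - t : ℝ) : ℂ)) - 1) := by
    rw [mul_sub, ← Complex.exp_add, mul_one]
    congr 2
    push_cast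
    ring
  rw [e, norm_mul, norm_exp_I_mul, one_mul]
  exact Real.norm_exp_I_mul_ofReal_sub_one_le

lemma SlowPhase.slow_opSymbol {ξ : ℤ × ℤ → ℝ × ℝ} (hξ : SlowPhase ξ) (a : DiffOp) :
    Slow (fun y => opSymbol (ξ y) a) := by
  induction a using diffOp_induction with
  | add a b ha hb =>
    simp only [map_add]
    exact ha.add hb
  | single m c =>
    simp only [opSymbol_single]
    have e : ∀ η : ℝ × ℝ, Complex.exp (Complex.I * (m.1 * η.1 + m.2 * η.2)) =
        Complex.exp (Complex.I * ((m.1 * η.1 + m.2 * η.2 : ℝ) : ℂ)) := fun η => by push_cast; rfl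
    refine (Slow.const c).mul ⟨⟨1, zero_le_one, fun y => ?_⟩, fun a => ?_⟩
    · beta_reduce
      rw [e, norm_exp_I_mul]; simp
    · obtain ⟨C, hC, h⟩ := hξ a
      refine ⟨(|(m.1 : ℝ)| + |(m.2 : ℝ)|) * C, by positivity, fun y hy hya => ?_⟩
      obtain ⟨h1, h2⟩ := h y hy hya
      beta_reduce
      rw [e, e]
      refine (norm_exp_I_sub_le _ _).trans ?_
      have e2 : (m.1 * (ξ (y + a)).1 + m.2 * (ξ (y + a)).2 - (m.1 * (ξ y).1 + m.2 * (ξ y).2) : ℝ) =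
        m.1 * ((ξ (y + a)).1 - (ξ y).1) + m.2 * ((ξ (y + a)).2 - (ξ y).2) := by ring
      rw [e2, add_mul, add_mul]
      refine (abs_add_le _ _).trans ?_
      rw [abs_mul, abs_mul, mul_assoc, mul_assoc]
      gcongr

/-! ### Outgoing functions -/

/-- Functions that vanish below the half-plane, decay like an outgoing wave, are smaller near its
boundary, and are asymptotically multiplied by the phase factors of `ξ` under the two coordinate shifts. -/
structure Outgoing (ξ : ℤ × ℤ → ℝ × ℝ) (w : ℤ × ℤ → ℂ) : Prop where
  eq_zero : ∀ y : ℤ × ℤ, y.2 < 0 → w y = 0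
  decay : Decay (1 / 2) w
  decay_boundary : ∃ C : ℝ, 0 ≤ C ∧ ∀ y, ‖w y‖ ≤ C * (1 + |(y.2 : ℝ)|) * nrm y ^ (-(3 / 2) : ℝ)
  shift_one : Decay (3 / 2) (fun y => w (y + (1, 0)) - Complex.exp (Complex.I * (ξ y).1) * w y)
  shift_two : Decay (3 / 2) (fun y => w (y + (0, 1)) - Complex.exp (Complex.I * (ξ y).2) * w y)

variable {ξ : ℤ × ℤ → ℝ × ℝ} {w : ℤ × ℤ → ℂ}

/-- Near the boundary of the half-plane no regularity of the phase is available below it; there the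
values of `w` are already `O(nrm ^ (-3/2))`. -/
lemma Outgoing.decay_below (hw : Outgoing ξ w) (a : ℤ × ℤ) :
    Decay (3 / 2) (fun y => if y.2 < 0 then w (y + a) else 0) := by
  obtain ⟨C, hC, h⟩ := hw.decay_boundary
  have h3 := Real.rpow_nonneg (nrm_pos a).le (3 / 2)
  refine ⟨C * nrm a * nrm a ^ (3 / 2 : ℝ), ?_, fun y => ?_⟩
  · have := nrm_pos a; positivity
  have hn := Real.rpow_pos_of_pos (nrm_pos y) (-(3 / 2))
  have ha := nrm_pos a
  beta_reduce
  split_ifs with hy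
  · by_cases hya : (y + a).2 < 0
    · rw [hw.eq_zero _ hya, norm_zero]; positivity
    · refine (h _).trans ?_
      have h1 : 1 + |((y + a).2 : ℝ)| ≤ nrm a := by
        have : |((y + a).2 : ℝ)| ≤ |(a.2 : ℝ)| := by
          have : |(y + a).2| ≤ |a.2| := by
            rw [Prod.snd_add] at hya ⊢
            rw [abs_of_nonneg (by omega), abs_of_nonneg (by omega)]
            omega
          exact_mod_cast this
        have := abs_nonneg (a.1 : ℝ)
        unfold nrm
        linarith
      have h2 := nrm_rpow_add_le (p := 3 / 2) (by norm_num) y a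
      rw [mul_assoc (C * nrm a)]
      have h4 := Real.rpow_nonneg (nrm_pos (y + a)).le (-(3 / 2))
      gcongr
  · rw [norm_zero]; positivity

lemma Outgoing.commute (hw : Outgoing ξ w) {M : ℤ × ℤ → ℂ} (hM : Slow M) (a : ℤ × ℤ) :
    Decay (3 / 2) (fun y => (M (y + a) - M y) * w (y + a)) := by
  obtain ⟨A, hA, hb⟩ := hM.1.exists_bound
  obtain ⟨C, hC, h⟩ := hM.2 a
  have h1 : Decay (1 + 1 / 2) (fun y : ℤ × ℤ => ((C * nrm y ^ (-1 : ℝ) : ℝ) : ℂ) * w (y + a)) := by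
    refine Decay.mul ⟨C, hC, fun y => ?_⟩ (hw.decay.translate (by norm_num) a)
    have := Real.rpow_pos_of_pos (nrm_pos y) (-1)
    rw [Complex.norm_real, Real.norm_eq_abs, abs_of_nonneg (by positivity)]
  have h2 := (hw.decay_below a).const_mul (2 * A)
  obtain ⟨C1, hC1, h1⟩ := h1
  obtain ⟨C2, hC2, h2⟩ := h2
  refine ⟨C1 + C2, by positivity, fun y => ?_⟩
  have hn := Real.rpow_pos_of_pos (nrm_pos y) (-(3 / 2))
  have hn' := Real.rpow_pos_of_pos (nrm_pos y) (-1)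
  have e : (-(1 + 1 / 2) : ℝ) = -(3 / 2) := by norm_num
  have h1 := h1 y
  have h2 := h2 y
  rw [e] at h1
  beta_reduce at h1 h2 ⊢
  by_cases hya : (y + a).2 < 0
  · rw [hw.eq_zero _ hya, mul_zero, norm_zero]; positivity
  by_cases hy : y.2 < 0
  · rw [if_pos hy] at h2
    have : ‖(M (y + a) - M y) * w (y + a)‖ ≤ ‖(2 * A : ℂ) * w (y + a)‖ := by
      rw [norm_mul, norm_mul]
      refine mul_le_mul_of_nonneg_right ?_ (norm_nonneg _)
      have : ‖(2 * A : ℂ)‖ = 2 * A := by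
        rw [norm_mul, Complex.norm_real, Real.norm_eq_abs, abs_of_nonneg hA]; norm_num
      rw [this]
      exact (norm_sub_le _ _).trans (by linarith [hb (y + a), hb y])
    nlinarith
  · have : ‖(M (y + a) - M y) * w (y + a)‖ ≤ ‖((C * nrm y ^ (-1 : ℝ) : ℝ) : ℂ) * w (y + a)‖ := by
      rw [norm_mul, norm_mul]
      refine mul_le_mul_of_nonneg_right ?_ (norm_nonneg _)
      rw [Complex.norm_real, Real.norm_eq_abs, abs_of_nonneg (by positivity)]
      exact h y (by omega) (by omega)
    nlinarith

/-- The factor by which `w` is asymptotically multiplied under the shift by `m`. -/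
noncomputable def phase (ξ : ℤ × ℤ → ℝ × ℝ) (m y : ℤ × ℤ) : ℂ := opSymbol (ξ y) (shift m)

lemma phase_add (ξ : ℤ × ℤ → ℝ × ℝ) (m n y : ℤ × ℤ) :
    phase ξ (m + n) y = phase ξ m y * phase ξ n y := by
  rw [phase, ← shift_mul_shift, map_mul]; rfl

lemma phase_zero (ξ : ℤ × ℤ → ℝ × ℝ) (y : ℤ × ℤ) : phase ξ 0 y = 1 := by
  rw [phase, shift_zero, map_one]

/-- The shifts that act asymptotically on `w` by multiplication with the phase. -/
def Outgoing.phaseGroup (hξ : SlowPhase ξ) (hw : Outgoing ξ w) : AddSubgroup (ℤ × ℤ) where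
  carrier := {m | Decay (3 / 2) (fun y => w (y + m) - phase ξ m y * w y)}
  zero_mem' := by
    refine (Decay.zero _).congr_le fun y => ?_
    simp [phase_zero]
  -- `S^(m+n) w - φ_m φ_n w` is the sum of `S^m (S^n w - φ_n w)`, the commutator of `S^m` with `φ_n`,
  -- and `φ_n (S^m w - φ_m w)`
  add_mem' {m n} hm hn := by
    have h1 := Decay.translate (by norm_num) hn m
    have h2 := hw.commute (hξ.slow_opSymbol (shift n)) m
    have h3 := (hξ.slow_opSymbol (shift n)).1.bdd_mul hm
    refine ((h1.add h2).add h3).congr_le fun y => le_of_eq ?_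
    congr 1
    rw [phase_add, ← add_assoc]
    simp only [phase]
    ring
  neg_mem' {m} hm := by
    have h1 := Decay.translate (by norm_num) hm (-m)
    have h2 := hw.commute (hξ.slow_opSymbol (shift m)) (-m)
    have h3 := (hξ.slow_opSymbol (shift (-m))).1.bdd_mul (h1.add h2)
    refine h3.congr_le fun y => le_of_eq ?_
    have e : phase ξ (-m) y * phase ξ m y = 1 := by
      rw [← phase_add, neg_add_cancel, phase_zero]
    simp only [phase] at e ⊢
    rw [← norm_neg]
    congr 1
    rw [neg_add_cancel_right]
    linear_combination (w (y + -m)) * e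

lemma Outgoing.shift_sub_phase (hξ : SlowPhase ξ) (hw : Outgoing ξ w) (m : ℤ × ℤ) :
    Decay (3 / 2) (fun y => w (y + m) - phase ξ m y * w y) := by
  have h1 : ((1, 0) : ℤ × ℤ) ∈ hw.phaseGroup hξ := by
    refine hw.shift_one.congr_le fun y => le_of_eq ?_
    simp [phase, opSymbol_shift]
  have h2 : ((0, 1) : ℤ × ℤ) ∈ hw.phaseGroup hξ := by
    refine hw.shift_two.congr_le fun y => le_of_eq ?_
    simp [phase, opSymbol_shift]
  have h3 := add_mem (zsmul_mem h1 m.1) (zsmul_mem h2 m.2)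
  have e : m.1 • ((1, 0) : ℤ × ℤ) + m.2 • ((0, 1) : ℤ × ℤ) = m := by ext <;> simp
  rw [e] at h3
  exact h3

/-- A finite difference operator acts on a product of a slowly varying multiplier and an outgoing
function, up to `O(nrm ^ (-3/2))`, by multiplication with its symbol. -/
lemma Outgoing.diffAct_mul (hξ : SlowPhase ξ) (hw : Outgoing ξ w) {M : ℤ × ℤ → ℂ} (hM : Slow M)
    (a : DiffOp) :
    Decay (3 / 2) (fun y => diffAct a (fun z => M z * w z) y - opSymbol (ξ y) a * (M y * w y)) := by
  induction a using diffOp_induction with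
  | single m c =>
    have h := ((hw.commute hM m).add (hM.1.bdd_mul (hw.shift_sub_phase hξ m))).const_mul c
    refine h.congr_le fun y => le_of_eq ?_
    rw [diffAct_single, opSymbol_single, phase, opSymbol_shift]
    congr 1
    ring
  | add a b ha hb =>
    refine (ha.add hb).congr_le fun y => le_of_eq ?_
    rw [map_add, map_add, LinearMap.add_apply, Pi.add_apply]
    congr 1
    ring

/-! ### Pairings with finitely supported functions -/

lemma mem_box_of_nrm_le {y : ℤ × ℤ} {A : ℝ} {N : ℕ} (h : nrm y ≤ A * N) :
    y ∈ box (⌈A⌉₊ * N) := by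
  have h1 : A * N ≤ (⌈A⌉₊ * N : ℕ) := by
    push_cast
    exact mul_le_mul_of_nonneg_right (Nat.le_ceil A) (Nat.cast_nonneg N)
  have h2 := abs_nonneg (y.1 : ℝ)
  have h3 := abs_nonneg (y.2 : ℝ)
  unfold nrm at h
  rw [mem_box]
  constructor
  · have : |(y.1 : ℝ)| ≤ ((⌈A⌉₊ * N : ℕ) : ℤ) := by push_cast at h1 ⊢; linarith
    exact_mod_cast this
  · have : |(y.2 : ℝ)| ≤ ((⌈A⌉₊ * N : ℕ) : ℤ) := by push_cast at h1 ⊢; linarith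
    exact_mod_cast this

lemma card_box (R : ℕ) : ((box R).card : ℝ) = (2 * R + 1) ^ 2 := by
  rw [box, Finset.card_product, Int.card_Icc]
  have : ((R : ℤ) + 1 - -R).toNat = 2 * R + 1 := by omega
  rw [this]; push_cast; ring

/-- Cauchy–Schwarz for a kernel of linear growth and a function of size `N ^ (-3/2)` on a box of
width `N`. -/
lemma norm_finsum_le {F : ℤ × ℤ → ℂ} {C A η : ℝ} (hC : 0 ≤ C) (hη : 0 ≤ η)
    (hF : ∀ R : ℕ, ∑ y ∈ box R, ‖F y‖ ^ 2 ≤ C * (R + 1)) {N : ℕ} (hN : 1 ≤ N) {g : ℤ × ℤ → ℂ}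
    (hg : ∀ y, g y ≠ 0 → nrm y ≤ A * N) (hη' : ∀ y, ‖g y‖ ≤ η * (N : ℝ) ^ (-(3 / 2) : ℝ)) :
    ‖∑ᶠ y, F y * g y‖ ≤ (2 * ⌈A⌉₊ + 1) ^ 2 * Real.sqrt C * η := by
  set a := ⌈A⌉₊
  have hN0 : (1 : ℝ) ≤ N := by exact_mod_cast hN
  have hs : (Function.support fun y => F y * g y) ⊆ box (a * N) := fun y hy =>
    mem_box_of_nrm_le (hg y fun h0 => hy (by simp [h0]))
  rw [finsum_eq_sum_of_support_subset _ hs]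
  refine abs_le_of_sq_le_sq' ?_ (by positivity) |>.2
  have h1 : ‖∑ y ∈ box (a * N), F y * g y‖ ≤ ∑ y ∈ box (a * N), ‖F y‖ * ‖g y‖ := by
    refine (norm_sum_le _ _).trans (le_of_eq ?_)
    simp only [norm_mul]
  have h2 := Finset.sum_mul_sq_le_sq_mul_sq (box (a * N)) (fun y => ‖F y‖) (fun y => ‖g y‖)
  have h3 : ∑ y ∈ box (a * N), ‖g y‖ ^ 2 ≤ (2 * (a * N : ℕ) + 1) ^ 2 *
      (η * (N : ℝ) ^ (-(3 / 2) : ℝ)) ^ 2 := by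
    rw [← card_box, ← nsmul_eq_mul]
    exact Finset.sum_le_card_nsmul _ _ _ fun y _ => pow_le_pow_left₀ (norm_nonneg _) (hη' y) 2
  have h4 : ((N : ℝ) ^ (-(3 / 2) : ℝ)) ^ 2 = ((N : ℝ) ^ 3)⁻¹ := by
    rw [← Real.rpow_natCast, ← Real.rpow_mul (by positivity)]
    norm_num
  have h5 : (2 * ((a * N : ℕ) : ℝ) + 1) ≤ (2 * a + 1) * N := by
    push_cast; nlinarith
  have h6 : (((a * N : ℕ) : ℝ) + 1) ≤ (2 * a + 1) * N := by
    push_cast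
    have : (0 : ℝ) ≤ a := by positivity
    nlinarith
  calc ‖∑ y ∈ box (a * N), F y * g y‖ ^ 2
      ≤ (∑ y ∈ box (a * N), ‖F y‖ * ‖g y‖) ^ 2 := pow_le_pow_left₀ (norm_nonneg _) h1 2
    _ ≤ _ := h2
    _ ≤ (C * ((2 * a + 1) * N)) * (((2 * a + 1) * N) ^ 2 * (η * (N : ℝ) ^ (-(3 / 2) : ℝ)) ^ 2) := by
        refine mul_le_mul ((hF _).trans ?_) (h3.trans ?_) (by positivity) (by positivity)
        · gcongr
        · gcongr
    _ = C * (2 * a + 1) ^ 3 * η ^ 2 := by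
        rw [mul_pow η, h4]
        have : (N : ℝ) ≠ 0 := by positivity
        field_simp
    _ ≤ C * (2 * a + 1) ^ 4 * η ^ 2 := by
        have : (1 : ℝ) ≤ 2 * a + 1 := by linarith [(Nat.cast_nonneg a : (0 : ℝ) ≤ a)]
        gcongr
        norm_num
    _ = _ := by
        rw [mul_pow, mul_pow, Real.sq_sqrt hC]; ring

/-- The transpose of a finite difference operator. -/
noncomputable def transpose : DiffOp →ₐ[ℂ] DiffOp :=
  AddMonoidAlgebra.mapDomainAlgHom ℂ ℂ (negAddMonoidHom : ℤ × ℤ →+ ℤ × ℤ)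

lemma transpose_single (m : ℤ × ℤ) (c : ℂ) :
    transpose (AddMonoidAlgebra.single m c) = AddMonoidAlgebra.single (-m) c := by
  simp [transpose, AddMonoidAlgebra.mapDomain_single]

lemma opSymbol_transpose (ξ : ℝ × ℝ) (a : DiffOp) : opSymbol ξ (transpose a) = opSymbol (-ξ) a := by
  induction a using diffOp_induction with
  | single m c =>
    rw [transpose_single, opSymbol_single, opSymbol_single]
    congr 2
    simp
  | add a b ha hb => rw [map_add, map_add, map_add, ha, hb]

lemma diffAct_finite_support (a : DiffOp) {g : ℤ × ℤ → ℂ} (hg : (Function.support g).Finite) :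
    (Function.support (diffAct a g)).Finite := by
  induction a using diffOp_induction with
  | single m c =>
    refine (hg.preimage (f := fun y => y + m) (add_left_injective m).injOn).subset fun y hy => ?_
    rw [Function.mem_support, diffAct_single] at hy
    exact right_ne_zero_of_mul hy
  | add a b ha hb =>
    rw [map_add, LinearMap.add_apply]
    exact (ha.union hb).subset (Function.support_add _ _)

lemma finite_support_mul (F : ℤ × ℤ → ℂ) {g : ℤ × ℤ → ℂ} (hg : (Function.support g).Finite) :
    (Function.support fun y => F y * g y).Finite :=
  hg.subset fun _ hy => right_ne_zero_of_mul hy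

/-- Summation by parts. -/
lemma finsum_mul_diffAct (a : DiffOp) (F : ℤ × ℤ → ℂ) {g : ℤ × ℤ → ℂ}
    (hg : (Function.support g).Finite) :
    ∑ᶠ y, F y * diffAct (transpose a) g y = ∑ᶠ y, diffAct a F y * g y := by
  induction a using diffOp_induction with
  | single m c =>
    rw [← finsum_comp_equiv (Equiv.addRight m)]
    refine finsum_congr fun y => ?_
    rw [transpose_single, diffAct_single, diffAct_single, Equiv.coe_addRight,
      add_neg_cancel_right]
    ring
  | add a b ha hb =>
    simp only [map_add, LinearMap.add_apply, Pi.add_apply, mul_add, add_mul]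
    rw [finsum_add_distrib (finite_support_mul F (diffAct_finite_support _ hg))
      (finite_support_mul F (diffAct_finite_support _ hg)),
      finsum_add_distrib (finite_support_mul _ hg) (finite_support_mul _ hg), ha, hb]

/-- Families `f N`, supported in balls of radius `O(N)` and of size `O(N ^ (-5/2))`. -/
def Negligible (f : ℕ → ℤ × ℤ → ℂ) : Prop := ∃ A C : ℝ, 0 ≤ C ∧ ∀ N : ℕ, 1 ≤ N → ∀ y,
  (f N y ≠ 0 → nrm y ≤ A * N) ∧ ‖f N y‖ ≤ C * (N : ℝ) ^ (-(5 / 2) : ℝ)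

lemma Negligible.add {f g : ℕ → ℤ × ℤ → ℂ} (hf : Negligible f) (hg : Negligible g) :
    Negligible (fun N y => f N y + g N y) := by
  obtain ⟨A, C, hC, h1⟩ := hf
  obtain ⟨B, D, hD, h2⟩ := hg
  refine ⟨max A B, C + D, by positivity, fun N hN y => ⟨fun hne => ?_, ?_⟩⟩
  · have hN0 : (0 : ℝ) ≤ N := Nat.cast_nonneg N
    by_cases h0 : f N y = 0
    · have : g N y ≠ 0 := fun h => hne (by simp [h0, h])
      exact ((h2 N hN y).1 this).trans (mul_le_mul_of_nonneg_right (le_max_right _ _) hN0)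
    · exact ((h1 N hN y).1 h0).trans (mul_le_mul_of_nonneg_right (le_max_left _ _) hN0)
  · rw [add_mul]
    exact (norm_add_le _ _).trans (add_le_add (h1 N hN y).2 (h2 N hN y).2)

lemma Negligible.const_mul {f : ℕ → ℤ × ℤ → ℂ} (hf : Negligible f) (c : ℂ) :
    Negligible (fun N y => c * f N y) := by
  obtain ⟨A, C, hC, h1⟩ := hf
  refine ⟨A, ‖c‖ * C, by positivity, fun N hN y => ⟨fun hne =>
    (h1 N hN y).1 (right_ne_zero_of_mul hne), ?_⟩⟩
  rw [norm_mul, mul_assoc]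
  exact mul_le_mul_of_nonneg_left (h1 N hN y).2 (norm_nonneg _)

lemma Negligible.finite_support {f : ℕ → ℤ × ℤ → ℂ} (hf : Negligible f) {N : ℕ} (hN : 1 ≤ N) :
    (Function.support (f N)).Finite := by
  obtain ⟨A, C, _, h⟩ := hf
  exact (box (⌈A⌉₊ * N)).finite_toSet.subset fun y hy => mem_box_of_nrm_le ((h N hN y).1 hy)

lemma Negligible.tendsto {f : ℕ → ℤ × ℤ → ℂ} (hf : Negligible f) {F : ℤ × ℤ → ℂ}
    (hF : LinearGrowth F) : Tendsto (fun N => ∑ᶠ y, F y * f N y) atTop (𝓝 0) := by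
  obtain ⟨A, C, hC, h⟩ := hf
  obtain ⟨D, hD, hF⟩ := hF
  have hlim : Tendsto (fun N : ℕ => (2 * ⌈A⌉₊ + 1) ^ 2 * Real.sqrt D * (C * (N : ℝ)⁻¹)) atTop
      (𝓝 0) := by
    have := (tendsto_inv_atTop_nhds_zero_nat (𝕜 := ℝ)).const_mul C |>.const_mul
      ((2 * ⌈A⌉₊ + 1) ^ 2 * Real.sqrt D)
    simpa using this
  refine squeeze_zero_norm' ?_ hlim
  filter_upwards [eventually_ge_atTop 1] with N hN
  have hN0 : (0 : ℝ) < N := by exact_mod_cast hN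
  refine norm_finsum_le hD (by positivity) hF hN (fun y => (h N hN y).1) fun y => ?_
  refine (h N hN y).2.trans (le_of_eq ?_)
  rw [mul_assoc, ← Real.rpow_neg_one, ← Real.rpow_add hN0]
  norm_num

/-- Weights that are concentrated at distance of order `N`, of size `O(1/N)`, and with increments
of size `O(1/N²)`, as produced by the first differences of a cut-off function at scale `N`. -/
structure CutoffWeights (d : ℕ → ℤ × ℤ → ℂ) : Prop where
  support : ∃ A : ℝ, 1 ≤ A ∧ ∀ N : ℕ, 1 ≤ N → ∀ y, d N y ≠ 0 → N ≤ A * nrm y ∧ nrm y ≤ A * N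
  bound : ∃ C : ℝ, 0 ≤ C ∧ ∀ N : ℕ, 1 ≤ N → ∀ y, ‖d N y‖ ≤ C * (N : ℝ) ^ (-1 : ℝ)
  increment : ∀ a, ∃ C : ℝ, 0 ≤ C ∧ ∀ N : ℕ, 1 ≤ N → ∀ y,
    ‖d N (y + a) - d N y‖ ≤ C * (N : ℝ) ^ (-2 : ℝ)

lemma rpow_nrm_le {A p : ℝ} (hA : 0 ≤ A) (hp : 0 ≤ p) {N : ℕ} (hN : 1 ≤ N) {y : ℤ × ℤ}
    (h : N ≤ A * nrm y) : nrm y ^ (-p) ≤ A ^ p * (N : ℝ) ^ (-p) := by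
  have hN0 : (0 : ℝ) < N := by exact_mod_cast hN
  have h1 := Real.rpow_le_rpow hN0.le h hp
  rw [Real.mul_rpow hA (nrm_pos y).le] at h1
  have h2 := Real.rpow_pos_of_pos (nrm_pos y) p
  have h3 := Real.rpow_pos_of_pos hN0 p
  rw [Real.rpow_neg (nrm_pos y).le, Real.rpow_neg hN0.le, ← div_eq_mul_inv, le_div_iff₀ h3,
    inv_mul_le_iff₀ h2, mul_comm]
  exact h1

lemma CutoffWeights.finite_support {d : ℕ → ℤ × ℤ → ℂ} (hd : CutoffWeights d) {N : ℕ} (hN : 1 ≤ N)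
    (v : ℤ × ℤ → ℂ) : (Function.support fun y => d N y * v y).Finite := by
  obtain ⟨A, _, h⟩ := hd.support
  exact (box (⌈A⌉₊ * N)).finite_toSet.subset fun y hy =>
    mem_box_of_nrm_le (h N hN y (left_ne_zero_of_mul hy)).2

lemma CutoffWeights.negligible {d : ℕ → ℤ × ℤ → ℂ} (hd : CutoffWeights d) {r : ℤ × ℤ → ℂ}
    (hr : Decay (3 / 2) r) : Negligible (fun N y => d N y * r y) := by
  obtain ⟨A, hA, h1⟩ := hd.support
  obtain ⟨C, hC, h2⟩ := hd.bound
  obtain ⟨D, hD, h3⟩ := hr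
  refine ⟨A, C * (D * A ^ (3 / 2 : ℝ)), by positivity, fun N hN y => ⟨fun hne =>
    (h1 N hN y (left_ne_zero_of_mul hne)).2, ?_⟩⟩
  have hN0 : (0 : ℝ) < N := by exact_mod_cast hN
  beta_reduce
  by_cases h0 : d N y = 0
  · rw [h0, zero_mul, norm_zero]; positivity
  have e : (N : ℝ) ^ (-(5 / 2) : ℝ) = (N : ℝ) ^ (-1 : ℝ) * (N : ℝ) ^ (-(3 / 2) : ℝ) := by
    rw [← Real.rpow_add hN0]; norm_num
  have h4 := rpow_nrm_le (p := 3 / 2) (by linarith) (by norm_num) hN (h1 N hN y h0).1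
  rw [norm_mul, e]
  calc _ ≤ (C * (N : ℝ) ^ (-1 : ℝ)) * (D * (A ^ (3 / 2 : ℝ) * (N : ℝ) ^ (-(3 / 2) : ℝ))) := by
        refine mul_le_mul (h2 N hN y) ((h3 y).trans ?_) (norm_nonneg _) (by positivity)
        gcongr
    _ = _ := by ring

/-- Finite difference operators commute with the multiplication by cut-off weights up to
negligible families. -/
lemma CutoffWeights.commute {d : ℕ → ℤ × ℤ → ℂ} (hd : CutoffWeights d) {v : ℤ × ℤ → ℂ}
    (hv : Decay (1 / 2) v) (a : DiffOp) :
    Negligible (fun N y => diffAct a (fun z => d N z * v z) y - d N y * diffAct a v y) := by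
  induction a using diffOp_induction with
  | add a b ha hb =>
    have e : (fun N y => diffAct (a + b) (fun z => d N z * v z) y - d N y * diffAct (a + b) v y) =
        fun N y => (diffAct a (fun z => d N z * v z) y - d N y * diffAct a v y) +
          (diffAct b (fun z => d N z * v z) y - d N y * diffAct b v y) := by
      ext N y
      rw [map_add, LinearMap.add_apply, LinearMap.add_apply, Pi.add_apply, Pi.add_apply]
      ring
    rw [e]
    exact ha.add hb
  | single m c =>
    have e : (fun N y => diffAct (AddMonoidAlgebra.single m c) (fun z => d N z * v z) y -
        d N y * diffAct (AddMonoidAlgebra.single m c) v y) =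
        fun N y => c * ((d N (y + m) - d N y) * v (y + m)) := by
      ext N y
      rw [diffAct_single, diffAct_single]
      ring
    rw [e]
    refine Negligible.const_mul ?_ c
    obtain ⟨A, hA, h1⟩ := hd.support
    obtain ⟨C, hC, h2⟩ := hd.increment m
    obtain ⟨D, hD, h3⟩ := hv
    have hm := one_le_nrm m
    have key : ∀ N : ℕ, 1 ≤ N → ∀ y, d N (y + m) - d N y ≠ 0 →
        N ≤ A * nrm m * nrm (y + m) ∧ nrm y ≤ A * nrm m * N := by
      intro N hN y hne
      have hN0 : (0 : ℝ) ≤ N := Nat.cast_nonneg N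
      have h5 := nrm_pos y
      have h6 := nrm_pos (y + m)
      by_cases h0 : d N y = 0
      · have := h1 N hN (y + m) (fun h => hne (by simp [h0, h]))
        have h4 := nrm_le_add y m
        constructor
        · calc (N : ℝ) ≤ A * nrm (y + m) := this.1
            _ ≤ _ := by gcongr; nlinarith
        · calc nrm y ≤ nrm m * nrm (y + m) := h4
            _ ≤ nrm m * (A * N) := by gcongr; exact this.2
            _ = _ := by ring
      · have := h1 N hN y h0
        have h4 := nrm_le_add y m
        constructor
        · calc (N : ℝ) ≤ A * nrm y := this.1
            _ ≤ A * (nrm m * nrm (y + m)) := by gcongr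
            _ = _ := by ring
        · calc nrm y ≤ A * N := this.2
            _ ≤ _ := by gcongr; nlinarith
    refine ⟨A * nrm m, C * (D * (A * nrm m) ^ (1 / 2 : ℝ)), by positivity, fun N hN y =>
      ⟨fun hne => (key N hN y (left_ne_zero_of_mul hne)).2, ?_⟩⟩
    have hN0 : (0 : ℝ) < N := by exact_mod_cast hN
    beta_reduce
    by_cases h0 : d N (y + m) - d N y = 0
    · rw [h0, zero_mul, norm_zero]; positivity
    have h4 := rpow_nrm_le (p := 1 / 2) (by positivity) (by norm_num) hN (key N hN y h0).1
    have e : (N : ℝ) ^ (-(5 / 2) : ℝ) = (N : ℝ) ^ (-2 : ℝ) * (N : ℝ) ^ (-(1 / 2) : ℝ) := by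
      rw [← Real.rpow_add hN0]; norm_num
    rw [norm_mul, e]
    calc _ ≤ (C * (N : ℝ) ^ (-2 : ℝ)) *
          (D * ((A * nrm m) ^ (1 / 2 : ℝ) * (N : ℝ) ^ (-(1 / 2) : ℝ))) := by
          refine mul_le_mul (h2 N hN y) ((h3 _).trans ?_) (norm_nonneg _) (by positivity)
          gcongr
      _ = _ := by ring

/-! ### Outgoing kernels do not see outgoing functions at infinity -/

/-- The operator whose symbol, at the far-field points, is the limit of the symbols of the
transposes of `(shift - a) discOp`, as the symbol of `a` approaches `sliceRoot`. Transposition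
reflects `ξ`, and `sliceRoot` at `-ξ₁` is the phase factor of the shift by `(-1, 1)`. -/
noncomputable def reflOp (b : ℝ) : DiffOp := (shift (0, -1) - shift (-1, 1)) * discOp b opX

variable {ξ : ℤ × ℤ → ℝ × ℝ} {w : ℤ × ℤ → ℂ}

/-- A slowly varying approximate inverse of the symbol of `reflOp`, which is exact up to a factor
`κ` where `w` is not already small because of the decay near the boundary. -/
lemma Outgoing.exists_multiplier {b : ℝ} (hξ : SlowPhase ξ) (hw : Outgoing ξ w) {c : ℝ} (hc : 0 < c)
    (hlow : ∀ y : ℤ × ℤ, 0 ≤ y.2 → c * ((y.2 : ℝ) / nrm y) ^ 3 ≤ ‖opSymbol (ξ y) (reflOp b)‖) :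
    ∃ K : ℝ, 0 ≤ K ∧ ∀ κ : ℝ, 0 < κ → ∃ M : ℤ × ℤ → ℂ, Slow M ∧ ∃ R : ℝ, ∀ y, R ≤ nrm y →
      ‖w y * (1 - opSymbol (ξ y) (reflOp b) * M y)‖ ≤ K * κ * nrm y ^ (-(1 / 2) : ℝ) := by
  obtain ⟨Cw, hCw, h1⟩ := hw.decay
  obtain ⟨Cb, hCb, h2⟩ := hw.decay_boundary
  refine ⟨Cb + Cw, by positivity, fun κ hκ => ?_⟩
  set ω : ℤ × ℤ → ℂ := fun y => opSymbol (ξ y) (reflOp b) with hω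
  have hωs : Slow ω := hξ.slow_opSymbol (reflOp b)
  -- a Tikhonov regularization of the inverse, with a parameter that is small relative to the lower
  -- bound `(c (κ/2)³)²` of the squared symbol at height `y₂ ≥ κ nrm y / 2`
  set τ : ℝ := c ^ 2 * κ ^ 7 / 64 with hτ
  have hτ0 : 0 < τ := by positivity
  have hden : ∀ y, (starRingEnd ℂ) (ω y) * ω y + τ = ((‖ω y‖ ^ 2 + τ : ℝ) : ℂ) := by
    intro y
    rw [Complex.conj_mul']
    push_cast
    rfl
  have hpos : ∀ y, 0 < ‖ω y‖ ^ 2 + τ := fun y => by positivity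
  refine ⟨fun y => (starRingEnd ℂ) (ω y) * ((starRingEnd ℂ) (ω y) * ω y + τ)⁻¹,
    hωs.conj.mul (Slow.inv ((hωs.conj.mul hωs).add (Slow.const τ)) hτ0 fun y => ?_),
    2 / κ, fun y hy => ?_⟩
  · rw [hden, Complex.norm_real, Real.norm_eq_abs, abs_of_pos (hpos y)]
    linarith [sq_nonneg ‖ω y‖]
  have hn := Real.rpow_pos_of_pos (nrm_pos y) (-(1 / 2))
  have hn' := nrm_pos y
  by_cases hy2 : y.2 < 0
  · rw [hw.eq_zero y hy2, zero_mul, norm_zero]; positivity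
  have e : ‖w y * (1 - ω y * ((starRingEnd ℂ) (ω y) * ((starRingEnd ℂ) (ω y) * ω y + τ)⁻¹))‖ =
      ‖w y‖ * (τ / (‖ω y‖ ^ 2 + τ)) := by
    have hne : (starRingEnd ℂ) (ω y) * ω y + τ ≠ 0 := by
      rw [hden]; exact_mod_cast (hpos y).ne'
    have e1 : 1 - ω y * ((starRingEnd ℂ) (ω y) * ((starRingEnd ℂ) (ω y) * ω y + τ)⁻¹) =
        τ / ((starRingEnd ℂ) (ω y) * ω y + τ) := by
      rw [eq_div_iff hne, sub_mul, mul_assoc, mul_assoc, inv_mul_cancel₀ hne]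
      ring
    rw [e1, norm_mul, norm_div, hden, Complex.norm_real, Complex.norm_real, Real.norm_eq_abs,
      Real.norm_eq_abs, abs_of_pos hτ0, abs_of_pos (hpos y)]
  rw [e]
  have hfac : τ / (‖ω y‖ ^ 2 + τ) ≤ 1 :=
    div_le_one_of_le₀ (by linarith [sq_nonneg ‖ω y‖]) (hpos y).le
  have hfac0 : 0 ≤ τ / (‖ω y‖ ^ 2 + τ) := by positivity
  have hy0 : 0 ≤ y.2 := not_lt.1 hy2
  have hy0' : (0 : ℝ) ≤ y.2 := by exact_mod_cast hy0
  -- in the sector near the boundary `w` itself is small, above it the regularized inverse is accurate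
  by_cases hcase : 1 + (y.2 : ℝ) ≤ κ * nrm y
  · have e2 : nrm y * nrm y ^ (-(3 / 2) : ℝ) = nrm y ^ (-(1 / 2) : ℝ) := by
      nth_rewrite 1 [← Real.rpow_one (nrm y)]
      rw [← Real.rpow_add hn']
      norm_num
    have hn3 := Real.rpow_pos_of_pos (nrm_pos y) (-(3 / 2))
    calc ‖w y‖ * (τ / (‖ω y‖ ^ 2 + τ)) ≤ ‖w y‖ * 1 := by gcongr
      _ ≤ Cb * (1 + |(y.2 : ℝ)|) * nrm y ^ (-(3 / 2) : ℝ) := by rw [mul_one]; exact h2 y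
      _ ≤ Cb * (κ * nrm y) * nrm y ^ (-(3 / 2) : ℝ) := by
          rw [abs_of_nonneg hy0']; gcongr
      _ = Cb * κ * nrm y ^ (-(1 / 2) : ℝ) := by rw [← e2]; ring
      _ ≤ _ := by gcongr; linarith
  · have h3 : 1 ≤ κ * nrm y / 2 := by
      rw [div_le_iff₀ hκ] at hy
      linarith
    have h4 : κ / 2 ≤ (y.2 : ℝ) / nrm y := by
      rw [le_div_iff₀ hn']
      linarith
    have h5 : c * (κ / 2) ^ 3 ≤ ‖ω y‖ := le_trans (by gcongr) (hlow y hy0)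
    have h6 : τ / (‖ω y‖ ^ 2 + τ) ≤ κ := by
      rw [div_le_iff₀ (hpos y)]
      have h7 : (c * (κ / 2) ^ 3) ^ 2 ≤ ‖ω y‖ ^ 2 := pow_le_pow_left₀ (by positivity) h5 2
      have h8 : τ = κ * (c * (κ / 2) ^ 3) ^ 2 := by rw [hτ]; ring
      nlinarith
    calc ‖w y‖ * (τ / (‖ω y‖ ^ 2 + τ)) ≤ (Cw * nrm y ^ (-(1 / 2) : ℝ)) * κ :=
          mul_le_mul (h1 y) h6 hfac0 (by positivity)
      _ = Cw * κ * nrm y ^ (-(1 / 2) : ℝ) := by ring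
      _ ≤ _ := by gcongr; linarith

/-- Functions that are `O(η nrm ^ (-1/2))` on the transition region become `O(η N ^ (-3/2))` when
multiplied by cut-off weights, the size required by `norm_finsum_le`. -/
lemma CutoffWeights.norm_mul_le {d : ℕ → ℤ × ℤ → ℂ} {A C η : ℝ} (hA : 0 ≤ A) (hC : 0 ≤ C)
    (hη : 0 ≤ η) (hd1 : ∀ N : ℕ, 1 ≤ N → ∀ y, d N y ≠ 0 → N ≤ A * nrm y ∧ nrm y ≤ A * N)
    (hd2 : ∀ N : ℕ, 1 ≤ N → ∀ y, ‖d N y‖ ≤ C * (N : ℝ) ^ (-1 : ℝ)) {N : ℕ} (hN : 1 ≤ N)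
    {v : ℤ × ℤ → ℂ} (hv : ∀ y, d N y ≠ 0 → ‖v y‖ ≤ η * nrm y ^ (-(1 / 2) : ℝ)) (y : ℤ × ℤ) :
    ‖d N y * v y‖ ≤ (C * A ^ (1 / 2 : ℝ) * η) * (N : ℝ) ^ (-(3 / 2) : ℝ) := by
  have hN0 : (0 : ℝ) < N := by exact_mod_cast hN
  by_cases h0 : d N y = 0
  · rw [h0, zero_mul, norm_zero]; positivity
  have e : (N : ℝ) ^ (-(3 / 2) : ℝ) = (N : ℝ) ^ (-1 : ℝ) * (N : ℝ) ^ (-(1 / 2) : ℝ) := by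
    rw [← Real.rpow_add hN0]; norm_num
  have h4 := rpow_nrm_le (p := 1 / 2) hA (by norm_num) hN (hd1 N hN y h0).1
  rw [norm_mul, e]
  calc _ ≤ (C * (N : ℝ) ^ (-1 : ℝ)) * (η * (A ^ (1 / 2 : ℝ) * (N : ℝ) ^ (-(1 / 2) : ℝ))) := by
        refine mul_le_mul (hd2 N hN y) ((hv y h0).trans ?_) (norm_nonneg _) (by positivity)
        gcongr
    _ = _ := by ring

lemma Outgoing.decay_rows (hw : Outgoing ξ w) (s : ℤ) :
    Decay (3 / 2) (fun y => if s ≤ y.2 then 0 else w y) := by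
  obtain ⟨C, hC, h⟩ := hw.decay_boundary
  refine ⟨C * (1 + |(s : ℝ)|), by positivity, fun y => ?_⟩
  have hn := Real.rpow_pos_of_pos (nrm_pos y) (-(3 / 2))
  beta_reduce
  split_ifs with hy
  · rw [norm_zero]; positivity
  · by_cases hy2 : y.2 < 0
    · rw [hw.eq_zero y hy2, norm_zero]; positivity
    · refine (h y).trans ?_
      have : |(y.2 : ℝ)| ≤ |(s : ℝ)| := by
        have : |y.2| ≤ |s| := by
          rw [abs_of_nonneg (by omega), abs_of_nonneg (by omega)]
          omega
        exact_mod_cast this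
      gcongr

/-- With `W = (shift - a) discOp` and a multiplier `M` that inverts the symbol of its transpose, `d w` is
close to `Wᵗ (d M w)`; moving `W` to the kernel makes the pairing small, since `W F` is small on
the upper rows. -/
lemma Outgoing.pairing_le {b : ℝ} {F : ℤ × ℤ → ℂ} (hF : OutgoingKernel b F) (hξ : SlowPhase ξ)
    (hw : Outgoing ξ w) {d : ℕ → ℤ × ℤ → ℂ} (hd : CutoffWeights d)
    (hroot : ∀ y, sliceRoot b 0 (-(ξ y).1) = opSymbol (ξ y) (shift (-1, 1))) {c : ℝ} (hc : 0 < c)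
    (hlow : ∀ y : ℤ × ℤ, 0 ≤ y.2 → c * ((y.2 : ℝ) / nrm y) ^ 3 ≤ ‖opSymbol (ξ y) (reflOp b)‖) :
    ∃ K : ℝ, 0 ≤ K ∧ ∀ κ : ℝ, 0 < κ → ∃ f : ℕ → ℂ, Tendsto f atTop (𝓝 0) ∧
      ∀ᶠ N : ℕ in atTop, ‖∑ᶠ y, F y * (d N y * w y)‖ ≤ K * κ + ‖f N‖ := by
  obtain ⟨K, hK, hmul⟩ := hw.exists_multiplier hξ hc hlow
  obtain ⟨⟨CF, hCF, hFL⟩, s, MF, hMF, hslice⟩ := hF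
  have hFlin : LinearGrowth F := ⟨CF, hCF, hFL⟩
  obtain ⟨D, hD, hDle⟩ := exists_sliceW_sq_le b
  obtain ⟨A, hA, hd1⟩ := hd.support
  obtain ⟨Cd, hCd, hd2⟩ := hd.bound
  obtain ⟨Cw, hCw, hw1⟩ := hw.decay
  have hA0 : 0 ≤ A := by linarith
  set Q : ℝ := (2 * ⌈A⌉₊ + 1) ^ 2 with hQ
  refine ⟨Q * Real.sqrt CF * (Cd * A ^ (1 / 2 : ℝ) * (K + D * Cw)) +
    Q * Real.sqrt (2 * MF) * (Cd * A ^ (1 / 2 : ℝ) * Cw), by positivity, fun κ hκ => ?_⟩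
  obtain ⟨M, hM, R, hMR⟩ := hmul κ hκ
  obtain ⟨B, hB, hMB⟩ := hM.1.exists_bound
  -- the accuracy of `a` is chosen after `M`, so that `M` times the error remains of order `κ`
  set τ : ℝ := κ / (B + 1) with hτ
  have hτ0 : 0 < τ := by positivity
  have hτB : τ * B ≤ κ := by
    rw [hτ, div_mul_eq_mul_div, div_le_iff₀ (by positivity)]
    nlinarith
  obtain ⟨a, ha, hrow⟩ := hslice τ hτ0
  set W : DiffOp := (shift (0, 1) - a) * discOp b opX with hW
  set v : ℤ × ℤ → ℂ := fun y => M y * w y with hv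
  have hvd : Decay (1 / 2) v := hM.1.bdd_mul hw.decay
  -- the symbol of the transpose of `W` is within `D τ` of that of `reflOp`
  have hsymb : ∀ y, ‖opSymbol (ξ y) (reflOp b) - opSymbol (ξ y) (transpose W)‖ ≤ D * τ := by
    intro y
    have e1 : opSymbol (-(ξ y)) (shift (0, 1)) = opSymbol (ξ y) (shift (0, -1)) := by
      rw [opSymbol_shift, opSymbol_shift]; simp
    have e2 : opSymbol (ξ y) (reflOp b) - opSymbol (ξ y) (transpose W) =
        -((sliceRoot b 0 (-(ξ y)).1 - opSymbol (-(ξ y)) a) * sliceDisc b (ξ y).1) := by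
      rw [opSymbol_transpose, hW, reflOp, map_mul, map_mul, map_sub, map_sub, opSymbol_discOp,
        opSymbol_discOp, e1, Prod.fst_neg, hroot y]
      have : sliceDisc b (-(ξ y).1) = sliceDisc b (ξ y).1 := by simp [sliceDisc]
      rw [this]
      ring
    rw [e2, norm_neg, norm_mul, ← sliceW_sq_zero, norm_pow, mul_comm D]
    exact mul_le_mul (ha _) (hDle _) (by positivity) hτ0.le
  -- the negligible part of the replacement of the symbol by the operator
  have hneg : Negligible fun N y => d N y * (opSymbol (ξ y) (transpose W) * v y) -
      diffAct (transpose W) (fun z => d N z * v z) y := by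
    have h1 := (hd.commute hvd (transpose W)).const_mul (-1)
    have h2 := (hd.negligible (hw.diffAct_mul hξ hM (transpose W))).const_mul (-1)
    have := h1.add h2
    convert this using 2 with N
    ext y
    simp only [hv]
    ring
  -- the rows below `s`, on which `W F` need not be small
  have hlowrows : Negligible fun N y => d N y * (M y * if s ≤ y.2 then 0 else w y) :=
    hd.negligible (hM.1.bdd_mul (hw.decay_rows s))
  set F₁ : ℤ × ℤ → ℂ := fun y => if s ≤ y.2 then diffAct W F y else 0 with hF₁
  refine ⟨fun N => ∑ᶠ y, F y * (d N y * (opSymbol (ξ y) (transpose W) * v y) -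
      diffAct (transpose W) (fun z => d N z * v z) y) +
    ∑ᶠ y, diffAct W F y * (d N y * (M y * if s ≤ y.2 then 0 else w y)), ?_, ?_⟩
  · simpa using (hneg.tendsto hFlin).add (hlowrows.tendsto (hFlin.diffAct W))
  filter_upwards [eventually_ge_atTop 1, eventually_ge_atTop ⌈A * R⌉₊] with N hN hNR
  -- the error of the multiplier, the small rows of `W F`, and two negligible terms
  have hsplit : ∑ᶠ y, F y * (d N y * w y) =
      ∑ᶠ y, F y * (d N y * (w y - opSymbol (ξ y) (transpose W) * v y)) +
      ∑ᶠ y, F₁ y * (d N y * v y) +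
      (∑ᶠ y, F y * (d N y * (opSymbol (ξ y) (transpose W) * v y) -
        diffAct (transpose W) (fun z => d N z * v z) y) +
      ∑ᶠ y, diffAct W F y * (d N y * (M y * if s ≤ y.2 then 0 else w y))) := by
    have fs := fun u => hd.finite_support hN u
    have e1 : ∑ᶠ y, F₁ y * (d N y * v y) +
        ∑ᶠ y, diffAct W F y * (d N y * (M y * if s ≤ y.2 then 0 else w y)) =
        ∑ᶠ y, F y * diffAct (transpose W) (fun z => d N z * v z) y := by
      rw [finsum_mul_diffAct W F (fs v),
        ← finsum_add_distrib (finite_support_mul _ (fs _)) (finite_support_mul _ (fs _))]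
      refine finsum_congr fun y => ?_
      simp only [hF₁, hv]
      split_ifs <;> ring
    have e2 : ∑ᶠ y, F y * (d N y * w y) =
        ∑ᶠ y, F y * (d N y * (w y - opSymbol (ξ y) (transpose W) * v y)) +
        (∑ᶠ y, F y * (d N y * (opSymbol (ξ y) (transpose W) * v y) -
          diffAct (transpose W) (fun z => d N z * v z) y) +
        ∑ᶠ y, F y * diffAct (transpose W) (fun z => d N z * v z) y) := by
      rw [← finsum_add_distrib (finite_support_mul _ (hneg.finite_support hN))
        (finite_support_mul _ (diffAct_finite_support _ (fs v))),
        ← finsum_add_distrib (finite_support_mul _ (fs _))]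
      · refine finsum_congr fun y => ?_
        ring
      · refine ((fs fun y => opSymbol (ξ y) (transpose W) * v y)).subset fun y hy => ?_
        intro h0
        refine hy ?_
        beta_reduce at h0 ⊢
        rw [← mul_add, sub_add_cancel, h0, mul_zero]
    rw [e2, ← e1]
    ring
  rw [hsplit]
  refine (norm_add_le _ _).trans (add_le_add_left ?_ _)
  refine (norm_add_le _ _).trans ?_
  rw [add_mul]
  refine add_le_add ?_ ?_
  · have hη : ∀ y, d N y ≠ 0 → ‖w y - opSymbol (ξ y) (transpose W) * v y‖ ≤
        ((K + D * Cw) * κ) * nrm y ^ (-(1 / 2) : ℝ) := by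
      intro y hy
      have hn := Real.rpow_pos_of_pos (nrm_pos y) (-(1 / 2))
      have hRy : R ≤ nrm y := by
        have h1 := (hd1 N hN y hy).1
        have h2 : A * R ≤ N := (Nat.le_ceil _).trans (by exact_mod_cast hNR)
        nlinarith
      have e : w y - opSymbol (ξ y) (transpose W) * v y =
          w y * (1 - opSymbol (ξ y) (reflOp b) * M y) +
          (opSymbol (ξ y) (reflOp b) - opSymbol (ξ y) (transpose W)) * (M y * w y) := by
        simp only [hv]; ring
      rw [e]
      refine (norm_add_le _ _).trans ?_
      have h3 : ‖(opSymbol (ξ y) (reflOp b) - opSymbol (ξ y) (transpose W)) * (M y * w y)‖ ≤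
          (D * τ) * (B * (Cw * nrm y ^ (-(1 / 2) : ℝ))) := by
        rw [norm_mul, norm_mul]
        have := hw1 y
        have := hMB y
        have := hsymb y
        gcongr
      have h4 : (D * τ) * (B * (Cw * nrm y ^ (-(1 / 2) : ℝ))) ≤
          D * Cw * κ * nrm y ^ (-(1 / 2) : ℝ) := by
        calc _ = D * Cw * (τ * B) * nrm y ^ (-(1 / 2) : ℝ) := by ring
          _ ≤ _ := by gcongr
      linarith [hMR y hRy]
    refine (norm_finsum_le hCF (η := Cd * A ^ (1 / 2 : ℝ) * ((K + D * Cw) * κ)) (by positivity)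
      hFL hN (fun y hy => (hd1 N hN y (left_ne_zero_of_mul hy)).2)
      (CutoffWeights.norm_mul_le hA0 hCd (by positivity) hd1 hd2 hN hη)).trans (le_of_eq ?_)
    ring
  · have hF₁L : ∀ R : ℕ, ∑ y ∈ box R, ‖F₁ y‖ ^ 2 ≤ 2 * (MF * τ ^ 2) * (R + 1) := by
      refine sum_box_le_of_row_sum (by positivity) fun t S => ?_
      simp only [hF₁]
      by_cases ht : s ≤ t
      · simp only [ht, if_true]
        exact hrow t ht S
      · simp only [ht, if_false, norm_zero]
        simp only [ne_eq, OfNat.ofNat_ne_zero, not_false_eq_true, zero_pow, Finset.sum_const_zero]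
        positivity
    have hη : ∀ y, d N y ≠ 0 → ‖v y‖ ≤ (B * Cw) * nrm y ^ (-(1 / 2) : ℝ) := by
      intro y _
      simp only [hv]
      rw [norm_mul, mul_assoc]
      have := hw1 y
      have := hMB y
      gcongr
    refine (norm_finsum_le (by positivity) (η := Cd * A ^ (1 / 2 : ℝ) * (B * Cw)) (by positivity)
      hF₁L hN (fun y hy => (hd1 N hN y (left_ne_zero_of_mul hy)).2)
      (CutoffWeights.norm_mul_le hA0 hCd (by positivity) hd1 hd2 hN hη)).trans ?_
    rw [← mul_assoc 2, Real.sqrt_mul (by positivity), Real.sqrt_sq hτ0.le]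
    calc _ = Q * Real.sqrt (2 * MF) * (Cd * A ^ (1 / 2 : ℝ) * Cw) * (τ * B) := by ring
      _ ≤ _ := by gcongr

/-- The pairing of an outgoing kernel with an outgoing function over the transition region of a
cut-off at scale `N` tends to zero. -/
theorem Outgoing.pairing_tendsto {b : ℝ} {F : ℤ × ℤ → ℂ} (hF : OutgoingKernel b F)
    (hξ : SlowPhase ξ) (hw : Outgoing ξ w) {d : ℕ → ℤ × ℤ → ℂ} (hd : CutoffWeights d)
    (hroot : ∀ y, sliceRoot b 0 (-(ξ y).1) = opSymbol (ξ y) (shift (-1, 1))) {c : ℝ} (hc : 0 < c)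
    (hlow : ∀ y : ℤ × ℤ, 0 ≤ y.2 → c * ((y.2 : ℝ) / nrm y) ^ 3 ≤ ‖opSymbol (ξ y) (reflOp b)‖) :
    Tendsto (fun N => ∑ᶠ y, F y * (d N y * w y)) atTop (𝓝 0) := by
  obtain ⟨K, hK, h⟩ := hw.pairing_le hF hξ hd hroot hc hlow
  rw [Metric.tendsto_nhds]
  intro ε hε
  obtain ⟨f, hf, h⟩ := h (ε / (2 * (K + 1))) (by positivity)
  have hf' := (Metric.tendsto_nhds.1 hf) (ε / 2) (by positivity)
  filter_upwards [h, hf'] with N h1 h2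
  rw [dist_zero_right] at h2 ⊢
  have : K * (ε / (2 * (K + 1))) ≤ ε / 2 := by
    rw [mul_div_assoc', div_le_div_iff₀ (by positivity) (by positivity)]
    nlinarith
  linarith

/-! ### The far-field points and the root function -/

lemma symbol_eq_zero_real {k : ℝ} {ξ : ℝ × ℝ} (h : symbol ((k : ℂ) ^ 2) ξ = 0) :
    k ^ 2 - 6 + 2 * Real.cos ξ.1 + 2 * Real.cos ξ.2 + 2 * Real.cos (ξ.1 - ξ.2) = 0 := by
  have e : symbol ((k : ℂ) ^ 2) ξ =
      ((k ^ 2 - 6 + 2 * Real.cos ξ.1 + 2 * Real.cos ξ.2 + 2 * Real.cos (ξ.1 - ξ.2) : ℝ) : ℂ) := by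
    simp [symbol]
  rw [e] at h
  exact_mod_cast h

/-- On the zero set of the symbol, the slice discriminant is the square of the second component of
the gradient. -/
lemma sliceDisc_eq_sq {k : ℝ} {ξ : ℝ × ℝ} (h : symbol ((k : ℂ) ^ 2) ξ = 0) :
    sliceDisc (6 - k ^ 2) ξ.1 = (2 * Real.sin ξ.2 - 2 * Real.sin (ξ.1 - ξ.2)) ^ 2 := by
  have h1 := symbol_eq_zero_real h
  have h2 : Real.cos ξ.1 = Real.cos ξ.2 * Real.cos (ξ.1 - ξ.2) -
      Real.sin ξ.2 * Real.sin (ξ.1 - ξ.2) := by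
    rw [← Real.cos_add]; congr 1; ring
  have h3 : 6 - k ^ 2 - 2 * Real.cos ξ.1 = 2 * Real.cos ξ.2 + 2 * Real.cos (ξ.1 - ξ.2) := by
    linarith
  rw [sliceDisc, h3, h2]
  nlinarith [Real.sin_sq_add_cos_sq ξ.2, Real.sin_sq_add_cos_sq (ξ.1 - ξ.2)]

lemma exp_I_mul_eq (t : ℝ) : Complex.exp (Complex.I * t) = Real.cos t + Complex.I * Real.sin t := by
  rw [mul_comm, Complex.exp_mul_I, ← Complex.ofReal_cos, ← Complex.ofReal_sin, mul_comm Complex.I]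

lemma sliceW_eq {k : ℝ} {ξ : ℝ × ℝ} (h : symbol ((k : ℂ) ^ 2) ξ = 0)
    (h0 : 0 ≤ 2 * Real.sin ξ.2 - 2 * Real.sin (ξ.1 - ξ.2)) :
    sliceW (6 - k ^ 2) 0 ξ.1 = ((2 * Real.sin ξ.2 - 2 * Real.sin (ξ.1 - ξ.2) : ℝ) : ℂ) := by
  set x := 2 * Real.sin ξ.2 - 2 * Real.sin (ξ.1 - ξ.2)
  have h1 : sliceW (6 - k ^ 2) 0 ξ.1 ^ 2 = (x : ℂ) ^ 2 := by
    rw [sliceW_sq_zero, sliceDisc_eq_sq h, Complex.ofReal_pow]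
  rcases sq_eq_sq_iff_eq_or_eq_neg.1 h1 with e | e
  · exact e
  · have h2 := sliceW_re_nonneg (6 - k ^ 2) 0 ξ.1
    rw [e, Complex.neg_re, Complex.ofReal_re] at h2
    have h3 : x = 0 := by linarith
    rw [e, h3]; simp

/-- At zeros of the symbol where the second component of `-∇σ` is nonnegative, the second phase
factor is the decaying root. -/
lemma exp_eq_sliceRoot {k : ℝ} (hk : Admissible k) {ξ : ℝ × ℝ} (h : symbol ((k : ℂ) ^ 2) ξ = 0)
    (h0 : 0 ≤ 2 * Real.sin ξ.2 - 2 * Real.sin (ξ.1 - ξ.2)) :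
    sliceRoot (6 - k ^ 2) 0 ξ.1 = Complex.exp (Complex.I * ξ.2) := by
  have h1 := symbol_eq_zero_real h
  have h3 : 6 - k ^ 2 - 2 * Real.cos ξ.1 = 2 * Real.cos ξ.2 + 2 * Real.cos (ξ.1 - ξ.2) := by
    linarith
  have hd : sliceA (6 - k ^ 2) 0 ξ.1 - Complex.I * sliceW (6 - k ^ 2) 0 ξ.1 =
      2 * Complex.exp (Complex.I * ((-ξ.2 : ℝ) : ℂ)) +
        2 * Complex.exp (Complex.I * ((ξ.1 - ξ.2 : ℝ) : ℂ)) := by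
    rw [sliceA, h3, sliceW_eq h h0, exp_I_mul_eq, exp_I_mul_eq, Real.cos_neg, Real.sin_neg]
    push_cast
    ring
  have hne := slice_denom_ne_zero hk.ne le_rfl ξ.1
  rw [sliceRoot, div_eq_iff hne, hd]
  have e1 : Complex.exp (Complex.I * ξ.2) * Complex.exp (Complex.I * ((-ξ.2 : ℝ) : ℂ)) = 1 := by
    rw [← Complex.exp_add]; simp
  have e2 : Complex.exp (Complex.I * ξ.2) * Complex.exp (Complex.I * ((ξ.1 - ξ.2 : ℝ) : ℂ)) =
      Complex.exp (Complex.I * ξ.1) := by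
    rw [← Complex.exp_add]; congr 1; push_cast; ring
  linear_combination (-2) * e1 - 2 * e2

/-- The symbol of `reflOp` vanishes at most to third order in the second component of the gradient:
the discriminant is its square, and the phase factors differ by at least half of it. -/
lemma norm_opSymbol_reflOp {k : ℝ} {ξ : ℝ × ℝ} (h : symbol ((k : ℂ) ^ 2) ξ = 0) :
    (2 * Real.sin ξ.2 - 2 * Real.sin (ξ.1 - ξ.2)) ^ 3 / 2 ≤
      ‖opSymbol ξ (reflOp (6 - k ^ 2))‖ := by
  set x := 2 * Real.sin ξ.2 - 2 * Real.sin (ξ.1 - ξ.2) with hx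
  rw [reflOp, map_mul, map_sub, opSymbol_discOp, opSymbol_shift, opSymbol_shift, sliceDisc_eq_sq h,
    norm_mul, Complex.norm_real, Real.norm_eq_abs, abs_of_nonneg (sq_nonneg _)]
  have h1 : x / 2 ≤ ‖Complex.exp (Complex.I * (((0, -1) : ℤ × ℤ).1 * ξ.1 + ((0, -1) : ℤ × ℤ).2 * ξ.2)) -
      Complex.exp (Complex.I * (((-1, 1) : ℤ × ℤ).1 * ξ.1 + ((-1, 1) : ℤ × ℤ).2 * ξ.2))‖ := by
    have e1 : Complex.exp (Complex.I * (((0, -1) : ℤ × ℤ).1 * ξ.1 + ((0, -1) : ℤ × ℤ).2 * ξ.2)) =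
        Complex.exp (Complex.I * ((-ξ.2 : ℝ) : ℂ)) := by congr 2; push_cast; ring
    have e2 : Complex.exp (Complex.I * (((-1, 1) : ℤ × ℤ).1 * ξ.1 + ((-1, 1) : ℤ × ℤ).2 * ξ.2)) =
        Complex.exp (Complex.I * ((-(ξ.1 - ξ.2) : ℝ) : ℂ)) := by congr 2; push_cast; ring
    rw [e1, e2]
    refine le_trans ?_ (Complex.abs_im_le_norm _)
    refine le_trans (le_of_eq ?_) (neg_le_abs _)
    rw [Complex.sub_im, mul_comm Complex.I, mul_comm Complex.I, Complex.exp_ofReal_mul_I_im,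
      Complex.exp_ofReal_mul_I_im, Real.sin_neg, Real.sin_neg]
    linarith
  rw [← hx]
  nlinarith [mul_le_mul_of_nonneg_right h1 (sq_nonneg x)]

/-! ### The phases of the radiation condition -/

lemma absZ_eq_norm (y : ℤ × ℤ) : absZ y = ‖((y.1 : ℝ) + (y.2 : ℝ) * Complex.I : ℂ)‖ := by
  rw [absZ, Complex.norm_add_mul_I]

lemma absZ_nonneg (y : ℤ × ℤ) : 0 ≤ absZ y := Real.sqrt_nonneg _

lemma abs_fst_le_absZ (y : ℤ × ℤ) : |(y.1 : ℝ)| ≤ absZ y :=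
  Real.abs_le_sqrt (by nlinarith [sq_nonneg (y.2 : ℝ)])

lemma abs_snd_le_absZ (y : ℤ × ℤ) : |(y.2 : ℝ)| ≤ absZ y :=
  Real.abs_le_sqrt (by nlinarith [sq_nonneg (y.1 : ℝ)])

lemma absZ_le_nrm (y : ℤ × ℤ) : absZ y ≤ nrm y := by
  refine Real.sqrt_le_iff.2 ⟨(nrm_pos y).le, ?_⟩
  have h1 := abs_nonneg (y.1 : ℝ)
  have h2 := abs_nonneg (y.2 : ℝ)
  rw [← sq_abs (y.1 : ℝ), ← sq_abs (y.2 : ℝ), nrm]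
  nlinarith [mul_nonneg h1 h2]

lemma one_le_absZ {y : ℤ × ℤ} (hy : y ≠ 0) : 1 ≤ absZ y := by
  have : y.1 ≠ 0 ∨ y.2 ≠ 0 := by
    by_contra! h
    exact hy (Prod.ext h.1 h.2)
  rcases this with h | h
  · refine le_trans ?_ (abs_fst_le_absZ y)
    exact_mod_cast Int.one_le_abs h
  · refine le_trans ?_ (abs_snd_le_absZ y)
    exact_mod_cast Int.one_le_abs h

lemma nrm_le_absZ {y : ℤ × ℤ} (hy : y ≠ 0) : nrm y ≤ 3 * absZ y := by
  have := one_le_absZ hy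
  have := abs_fst_le_absZ y
  have := abs_snd_le_absZ y
  unfold nrm
  linarith

lemma abs_absZ_sub_le (y a : ℤ × ℤ) : |absZ (y + a) - absZ y| ≤ absZ a := by
  rw [absZ_eq_norm, absZ_eq_norm, absZ_eq_norm]
  refine (abs_norm_sub_norm_le _ _).trans (le_of_eq ?_)
  congr 1
  simp only [Prod.fst_add, Prod.snd_add]
  push_cast
  ring

/-- The polar angle, in `[0, π]`, of a point of the half-plane. -/
noncomputable def angle (y : ℤ × ℤ) : ℝ := Real.arccos (y.1 / absZ y)

lemma angle_mem (y : ℤ × ℤ) : angle y ∈ Set.Icc 0 Real.pi :=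
  ⟨Real.arccos_nonneg _, Real.arccos_le_pi _⟩

lemma abs_div_absZ_le (y : ℤ × ℤ) : |(y.1 : ℝ) / absZ y| ≤ 1 := by
  rw [abs_div, abs_of_nonneg (absZ_nonneg y)]
  exact div_le_one_of_le₀ (abs_fst_le_absZ y) (absZ_nonneg y)

lemma cos_angle (y : ℤ × ℤ) : Real.cos (angle y) = y.1 / absZ y := by
  have := abs_le.1 (abs_div_absZ_le y)
  exact Real.cos_arccos this.1 this.2

lemma sin_angle {y : ℤ × ℤ} (h0 : y ≠ 0) (hy : 0 ≤ y.2) : Real.sin (angle y) = y.2 / absZ y := by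
  have h1 : 0 < absZ y := by linarith [one_le_absZ h0]
  rw [angle, Real.sin_arccos]
  have e : absZ y ^ 2 = (y.1 : ℝ) ^ 2 + (y.2 : ℝ) ^ 2 := Real.sq_sqrt (by positivity)
  have e2 : 1 - ((y.1 : ℝ) / absZ y) ^ 2 = ((y.2 : ℝ) / absZ y) ^ 2 := by
    field_simp
    linarith
  rw [e2, Real.sqrt_sq]
  have : (0 : ℝ) ≤ y.2 := by exact_mod_cast hy
  positivity

/-- The far-field point in `D` for the direction of `y`. -/
noncomputable def farPhase (k : ℝ) (D : Set (ℝ × ℝ)) (y : ℤ × ℤ) : ℝ × ℝ :=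
  farFieldPoint k D (angle y)

lemma abs_div_sub_div_le {s t r r' e : ℝ} (hr : 0 < r) (hr' : 0 < r') (ht : |t| ≤ r')
    (hst : |t - s| ≤ e) (hrr : |r' - r| ≤ e) : |t / r' - s / r| ≤ 2 * e / r := by
  have e1 : t / r' - s / r = ((t - s) + (t / r') * (r - r')) / r := by
    field_simp
    ring
  rw [e1, abs_div, abs_of_pos hr]
  refine div_le_div_of_nonneg_right ?_ hr.le
  refine (abs_add_le _ _).trans ?_
  rw [abs_mul, abs_div, abs_of_pos hr', abs_sub_comm r r']
  have h1 : |t| / r' ≤ 1 := div_le_one_of_le₀ ht hr'.le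
  nlinarith [abs_nonneg (r' - r)]

lemma slowPhase_farPhase {k : ℝ} {D : Set (ℝ × ℝ)} {κ : ℝ} (h : WaveComponent k D κ) :
    SlowPhase (farPhase k D) := by
  obtain ⟨C, hC, hL⟩ := h.exists_lipschitz
  intro a
  have ha := one_le_nrm a
  refine ⟨C * (6 * nrm a), by positivity, fun y hy hya => ?_⟩
  have hny := nrm_pos y
  have key : |Real.cos (angle (y + a)) - Real.cos (angle y)| ≤ 6 * nrm a * nrm y ^ (-1 : ℝ) ∧
      |Real.sin (angle (y + a)) - Real.sin (angle y)| ≤ 6 * nrm a * nrm y ^ (-1 : ℝ) := by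
    rw [Real.rpow_neg_one, ← div_eq_mul_inv]
    -- near the origin the bound exceeds the trivial one
    have triv : 2 ≤ 6 * nrm a / nrm y →
        |Real.cos (angle (y + a)) - Real.cos (angle y)| ≤ 6 * nrm a / nrm y ∧
        |Real.sin (angle (y + a)) - Real.sin (angle y)| ≤ 6 * nrm a / nrm y := by
      intro h2
      constructor
      · refine le_trans ?_ h2
        rw [abs_le]
        constructor <;> linarith [Real.neg_one_le_cos (angle (y + a)), Real.cos_le_one (angle (y + a)),
          Real.neg_one_le_cos (angle y), Real.cos_le_one (angle y)]
      · refine le_trans ?_ h2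
        rw [abs_le]
        constructor <;> linarith [Real.neg_one_le_sin (angle (y + a)), Real.sin_le_one (angle (y + a)),
          Real.neg_one_le_sin (angle y), Real.sin_le_one (angle y)]
    by_cases h0 : y = 0
    · refine triv ?_
      have : nrm y = 1 := by rw [h0]; simp [nrm]
      rw [this]; linarith
    by_cases h0' : y + a = 0
    · refine triv ?_
      have : nrm y ≤ nrm a := by
        have := nrm_le_add y a
        rw [h0'] at this
        have e : nrm 0 = 1 := by simp [nrm]
        rwa [e, mul_one] at this
      rw [le_div_iff₀ hny]
      linarith
    have hr : 0 < absZ y := by linarith [one_le_absZ h0]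
    have hr' : 0 < absZ (y + a) := by linarith [one_le_absZ h0']
    have hle : 2 * nrm a / absZ y ≤ 6 * nrm a / nrm y := by
      rw [div_le_div_iff₀ hr hny]
      nlinarith [nrm_le_absZ h0]
    have hrr := (abs_absZ_sub_le y a).trans (absZ_le_nrm a)
    rw [cos_angle, cos_angle, sin_angle h0 hy, sin_angle h0' hya]
    have e1 : |((y + a).1 : ℝ) - y.1| ≤ nrm a := by
      have : ((y + a).1 : ℝ) - y.1 = a.1 := by rw [Prod.fst_add]; push_cast; ring
      rw [this]
      exact (abs_fst_le_absZ a).trans (absZ_le_nrm a)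
    have e2 : |((y + a).2 : ℝ) - y.2| ≤ nrm a := by
      have : ((y + a).2 : ℝ) - y.2 = a.2 := by rw [Prod.snd_add]; push_cast; ring
      rw [this]
      exact (abs_snd_le_absZ a).trans (absZ_le_nrm a)
    exact ⟨(abs_div_sub_div_le hr hr' (abs_fst_le_absZ _) e1 hrr).trans hle,
      (abs_div_sub_div_le hr hr' (abs_snd_le_absZ _) e2 hrr).trans hle⟩
  have := hL (angle (y + a)) (angle y) _ _ (h.isFarFieldPoint _) (h.isFarFieldPoint _) _ key.1 key.2
  rw [mul_assoc]
  exact this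

lemma WaveComponent.symbol_farPhase {k : ℝ} {D : Set (ℝ × ℝ)} {κ : ℝ} (h : WaveComponent k D κ)
    (y : ℤ × ℤ) : symbol ((k : ℂ) ^ 2) (farPhase k D y) = 0 := (h.isFarFieldPoint _).2.1

/-- In the directions of the closed upper half-plane the second component of `-∇σ` at the
far-field point is bounded below by a multiple of the sine of the angle. -/
lemma WaveComponent.exists_le_gradient {k : ℝ} {D : Set (ℝ × ℝ)} {κ : ℝ} (h : WaveComponent k D κ) :
    ∃ c : ℝ, 0 < c ∧ ∀ α, 0 ≤ Real.sin α → c * Real.sin α ≤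
      2 * Real.sin (farFieldPoint k D α).2 -
        2 * Real.sin ((farFieldPoint k D α).1 - (farFieldPoint k D α).2) := by
  obtain ⟨c₀, hc₀, hle⟩ := h.exists_le_grad
  refine ⟨c₀, hc₀, fun α hα => ?_⟩
  obtain ⟨hD, hs, c, hc, e1, e2⟩ := h.isFarFieldPoint α
  rw [e2]
  exact mul_le_mul_of_nonneg_right (hle α _ c hD hs hc.le e1 e2) hα

lemma sin_angle_nonneg (y : ℤ × ℤ) : 0 ≤ Real.sin (angle y) :=
  Real.sin_nonneg_of_mem_Icc (angle_mem y)

lemma WaveComponent.gradient_nonneg {k : ℝ} {D : Set (ℝ × ℝ)} {κ : ℝ} (h : WaveComponent k D κ)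
    (y : ℤ × ℤ) : 0 ≤ 2 * Real.sin (farPhase k D y).2 -
        2 * Real.sin ((farPhase k D y).1 - (farPhase k D y).2) := by
  obtain ⟨c, hc, hle⟩ := h.exists_le_gradient
  exact (mul_nonneg hc.le (sin_angle_nonneg y)).trans (hle _ (sin_angle_nonneg y))

/-- At the far-field points the root on the mirrored slice is the phase factor of the shift by
`(-1, 1)`. -/
lemma WaveComponent.sliceRoot_farPhase {k : ℝ} (hk : Admissible k) {D : Set (ℝ × ℝ)} {κ : ℝ}
    (h : WaveComponent k D κ) (y : ℤ × ℤ) :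
    sliceRoot (6 - k ^ 2) 0 (-(farPhase k D y).1) = opSymbol (farPhase k D y) (shift (-1, 1)) := by
  rw [sliceRoot_neg, exp_eq_sliceRoot hk (h.symbol_farPhase y) (h.gradient_nonneg y), opSymbol_shift,
    ← Complex.exp_add]
  congr 1
  push_cast
  ring

lemma WaveComponent.exists_le_reflOp {k : ℝ} {D : Set (ℝ × ℝ)} {κ : ℝ} (h : WaveComponent k D κ) :
    ∃ c : ℝ, 0 < c ∧ ∀ y : ℤ × ℤ, 0 ≤ y.2 →
      c * ((y.2 : ℝ) / nrm y) ^ 3 ≤ ‖opSymbol (farPhase k D y) (reflOp (6 - k ^ 2))‖ := by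
  obtain ⟨c, hc, hle⟩ := h.exists_le_gradient
  refine ⟨c ^ 3 / 2, by positivity, fun y hy => ?_⟩
  by_cases h0 : y = 0
  · subst h0; simp
  refine le_trans ?_ (norm_opSymbol_reflOp (h.symbol_farPhase y))
  have h1 := hle _ (sin_angle_nonneg y)
  rw [sin_angle h0 hy] at h1
  have hy' : (0 : ℝ) ≤ y.2 := by exact_mod_cast hy
  have hn := nrm_pos y
  have hr : 0 < absZ y := by linarith [one_le_absZ h0]
  have h2 : (y.2 : ℝ) / nrm y ≤ y.2 / absZ y := div_le_div_of_nonneg_left hy' hr (absZ_le_nrm y)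
  have h3 : c * ((y.2 : ℝ) / nrm y) ≤ 2 * Real.sin (farPhase k D y).2 -
        2 * Real.sin ((farPhase k D y).1 - (farPhase k D y).2) :=
    (mul_le_mul_of_nonneg_left h2 hc.le).trans h1
  have h4 := pow_le_pow_left₀ (by positivity) h3 3
  rw [mul_pow] at h4
  linarith

/-! ### Radiating functions are outgoing -/

/-- Extension by zero from the half-plane to the lattice. -/
noncomputable def extend (w : ℤ × ℤ → ℂ) (y : ℤ × ℤ) : ℂ := if 0 ≤ y.2 then w y else 0

lemma mem_halfPlane {y : ℤ × ℤ} : y ∈ halfPlane ↔ 0 ≤ y.2 := by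
  simp only [halfPlane, interiorPts, boundaryPts, Set.mem_union, Set.mem_ofPred_eq]
  omega

/-- The radiation estimates in terms of the weight `nrm` and of the phases `farPhase`. -/
lemma RadiatesIn.exists_bound {k : ℝ} {D : Set (ℝ × ℝ)} {w : ℤ × ℤ → ℂ} (h : RadiatesIn k D w) :
    ∃ C : ℝ, 0 ≤ C ∧ ∀ y : ℤ × ℤ, 0 ≤ y.2 →
      ‖w y‖ ≤ C * nrm y ^ (-(1 / 2) : ℝ) ∧
      ‖w (y + (1, 0)) - Complex.exp (Complex.I * (farPhase k D y).1) * w y‖ ≤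
        C * nrm y ^ (-(3 / 2) : ℝ) ∧
      ‖w (y + (0, 1)) - Complex.exp (Complex.I * (farPhase k D y).2) * w y‖ ≤
        C * nrm y ^ (-(3 / 2) : ℝ) := by
  obtain ⟨C, h⟩ := h
  have hC : 0 ≤ C := by
    obtain ⟨h1, -, -⟩ := h (1, 0) (mem_halfPlane.2 le_rfl) (by simp) 0
      ⟨le_rfl, Real.pi_pos.le⟩ (by simp [absZ]) (by simp)
    have e : absZ (1, 0) = 1 := by simp [absZ]
    rw [e, Real.one_rpow, mul_one] at h1
    exact (norm_nonneg _).trans h1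
  have conv : ∀ p : ℝ, 0 ≤ p → ∀ y : ℤ × ℤ, y ≠ 0 →
      absZ y ^ (-p) ≤ (3 : ℝ) ^ p * nrm y ^ (-p) := by
    intro p hp y hy
    have h1 : 0 < absZ y := by linarith [one_le_absZ hy]
    have h2 := Real.rpow_le_rpow (nrm_pos y).le (nrm_le_absZ hy) hp
    rw [Real.mul_rpow (by norm_num) h1.le] at h2
    have h3 := Real.rpow_pos_of_pos (nrm_pos y) p
    have h4 := Real.rpow_pos_of_pos h1 p
    rw [Real.rpow_neg h1.le, Real.rpow_neg (nrm_pos y).le, ← div_eq_mul_inv, le_div_iff₀ h3,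
      inv_mul_le_iff₀ h4, mul_comm]
    exact h2
  set C₁ := C * (3 : ℝ) ^ (3 / 2 : ℝ) with hC₁
  have h3 : (3 : ℝ) ^ (1 / 2 : ℝ) ≤ (3 : ℝ) ^ (3 / 2 : ℝ) :=
    Real.rpow_le_rpow_of_exponent_le (by norm_num) (by norm_num)
  set C₂ := ‖w 0‖ + ‖w (0 + (1, 0)) - Complex.exp (Complex.I * (farPhase k D 0).1) * w 0‖ +
    ‖w (0 + (0, 1)) - Complex.exp (Complex.I * (farPhase k D 0).2) * w 0‖ with hC₂
  have hC₂0 : 0 ≤ C₂ := by positivity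
  have hC₁0 : 0 ≤ C₁ := by positivity
  refine ⟨C₁ + C₂, by positivity, fun y hy => ?_⟩
  by_cases h0 : y = 0
  · subst h0
    have e : nrm 0 = 1 := by simp [nrm]
    rw [e, Real.one_rpow, Real.one_rpow, mul_one]
    have n1 := norm_nonneg (w 0)
    have n2 := norm_nonneg (w (0 + (1, 0)) - Complex.exp (Complex.I * (farPhase k D 0).1) * w 0)
    have n3 := norm_nonneg (w (0 + (0, 1)) - Complex.exp (Complex.I * (farPhase k D 0).2) * w 0)
    refine ⟨?_, ?_, ?_⟩ <;> linarith
  · have hr : 0 < absZ y := by linarith [one_le_absZ h0]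
    obtain ⟨h1, h2, h4⟩ := h y (mem_halfPlane.2 hy) h0 (angle y) (angle_mem y)
      (by rw [cos_angle]; field_simp) (by rw [sin_angle h0 hy]; field_simp)
    have q1 := Real.rpow_pos_of_pos (nrm_pos y) (-(1 / 2))
    have q2 := Real.rpow_pos_of_pos (nrm_pos y) (-(3 / 2))
    have b2 : C * absZ y ^ (-(3 / 2) : ℝ) ≤ (C₁ + C₂) * nrm y ^ (-(3 / 2) : ℝ) := by
      calc _ ≤ C * ((3 : ℝ) ^ (3 / 2 : ℝ) * nrm y ^ (-(3 / 2) : ℝ)) := by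
            gcongr; exact conv _ (by norm_num) y h0
        _ = C₁ * nrm y ^ (-(3 / 2) : ℝ) := by rw [hC₁]; ring
        _ ≤ _ := by gcongr; linarith
    refine ⟨?_, h2.trans b2, h4.trans b2⟩
    calc _ ≤ C * absZ y ^ (-(1 / 2) : ℝ) := h1
      _ ≤ C * ((3 : ℝ) ^ (1 / 2 : ℝ) * nrm y ^ (-(1 / 2) : ℝ)) := by
            gcongr; exact conv _ (by norm_num) y h0
      _ ≤ C * ((3 : ℝ) ^ (3 / 2 : ℝ) * nrm y ^ (-(1 / 2) : ℝ)) := by gcongr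
      _ = C₁ * nrm y ^ (-(1 / 2) : ℝ) := by rw [hC₁]; ring
      _ ≤ _ := by gcongr; linarith

/-- Summing the vertical shift estimate upward from `Γ`: a radiating function that is
`O(nrm ^ (-3/2))` on `Γ` is small near `Γ`. -/
lemma exists_decay_boundary {D C : ℝ} {w : ℤ × ℤ → ℂ} {φ : ℤ × ℤ → ℝ} (hD : 0 ≤ D) (hC : 0 ≤ C)
    (h0 : ∀ y : ℤ × ℤ, y.2 = 0 → ‖w y‖ ≤ D * nrm y ^ (-(3 / 2) : ℝ))
    (h1 : ∀ y : ℤ × ℤ, 0 ≤ y.2 → ‖w y‖ ≤ C * nrm y ^ (-(1 / 2) : ℝ))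
    (h2 : ∀ y : ℤ × ℤ, 0 ≤ y.2 → ‖w (y + (0, 1)) - Complex.exp (Complex.I * φ y) * w y‖ ≤
        C * nrm y ^ (-(3 / 2) : ℝ)) :
    ∃ K : ℝ, 0 ≤ K ∧ ∀ y : ℤ × ℤ, 0 ≤ y.2 →
      ‖w y‖ ≤ K * (1 + |(y.2 : ℝ)|) * nrm y ^ (-(3 / 2) : ℝ) := by
  have step : ∀ (m : ℤ) (t : ℕ), ‖w (m, t)‖ ≤
      (D + C * t) * (1 + |(m : ℝ)|) ^ (-(3 / 2) : ℝ) := by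
    intro m t
    have hm := abs_nonneg (m : ℝ)
    induction t with
    | zero =>
      have := h0 (m, 0) rfl
      simpa [nrm] using this
    | succ t ih =>
      have e : ((m, ((t + 1 : ℕ) : ℤ)) : ℤ × ℤ) = (m, (t : ℤ)) + (0, 1) := by ext <;> simp
      have ht : (0 : ℤ) ≤ ((m, (t : ℤ)) : ℤ × ℤ).2 := by simp
      have h3 := h2 (m, t) ht
      have h4 : nrm (m, (t : ℤ)) ^ (-(3 / 2) : ℝ) ≤ (1 + |(m : ℝ)|) ^ (-(3 / 2) : ℝ) := by
        refine Real.rpow_le_rpow_of_nonpos (by positivity) ?_ (by norm_num)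
        unfold nrm
        linarith [abs_nonneg (((t : ℤ)) : ℝ)]
      have h5 := norm_sub_norm_le (w ((m, (t : ℤ)) + (0, 1)))
        (Complex.exp (Complex.I * φ (m, t)) * w (m, t))
      rw [norm_mul, norm_exp_I_mul, one_mul] at h5
      rw [e]
      push_cast
      have h6 := mul_le_mul_of_nonneg_left h4 hC
      linarith
  refine ⟨(D + C) * (2 : ℝ) ^ (3 / 2 : ℝ) + 2 * C, by positivity, fun y hy => ?_⟩
  have hy' : (0 : ℝ) ≤ y.2 := by exact_mod_cast hy
  have hn := nrm_pos y
  have q1 := Real.rpow_pos_of_pos hn (-(3 / 2))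
  have q2 := Real.rpow_pos_of_pos (show (0 : ℝ) < 2 by norm_num) (3 / 2)
  rw [abs_of_nonneg hy']
  have hm := abs_nonneg (y.1 : ℝ)
  by_cases hcase : (y.2 : ℝ) ≤ 1 + |(y.1 : ℝ)|
  · have e : y = (y.1, ((y.2.toNat : ℕ) : ℤ)) := by
      ext
      · rfl
      · simp [Int.toNat_of_nonneg hy]
    have h3 := step y.1 y.2.toNat
    rw [← e] at h3
    have e2 : ((y.2.toNat : ℕ) : ℝ) = y.2 := by
      have : ((y.2.toNat : ℕ) : ℤ) = y.2 := Int.toNat_of_nonneg hy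
      exact_mod_cast this
    rw [e2] at h3
    have h4 : (1 + |(y.1 : ℝ)|) ^ (-(3 / 2) : ℝ) ≤ (2 : ℝ) ^ (3 / 2 : ℝ) * nrm y ^ (-(3 / 2) : ℝ) := by
      have h5 : nrm y ≤ 2 * (1 + |(y.1 : ℝ)|) := by
        rw [nrm, abs_of_nonneg hy']; linarith
      have h6 := Real.rpow_le_rpow_of_nonpos hn h5 (show (-(3 / 2) : ℝ) ≤ 0 by norm_num)
      rw [Real.mul_rpow (by norm_num) (by positivity), Real.rpow_neg (by norm_num : (0 : ℝ) ≤ 2)] at h6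
      rwa [inv_mul_le_iff₀ q2] at h6
    calc ‖w y‖ ≤ _ := h3
      _ ≤ (D + C * y.2) * ((2 : ℝ) ^ (3 / 2 : ℝ) * nrm y ^ (-(3 / 2) : ℝ)) := by gcongr
      _ ≤ ((D + C) * (1 + y.2)) * ((2 : ℝ) ^ (3 / 2 : ℝ) * nrm y ^ (-(3 / 2) : ℝ)) := by
          refine mul_le_mul_of_nonneg_right ?_ (by positivity)
          nlinarith
      _ = ((D + C) * (2 : ℝ) ^ (3 / 2 : ℝ)) * (1 + y.2) * nrm y ^ (-(3 / 2) : ℝ) := by ring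
      _ ≤ _ := by gcongr; linarith
  · have e2 : nrm y * nrm y ^ (-(3 / 2) : ℝ) = nrm y ^ (-(1 / 2) : ℝ) := by
      nth_rewrite 1 [← Real.rpow_one (nrm y)]
      rw [← Real.rpow_add hn]
      norm_num
    have h3 : nrm y ≤ 2 * (1 + y.2) := by
      rw [nrm, abs_of_nonneg hy']; linarith
    calc ‖w y‖ ≤ C * (nrm y * nrm y ^ (-(3 / 2) : ℝ)) := by rw [e2]; exact h1 y hy
      _ ≤ C * ((2 * (1 + y.2)) * nrm y ^ (-(3 / 2) : ℝ)) := by gcongr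
      _ = 2 * C * (1 + y.2) * nrm y ^ (-(3 / 2) : ℝ) := by ring
      _ ≤ _ := by gcongr; linarith [show 0 ≤ (D + C) * (2 : ℝ) ^ (3 / 2 : ℝ) by positivity]

lemma RadiatesIn.outgoing_extend {k : ℝ} {D : Set (ℝ × ℝ)} {w : ℤ × ℤ → ℂ} (h : RadiatesIn k D w)
    {B : ℝ} (hB : 0 ≤ B)
    (hΓ : ∀ y : ℤ × ℤ, y.2 = 0 → ‖w y‖ ≤ B * nrm y ^ (-(3 / 2) : ℝ)) :
    Outgoing (farPhase k D) (extend w) := by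
  obtain ⟨C, hC, h⟩ := h.exists_bound
  obtain ⟨K, hK, hb⟩ := exists_decay_boundary (φ := fun y => (farPhase k D y).2) hB hC hΓ
    (fun y hy => (h y hy).1) (fun y hy => (h y hy).2.2)
  have q1 := fun y : ℤ × ℤ => Real.rpow_pos_of_pos (nrm_pos y) (-(1 / 2))
  have q3 := fun y : ℤ × ℤ => Real.rpow_pos_of_pos (nrm_pos y) (-(3 / 2))
  refine ⟨fun y hy => if_neg (by omega), ⟨C, hC, fun y => ?_⟩, ⟨K, hK, fun y => ?_⟩,
    ⟨C, hC, fun y => ?_⟩, ⟨C + B * nrm (0, 1) ^ (3 / 2 : ℝ), ?_, fun y => ?_⟩⟩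
  · unfold extend
    split_ifs with hy
    · exact (h y hy).1
    · rw [norm_zero]; exact mul_nonneg hC (q1 y).le
  · unfold extend
    split_ifs with hy
    · exact hb y hy
    · rw [norm_zero]
      exact mul_nonneg (by positivity) (q3 y).le
  · unfold extend
    have e : (y + (1, 0)).2 = y.2 := by simp
    beta_reduce
    rw [e]
    split_ifs with hy
    · exact (h y hy).2.1
    · rw [mul_zero, sub_zero, norm_zero]; exact mul_nonneg hC (q3 y).le
  · have := Real.rpow_nonneg (nrm_pos (0, 1)).le (3 / 2)
    positivity
  · have hp := Real.rpow_nonneg (nrm_pos (0, 1)).le (3 / 2)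
    have hB' : 0 ≤ B * nrm (0, 1) ^ (3 / 2 : ℝ) * nrm y ^ (-(3 / 2) : ℝ) :=
      mul_nonneg (by positivity) (q3 y).le
    have hC' : 0 ≤ C * nrm y ^ (-(3 / 2) : ℝ) := mul_nonneg hC (q3 y).le
    rw [add_mul]
    unfold extend
    have e : (y + (0, 1)).2 = y.2 + 1 := by simp
    beta_reduce
    rw [e]
    by_cases hy : 0 ≤ y.2
    · rw [if_pos hy, if_pos (by omega)]
      linarith [(h y hy).2.2]
    · rw [if_neg hy, mul_zero, sub_zero]
      split_ifs with hy1
      · have h4 := hΓ (y + (0, 1)) (by rw [e]; omega)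
        have h5 := mul_le_mul_of_nonneg_left (nrm_rpow_add_le (p := 3 / 2) (by norm_num) y (0, 1)) hB
        linarith
      · rw [norm_zero]; linarith

lemma exists_bound_of_finite {u : ℤ × ℤ → ℂ} (hΓ : {y : ℤ × ℤ | y ∈ boundaryPts ∧ u y ≠ 0}.Finite)
    (p : ℝ) : ∃ B : ℝ, 0 ≤ B ∧ ∀ y : ℤ × ℤ, y.2 = 0 → ‖u y‖ ≤ B * nrm y ^ (-p) := by
  have q := fun y : ℤ × ℤ => Real.rpow_pos_of_pos (nrm_pos y) (-p)
  refine ⟨∑ y ∈ hΓ.toFinset, ‖u y‖ / nrm y ^ (-p), Finset.sum_nonneg fun y _ =>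
    div_nonneg (norm_nonneg _) (q y).le, fun y hy => ?_⟩
  by_cases h0 : u y = 0
  · rw [h0, norm_zero]
    exact mul_nonneg (Finset.sum_nonneg fun y _ => div_nonneg (norm_nonneg _) (q y).le) (q y).le
  · rw [← div_le_iff₀ (q y)]
    exact Finset.single_le_sum (f := fun y => ‖u y‖ / nrm y ^ (-p))
      (fun y _ => div_nonneg (norm_nonneg _) (q y).le) (hΓ.mem_toFinset.2 ⟨hy, h0⟩)

lemma exp_I_injOn {s t : ℝ} (hs : |s| < Real.pi) (ht : |t| < Real.pi)
    (h : Complex.exp (Complex.I * s) = Complex.exp (Complex.I * t)) : s = t := by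
  obtain ⟨n, hn⟩ := Complex.exp_eq_exp_iff_exists_int.1 h
  have e : s = t + n * (2 * Real.pi) := by
    have h1 : Complex.I * (s : ℂ) = Complex.I * ((t + n * (2 * Real.pi) : ℝ) : ℂ) := by
      rw [hn]; push_cast; ring
    have := mul_left_cancel₀ Complex.I_ne_zero h1
    exact_mod_cast this
  rw [abs_lt] at hs ht
  have hpi := Real.pi_pos
  have h2 : n = 0 := by
    have a1 : (n : ℝ) < 1 := by
      by_contra! hc
      nlinarith
    have a2 : (-1 : ℝ) < n := by
      by_contra! hc
      nlinarith
    have b1 : n < 1 := by exact_mod_cast a1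
    have b2 : -1 < n := by exact_mod_cast a2
    omega
  rw [e, h2]; simp

/-- For the same direction, the horizontal phase factors of the two components differ: the vertical
ones are determined by them through `sliceRoot`, while the components are disjoint. -/
lemma exp_farPhase_ne {k : ℝ} (hk : Admissible k) {κ κ' : ℝ} (h : WaveComponent k cellLower κ)
    (h' : WaveComponent k cellUpper κ') (y : ℤ × ℤ) :
    Complex.exp (Complex.I * (farPhase k cellLower y).1) ≠
      Complex.exp (Complex.I * (farPhase k cellUpper y).1) := by
  intro heq
  have m1 : farPhase k cellLower y ∈ cellLower := (h.isFarFieldPoint _).1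
  have m2 : farPhase k cellUpper y ∈ cellUpper := (h'.isFarFieldPoint _).1
  have e1 := exp_I_injOn m1.1.1 m2.1.1 heq
  have e2 : Complex.exp (Complex.I * (farPhase k cellLower y).2) =
      Complex.exp (Complex.I * (farPhase k cellUpper y).2) := by
    rw [← exp_eq_sliceRoot hk (h.symbol_farPhase y) (h.gradient_nonneg y),
      ← exp_eq_sliceRoot hk (h'.symbol_farPhase y) (h'.gradient_nonneg y), e1]
  have e3 := exp_I_injOn m1.1.2 m2.1.2 e2
  have l1 := m1.2
  have l2 := m2.2
  linarith

lemma angle_boundary {y : ℤ × ℤ} (hy : y.2 = 0) : angle y = angle (y.1.sign, 0) := by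
  obtain ⟨m, t⟩ := y
  simp only at hy
  subst hy
  rcases lt_trichotomy m 0 with h | h | h
  · have h1 : (m : ℝ) < 0 := by exact_mod_cast h
    simp only [angle, absZ, Int.sign_eq_neg_one_of_neg h]
    simp [Real.sqrt_sq_eq_abs, abs_of_neg h1, h1.ne]
  · subst h; simp
  · have h1 : (0 : ℝ) < m := by exact_mod_cast h
    simp only [angle, absZ, Int.sign_eq_one_of_pos h]
    simp [Real.sqrt_sq_eq_abs, abs_of_pos h1, h1.ne']

/-- If the sum of two functions that radiate with different components has finite support on `Γ`,
then each of them is small on `Γ`, since their horizontal phase factors differ there. -/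
lemma exists_bound_component {k : ℝ} (hk : Admissible k) {κ κ' : ℝ}
    (h : WaveComponent k cellLower κ) (h' : WaveComponent k cellUpper κ') {u u₁ u₂ : ℤ × ℤ → ℂ}
    (hu : ∀ x ∈ halfPlane, u x = u₁ x + u₂ x) (h₁ : RadiatesIn k cellLower u₁)
    (h₂ : RadiatesIn k cellUpper u₂) (hΓ : {y : ℤ × ℤ | y ∈ boundaryPts ∧ u y ≠ 0}.Finite) :
    ∃ B : ℝ, 0 ≤ B ∧ ∀ y : ℤ × ℤ, y.2 = 0 → ‖u₁ y‖ ≤ B * nrm y ^ (-(3 / 2) : ℝ) := by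
  obtain ⟨C₁, hC₁, b₁⟩ := h₁.exists_bound
  obtain ⟨C₂, hC₂, b₂⟩ := h₂.exists_bound
  obtain ⟨B, hB, b⟩ := exists_bound_of_finite hΓ (3 / 2)
  set g : ℤ × ℤ → ℝ := fun y => ‖Complex.exp (Complex.I * (farPhase k cellLower y).1) -
    Complex.exp (Complex.I * (farPhase k cellUpper y).1)‖ with hg
  have hg0 : ∀ y, 0 < g y := fun y => norm_pos_iff.2 (sub_ne_zero.2 (exp_farPhase_ne hk h h' y))
  have hgs : ∀ y : ℤ × ℤ, y.2 = 0 → g y = g (y.1.sign, 0) := by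
    intro y hy
    simp only [hg, farPhase, angle_boundary hy]
  obtain ⟨c, hc, hcle⟩ : ∃ c : ℝ, 0 < c ∧ ∀ y : ℤ × ℤ, y.2 = 0 → c ≤ g y := by
    -- along `Γ` there are only two directions, and the convention at the origin
    refine ⟨min (g (1, 0)) (min (g (-1, 0)) (g (0, 0))), by simp [hg0], fun y hy => ?_⟩
    rw [hgs y hy]
    rcases lt_trichotomy y.1 0 with h | h | h
    · rw [Int.sign_eq_neg_one_of_neg h]
      exact (min_le_right _ _).trans (min_le_left _ _)
    · rw [h, Int.sign_zero]
      exact (min_le_right _ _).trans (min_le_right _ _)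
    · rw [Int.sign_eq_one_of_pos h]
      exact min_le_left _ _
  set P := nrm (1, 0) ^ (3 / 2 : ℝ) with hP
  have hP0 : 0 ≤ P := Real.rpow_nonneg (nrm_pos _).le _
  refine ⟨(C₁ + C₂ + B * P + B) / c, by positivity, fun y hy => ?_⟩
  have hy0 : 0 ≤ y.2 := hy.ge
  have hy1 : (y + (1, 0)).2 = 0 := by simp [hy]
  set E₁ := Complex.exp (Complex.I * (farPhase k cellLower y).1)
  set E₂ := Complex.exp (Complex.I * (farPhase k cellUpper y).1) with hE₂
  have s0 : u y = u₁ y + u₂ y := hu y (mem_halfPlane.2 hy0)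
  have s1 : u (y + (1, 0)) = u₁ (y + (1, 0)) + u₂ (y + (1, 0)) := hu _ (mem_halfPlane.2 hy1.ge)
  -- eliminating `u₂` from the two shift estimates, with `u` known on `Γ`
  have e : (E₁ - E₂) * u₁ y = -(u₁ (y + (1, 0)) - E₁ * u₁ y) - (u₂ (y + (1, 0)) - E₂ * u₂ y) +
      u (y + (1, 0)) - E₂ * u y := by
    rw [s0, s1]; ring
  have n1 := (b₁ y hy0).2.1
  have n2 := (b₂ y hy0).2.1
  have n3 : ‖u (y + (1, 0))‖ ≤ B * P * nrm y ^ (-(3 / 2) : ℝ) := by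
    refine (b _ hy1).trans ?_
    rw [mul_assoc]
    exact mul_le_mul_of_nonneg_left (nrm_rpow_add_le (by norm_num) _ _) hB
  have n4 : ‖E₂ * u y‖ ≤ B * nrm y ^ (-(3 / 2) : ℝ) := by
    rw [norm_mul, hE₂, norm_exp_I_mul, one_mul]
    exact b y hy
  have n5 : ‖(E₁ - E₂) * u₁ y‖ ≤ (C₁ + C₂ + B * P + B) * nrm y ^ (-(3 / 2) : ℝ) := by
    rw [e]
    refine (norm_sub_le _ _).trans ?_
    have a1 := norm_add_le (-(u₁ (y + (1, 0)) - E₁ * u₁ y) - (u₂ (y + (1, 0)) - E₂ * u₂ y))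
      (u (y + (1, 0)))
    have a2 := norm_sub_le (-(u₁ (y + (1, 0)) - E₁ * u₁ y)) (u₂ (y + (1, 0)) - E₂ * u₂ y)
    rw [norm_neg] at a2
    linarith
  rw [norm_mul] at n5
  have n6 : c * ‖u₁ y‖ ≤ ‖E₁ - E₂‖ * ‖u₁ y‖ :=
    mul_le_mul_of_nonneg_right (hcle y hy) (norm_nonneg _)
  rw [div_mul_eq_mul_div, le_div_iff₀ hc]
  linarith

/-! ### Smooth cut-off functions on hexagons -/

/-- First and second differences of a smooth function of compact support. -/
lemma exists_increment_bounds {H : ℝ × ℝ → ℝ} (hH : ContDiff ℝ 2 H) (hc : HasCompactSupport H) :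
    ∃ C : ℝ, 0 ≤ C ∧ (∀ p a, |H (p + a) - H p| ≤ C * ‖a‖) ∧
      ∀ p a b, |(H (p + b + a) - H (p + b)) - (H (p + a) - H p)| ≤ C * ‖a‖ * ‖b‖ := by
  obtain ⟨C₁, h₁⟩ := ContDiff.lipschitzWith_of_hasCompactSupport hc hH (by norm_num)
  have hH' : ContDiff ℝ 1 (fderiv ℝ H) := hH.fderiv_right (by norm_num)
  obtain ⟨C₂, h₂⟩ := ContDiff.lipschitzWith_of_hasCompactSupport (hc.fderiv ℝ) hH' (by norm_num)
  have hd : Differentiable ℝ H := hH.differentiable (by norm_num)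
  refine ⟨C₁ + C₂, by positivity, fun p a => ?_, fun p a b => ?_⟩
  · have := h₁.dist_le_mul (p + a) p
    rw [dist_eq_norm, dist_eq_norm, add_sub_cancel_left, Real.norm_eq_abs] at this
    have h3 : 0 ≤ (C₂ : ℝ) * ‖a‖ := by positivity
    linarith
  · have hg : ∀ q, HasFDerivAt (fun q => H (q + a) - H q) (fderiv ℝ H (q + a) - fderiv ℝ H q) q := by
      intro q
      refine HasFDerivAt.sub ?_ (hd q).hasFDerivAt
      exact hasFDerivAt_comp_add_right a |>.2 (hd (q + a)).hasFDerivAt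
    have hb : ∀ q, ‖fderiv ℝ H (q + a) - fderiv ℝ H q‖ ≤ C₂ * ‖a‖ := by
      intro q
      have := h₂.dist_le_mul (q + a) q
      rwa [dist_eq_norm, dist_eq_norm, add_sub_cancel_left] at this
    have := convex_univ.norm_image_sub_le_of_norm_hasFDerivWithin_le
      (fun q _ => (hg q).hasFDerivWithinAt) (fun q _ => hb q) (Set.mem_univ p)
      (Set.mem_univ (p + b))
    rw [add_sub_cancel_left, Real.norm_eq_abs] at this
    have h3 : 0 ≤ (C₁ : ℝ) * ‖a‖ * ‖b‖ := by positivity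
    linarith

/-- The profile, equal to `1` on `[-1, 1]` and to `0` outside `(-1 - δ, 1 + δ)`. -/
noncomputable def bump {δ : ℝ} (hδ : 0 < δ) : ContDiffBump (0 : ℝ) where
  rIn := 1
  rOut := 1 + δ
  rIn_pos := one_pos
  rIn_lt_rOut := by linarith

/-- A smooth function on the plane that is `1` on the hexagon `|s|, |t|, |s + t| ≤ 1`, and vanishes
off the hexagon enlarged by the factor `1 + δ`. -/
noncomputable def hexBump {δ : ℝ} (hδ : 0 < δ) (p : ℝ × ℝ) : ℝ :=
  bump hδ p.1 * bump hδ p.2 * bump hδ (p.1 + p.2)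

lemma bump_eq_one {δ : ℝ} (hδ : 0 < δ) {s : ℝ} (hs : |s| ≤ 1) : bump hδ s = 1 :=
  (bump hδ).one_of_mem_closedBall (by simpa [bump] using hs)

lemma bump_eq_zero {δ : ℝ} (hδ : 0 < δ) {s : ℝ} (hs : 1 + δ ≤ |s|) : bump hδ s = 0 :=
  (bump hδ).zero_of_le_dist (by simpa [bump] using hs)

lemma hexBump_mem_Icc {δ : ℝ} (hδ : 0 < δ) (p : ℝ × ℝ) : hexBump hδ p ∈ Set.Icc 0 1 := by
  have h1 := fun s => (bump hδ).nonneg' s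
  have h2 := fun s => (bump hδ).le_one (x := s)
  refine ⟨mul_nonneg (mul_nonneg (h1 _) (h1 _)) (h1 _), ?_⟩
  exact mul_le_one₀ (mul_le_one₀ (h2 _) (h1 _) (h2 _)) (h1 _) (h2 _)

lemma contDiff_hexBump {δ : ℝ} (hδ : 0 < δ) : ContDiff ℝ 2 (hexBump hδ) := by
  have h : ContDiff ℝ 2 (bump hδ) := (bump hδ).contDiff
  exact ((h.comp contDiff_fst).mul (h.comp contDiff_snd)).mul
    (h.comp (contDiff_fst.add contDiff_snd))

lemma hasCompactSupport_hexBump {δ : ℝ} (hδ : 0 < δ) : HasCompactSupport (hexBump hδ) := by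
  refine HasCompactSupport.intro (K := Metric.closedBall 0 (1 + δ)) (isCompact_closedBall _ _)
    fun p hp => ?_
  rw [mem_closedBall_zero_iff, not_le, Prod.norm_def, lt_max_iff, Real.norm_eq_abs,
    Real.norm_eq_abs] at hp
  rcases hp with h | h
  · rw [hexBump, bump_eq_zero hδ h.le, zero_mul, zero_mul]
  · rw [hexBump, bump_eq_zero hδ h.le, mul_zero, zero_mul]

/-- The cut-off function at scale `N`. -/
noncomputable def hexCutoff {δ : ℝ} (hδ : 0 < δ) (N : ℕ) (y : ℤ × ℤ) : ℝ :=
  hexBump hδ ((y.1 : ℝ) / N, (y.2 : ℝ) / N)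

lemma hexCutoff_mem_Icc {δ : ℝ} (hδ : 0 < δ) (N : ℕ) (y : ℤ × ℤ) :
    hexCutoff hδ N y ∈ Set.Icc 0 1 := hexBump_mem_Icc hδ _

lemma mem_hexBall {N : ℕ} {y : ℤ × ℤ} :
    y ∈ hexBall N ↔ |y.1| ≤ N ∧ |y.2| ≤ N ∧ |y.1 + y.2| ≤ N := by
  induction N generalizing y with
  | zero =>
    simp only [hexBall, Finset.mem_singleton, abs_le, Prod.ext_iff, Prod.fst_zero, Prod.snd_zero]
    push_cast
    omega
  | succ N ih =>
    simp only [hexBall, Finset.mem_biUnion, Finset.mem_insert, Finset.mem_image, Finset.mem_univ,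
      true_and, ih, abs_le]
    constructor
    · rintro ⟨z, hz, rfl | ⟨j, rfl⟩⟩
      · push_cast; omega
      · obtain ⟨p, q⟩ := z
        fin_cases j <;> simp [dir] at hz ⊢ <;> omega
    · obtain ⟨p, q⟩ := y
      intro h
      push_cast at h
      have step : ∀ j : Fin 6, (let z := (p, q) - dir j
          (-(N : ℤ) ≤ z.1 ∧ z.1 ≤ N) ∧ (-(N : ℤ) ≤ z.2 ∧ z.2 ≤ N) ∧
            -(N : ℤ) ≤ z.1 + z.2 ∧ z.1 + z.2 ≤ N) →
          ∃ a : ℤ × ℤ, ((-(N : ℤ) ≤ a.1 ∧ a.1 ≤ N) ∧ (-(N : ℤ) ≤ a.2 ∧ a.2 ≤ N) ∧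
            -(N : ℤ) ≤ a.1 + a.2 ∧ a.1 + a.2 ≤ N) ∧
            ((p, q) = a ∨ ∃ j : Fin 6, a + dir j = (p, q)) :=
        fun j hj => ⟨(p, q) - dir j, hj, Or.inr ⟨j, by simp⟩⟩
      rcases lt_trichotomy p 0 with hp | hp | hp
      · by_cases hq : 0 < q
        · refine step 5 ?_
          simp [dir]; omega
        · refine step 3 ?_
          simp [dir]; omega
      · rcases lt_trichotomy q 0 with hq | hq | hq
        · refine step 4 ?_
          simp [dir]; omega
        · refine ⟨(p, q), ?_, Or.inl rfl⟩
          simp only; omega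
        · refine step 1 ?_
          simp [dir]; omega
      · by_cases hq : q < 0
        · refine step 2 ?_
          simp [dir]; omega
        · refine step 0 ?_
          simp [dir]; omega

lemma hexCutoff_eq_one {δ : ℝ} (hδ : 0 < δ) {N : ℕ} {y : ℤ × ℤ} (hy : y ∈ hexBall N) :
    hexCutoff hδ N y = 1 := by
  obtain ⟨h1, h2, h3⟩ := mem_hexBall.1 hy
  have hN : (0 : ℝ) ≤ N := Nat.cast_nonneg N
  have key : ∀ s : ℤ, |s| ≤ N → |(s : ℝ) / N| ≤ 1 := by
    intro s hs
    rw [abs_div, abs_of_nonneg hN]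
    refine div_le_one_of_le₀ ?_ hN
    exact_mod_cast hs
  have e : (y.1 : ℝ) / N + (y.2 : ℝ) / N = ((y.1 + y.2 : ℤ) : ℝ) / N := by push_cast; ring
  rw [hexCutoff, hexBump]
  simp only [e]
  rw [bump_eq_one hδ (key _ h1), bump_eq_one hδ (key _ h2), bump_eq_one hδ (key _ h3)]
  norm_num

lemma le_of_hexCutoff_ne_zero {δ : ℝ} (hδ : 0 < δ) {N : ℕ} (hN : 1 ≤ N) {y : ℤ × ℤ}
    (hy : hexCutoff hδ N y ≠ 0) :
    |(y.1 : ℝ)| ≤ (1 + δ) * N ∧ |(y.2 : ℝ)| ≤ (1 + δ) * N ∧ |((y.1 + y.2 : ℤ) : ℝ)| ≤ (1 + δ) * N := by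
  have hN0 : (0 : ℝ) < N := by exact_mod_cast hN
  have e : (y.1 : ℝ) / N + (y.2 : ℝ) / N = ((y.1 + y.2 : ℤ) : ℝ) / N := by push_cast; ring
  have key : ∀ s : ℤ, bump hδ ((s : ℝ) / N) ≠ 0 → |(s : ℝ)| ≤ (1 + δ) * N := by
    intro s hs
    by_contra! h
    refine hs (bump_eq_zero hδ ?_)
    rw [abs_div, abs_of_pos hN0, le_div_iff₀ hN0]
    exact h.le
  rw [hexCutoff, hexBump] at hy
  simp only [e] at hy
  exact ⟨key _ (left_ne_zero_of_mul (left_ne_zero_of_mul hy)),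
    key _ (right_ne_zero_of_mul (left_ne_zero_of_mul hy)), key _ (right_ne_zero_of_mul hy)⟩

lemma le_nrm_of_notMem_hexBall {N : ℕ} {y : ℤ × ℤ} (hy : y ∉ hexBall N) : (N : ℝ) ≤ nrm y := by
  by_contra! h
  refine hy (mem_hexBall.2 ?_)
  have h1 := abs_nonneg (y.1 : ℝ)
  have h2 := abs_nonneg (y.2 : ℝ)
  have h3 := abs_add_le (y.1 : ℝ) y.2
  unfold nrm at h
  refine ⟨?_, ?_, ?_⟩
  · have : |(y.1 : ℝ)| ≤ (N : ℤ) := by push_cast; linarith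
    exact_mod_cast this
  · have : |(y.2 : ℝ)| ≤ (N : ℤ) := by push_cast; linarith
    exact_mod_cast this
  · have : |(y.1 : ℝ) + y.2| ≤ (N : ℤ) := by push_cast; linarith
    exact_mod_cast this

/-- First differences of the cut-off functions are cut-off weights. -/
lemma cutoffWeights_hexCutoff {δ : ℝ} (hδ : 0 < δ) (e : ℤ × ℤ) :
    CutoffWeights (fun N y => ((hexCutoff hδ N (y + e) - hexCutoff hδ N y : ℝ) : ℂ)) := by
  obtain ⟨C, hC, h1, h2⟩ := exists_increment_bounds (contDiff_hexBump hδ)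
    (hasCompactSupport_hexBump hδ)
  set v : ℕ → ℤ × ℤ → ℝ × ℝ := fun N y => ((y.1 : ℝ) / N, (y.2 : ℝ) / N) with hv
  have hadd : ∀ N y a, v N (y + a) = v N y + v N a := by
    intro N y a
    simp only [hv, Prod.mk_add_mk, Prod.fst_add, Prod.snd_add]
    push_cast
    rw [add_div, add_div]
  have hnorm : ∀ (N : ℕ), 1 ≤ N → ∀ a, ‖v N a‖ ≤ nrm a * (N : ℝ) ^ (-1 : ℝ) := by
    intro N hN a
    have hN0 : (0 : ℝ) < N := by exact_mod_cast hN
    have p1 := abs_nonneg (a.1 : ℝ)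
    have p2 := abs_nonneg (a.2 : ℝ)
    rw [Real.rpow_neg_one, ← div_eq_mul_inv, Prod.norm_def]
    simp only [hv, Real.norm_eq_abs, abs_div, abs_of_pos hN0]
    refine max_le (div_le_div_of_nonneg_right ?_ hN0.le) (div_le_div_of_nonneg_right ?_ hN0.le) <;>
      · unfold nrm; linarith
  have ha := one_le_nrm e
  refine ⟨⟨nrm e * (3 + 2 * δ), by nlinarith, fun N hN y hy => ?_⟩,
    ⟨C * nrm e, by positivity, fun N hN y => ?_⟩,
    fun a => ⟨C * nrm e * nrm a, mul_nonneg (by positivity) (nrm_pos a).le, fun N hN y => ?_⟩⟩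
  · have hy' : hexCutoff hδ N (y + e) - hexCutoff hδ N y ≠ 0 := by exact_mod_cast hy
    have hN0 : (1 : ℝ) ≤ N := by exact_mod_cast hN
    have hny := nrm_pos y
    have up : ∀ z, hexCutoff hδ N z ≠ 0 → nrm z ≤ (3 + 2 * δ) * N := by
      intro z hz
      obtain ⟨b1, b2, -⟩ := le_of_hexCutoff_ne_zero hδ hN hz
      unfold nrm
      nlinarith
    constructor
    · have h3 : (N : ℝ) ≤ nrm e * nrm y := by
        by_cases hm : y ∈ hexBall N
        · have hm' : y + e ∉ hexBall N := fun hm' => hy' (by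
            rw [hexCutoff_eq_one hδ hm, hexCutoff_eq_one hδ hm', sub_self])
          exact (le_nrm_of_notMem_hexBall hm').trans (nrm_add_le y e)
        · exact (le_nrm_of_notMem_hexBall hm).trans (by nlinarith)
      calc (N : ℝ) ≤ nrm e * nrm y := h3
        _ ≤ nrm e * (3 + 2 * δ) * nrm y := by gcongr; nlinarith
    · by_cases h0 : hexCutoff hδ N y = 0
      · have h3 := up (y + e) (fun h => hy' (by rw [h, h0, sub_self]))
        calc nrm y ≤ nrm e * nrm (y + e) := nrm_le_add y e
          _ ≤ nrm e * ((3 + 2 * δ) * N) := by gcongr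
          _ = _ := by ring
      · calc nrm y ≤ (3 + 2 * δ) * N := up y h0
          _ ≤ nrm e * ((3 + 2 * δ) * N) := le_mul_of_one_le_left (by positivity) ha
          _ = _ := by ring
  · rw [Complex.norm_real, Real.norm_eq_abs]
    have e1 : hexCutoff hδ N (y + e) = hexBump hδ (v N y + v N e) := by rw [← hadd]; rfl
    have e2 : hexCutoff hδ N y = hexBump hδ (v N y) := rfl
    rw [e1, e2, mul_assoc]
    exact (h1 _ _).trans (mul_le_mul_of_nonneg_left (hnorm N hN e) hC)
  · have hN0 : (0 : ℝ) < N := by exact_mod_cast hN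
    have e1 : hexCutoff hδ N (y + a + e) = hexBump hδ (v N y + v N a + v N e) := by
      rw [← hadd, ← hadd]; rfl
    have e2 : hexCutoff hδ N (y + e) = hexBump hδ (v N y + v N e) := by rw [← hadd]; rfl
    have e3 : hexCutoff hδ N (y + a) = hexBump hδ (v N y + v N a) := by rw [← hadd]; rfl
    have e4 : hexCutoff hδ N y = hexBump hδ (v N y) := rfl
    rw [← Complex.ofReal_sub, Complex.norm_real, Real.norm_eq_abs, e1, e2, e3, e4]
    refine (h2 _ _ _).trans ?_
    have e5 : (N : ℝ) ^ (-2 : ℝ) = (N : ℝ) ^ (-1 : ℝ) * (N : ℝ) ^ (-1 : ℝ) := by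
      rw [← Real.rpow_add hN0]; norm_num
    rw [e5]
    calc C * ‖v N e‖ * ‖v N a‖ ≤ C * (nrm e * (N : ℝ) ^ (-1 : ℝ)) * (nrm a * (N : ℝ) ^ (-1 : ℝ)) := by
          have := hnorm N hN e
          have := hnorm N hN a
          have := nrm_pos e
          gcongr
      _ = _ := by ring

/-- The points between the hexagon of radius `N` and its enlargement by the factor `1 + δ`. -/
noncomputable def hexShell (δ : ℝ) (N : ℕ) : Finset (ℤ × ℤ) :=
  (box (2 * N)).filter fun y => y ∉ hexBall N ∧ |(y.1 : ℝ)| ≤ (1 + δ) * N ∧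
    |(y.2 : ℝ)| ≤ (1 + δ) * N ∧ |((y.1 + y.2 : ℤ) : ℝ)| ≤ (1 + δ) * N

lemma card_hexShell_le {δ : ℝ} (hδ : 0 < δ) {N : ℕ} (hN : 1 ≤ N) :
    ((hexShell δ N).card : ℝ) ≤ 30 * δ * N ^ 2 := by
  have hN0 : (1 : ℝ) ≤ N := by exact_mod_cast hN
  set m : ℤ := ⌊(1 + δ) * N⌋ with hm
  have hm1 : (m : ℝ) ≤ (1 + δ) * N := Int.floor_le _
  have hm2 : (N : ℤ) ≤ m := Int.le_floor.2 (by push_cast; nlinarith)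
  set I : Finset ℤ := Finset.Icc ((N : ℤ) + 1) m ∪ Finset.Icc (-m) (-(N : ℤ) - 1) with hI
  set J : Finset ℤ := Finset.Icc (-((2 * N : ℕ) : ℤ)) ((2 * N : ℕ) : ℤ) with hJ
  have hIcard : (I.card : ℝ) ≤ 2 * (δ * N) := by
    have h1 : I.card ≤ (m - N).toNat + (m - N).toNat := by
      refine (Finset.card_union_le _ _).trans ?_
      rw [Int.card_Icc, Int.card_Icc]
      omega
    have h2 : (((m - N).toNat : ℕ) : ℝ) = m - N := by
      have : (((m - N).toNat : ℕ) : ℤ) = m - N := Int.toNat_of_nonneg (by omega)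
      exact_mod_cast this
    have h3 : (I.card : ℝ) ≤ ((m - N).toNat + (m - N).toNat : ℕ) := by exact_mod_cast h1
    rw [Nat.cast_add, h2] at h3
    linarith
  have hJcard : (J.card : ℝ) ≤ 5 * N := by
    rw [hJ, Int.card_Icc]
    have : (((2 * N : ℕ) : ℤ) + 1 - -((2 * N : ℕ) : ℤ)).toNat = 4 * N + 1 := by omega
    rw [this]; push_cast; linarith
  have hmemI : ∀ s : ℤ, ¬ |s| ≤ N → |(s : ℝ)| ≤ (1 + δ) * N → s ∈ I := by
    intro s h1 h2
    have h3 : |s| ≤ m := Int.le_floor.2 (by push_cast; exact h2)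
    rw [hI, Finset.mem_union, Finset.mem_Icc, Finset.mem_Icc]
    rw [abs_le] at h1 h3
    omega
  -- a point of the shell has one of `y₁`, `y₂`, `y₁ + y₂` in the thin set `I`
  have hsub : hexShell δ N ⊆ I ×ˢ J ∪ J ×ˢ I ∪ (I ×ˢ J).image fun p => (p.1 - p.2, p.2) := by
    intro y hy
    obtain ⟨hb, hnot, b1, b2, b3⟩ := Finset.mem_filter.1 hy
    rw [mem_box, abs_le, abs_le] at hb
    have j1 : y.1 ∈ J := Finset.mem_Icc.2 hb.1
    have j2 : y.2 ∈ J := Finset.mem_Icc.2 hb.2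
    rw [mem_hexBall] at hnot
    by_cases h1 : |y.1| ≤ N
    · by_cases h2 : |y.2| ≤ N
      · have h3 : ¬ |y.1 + y.2| ≤ N := fun h3 => hnot ⟨h1, h2, h3⟩
        refine Finset.mem_union_right _ (Finset.mem_image.2 ⟨(y.1 + y.2, y.2), ?_, ?_⟩)
        · exact Finset.mem_product.2 ⟨hmemI _ h3 b3, j2⟩
        · simp
      · exact Finset.mem_union_left _ (Finset.mem_union_right _
          (Finset.mem_product.2 ⟨j1, hmemI _ h2 b2⟩))
    · exact Finset.mem_union_left _ (Finset.mem_union_left _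
        (Finset.mem_product.2 ⟨hmemI _ h1 b1, j2⟩))
  have hcard : (hexShell δ N).card ≤ I.card * J.card + J.card * I.card + I.card * J.card := by
    refine (Finset.card_le_card hsub).trans ((Finset.card_union_le _ _).trans ?_)
    refine add_le_add ((Finset.card_union_le _ _).trans ?_) (Finset.card_image_le.trans ?_)
    · rw [Finset.card_product, Finset.card_product]
    · rw [Finset.card_product]
  have h1 : ((hexShell δ N).card : ℝ) ≤ 3 * (I.card * J.card) := by
    have : ((hexShell δ N).card : ℝ) ≤ ((I.card * J.card + J.card * I.card + I.card * J.card : ℕ) : ℝ) := by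
      exact_mod_cast hcard
    push_cast at this
    linarith
  have h2 : (I.card : ℝ) * J.card ≤ 2 * (δ * N) * (5 * N) :=
    mul_le_mul hIcard hJcard (by positivity) (by positivity)
  nlinarith

/-! ### Representation of finitely supported functions -/

lemma reflect_sub (x y : ℤ × ℤ) : reflect (x - y) = reflect x - reflect y := by
  ext <;> simp [reflect] <;> ring

lemma reflect_reflect (x : ℤ × ℤ) : reflect (reflect x) = x := by
  ext <;> simp [reflect]

lemma greenPlus_reflect {k : ℝ} (hk : Admissible k) (x y : ℤ × ℤ) :
    greenPlus k x (reflect y) = -greenPlus k x y := by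
  have h1 : green k (x - reflect y) = green k (reflect x - y) := by
    rw [← green_reflect hk, reflect_sub, reflect_reflect]
  have h2 : green k (reflect x - reflect y) = green k (x - y) := by
    rw [← reflect_sub, green_reflect hk]
  rw [greenPlus, greenPlus, h1, h2, neg_sub]

/-- Reflected points carry opposite values, so that the Dirichlet Green's function vanishes on the
boundary row. -/
lemma greenPlus_boundary {k : ℝ} (hk : Admissible k) (x : ℤ × ℤ) {y : ℤ × ℤ} (hy : y.2 = 0) :
    greenPlus k x y = 0 := by
  have h1 : reflect y = y := by ext <;> simp [reflect, hy]
  have h2 := greenPlus_reflect hk x y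
  rw [h1] at h2
  exact self_eq_neg.1 h2

lemma greenPlus_eq {k : ℝ} (hk : Admissible k) (x y : ℤ × ℤ) :
    greenPlus k x y = green k (y + -x) - green k (y + -reflect x) := by
  rw [greenPlus, ← green_neg hk (x - y), ← green_neg hk (reflect x - y)]
  congr 2 <;> abel

lemma linearGrowth_greenPlus {k : ℝ} (hk : Admissible k) (x : ℤ × ℤ) :
    LinearGrowth (greenPlus k x) := by
  have h1 := (linearGrowth_green hk).const_mul_translate 1 (-x)
  have h2 := (linearGrowth_green hk).const_mul_translate (-1) (-reflect x)
  have e : greenPlus k x =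
      (fun y => 1 * green k (y + -x)) + fun y => -1 * green k (y + -reflect x) := by
    ext y
    rw [greenPlus_eq hk, Pi.add_apply]
    ring
  rw [e]
  exact h1.add h2

lemma transpose_shift (m : ℤ × ℤ) : transpose (shift m) = shift (-m) := transpose_single m 1

lemma transpose_helmholtzOp (k : ℝ) : transpose (helmholtzOp k) = helmholtzOp k := by
  simp only [helmholtzOp, opX, opY, opZ, map_sub, map_add, transpose_shift, AlgHom.commutes,
    Prod.neg_mk, neg_zero, neg_neg]
  abel

lemma finsum_green_mul_helmholtz {k : ℝ} (hk : Admissible k) {g : ℤ × ℤ → ℂ}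
    (hg : (Function.support g).Finite) (z : ℤ × ℤ) :
    ∑ᶠ y, green k (y + -z) * helmholtz k g y = g z := by
  have h := finsum_mul_diffAct (helmholtzOp k) (fun y => green k (y + -z)) hg
  simp only [transpose_helmholtzOp, diffAct_helmholtzOp] at h
  rw [h]
  have e : ∀ y, helmholtz k (fun y => green k (y + -z)) y * g y = if y = z then g z else 0 := by
    intro y
    rw [← diffAct_helmholtzOp, diffAct_translate, diffAct_helmholtzOp, helmholtz_green hk]
    by_cases hy : y = z
    · simp [hy]
    · rw [if_neg hy, if_neg (fun h => hy (by rwa [← sub_eq_add_neg, sub_eq_zero] at h)), zero_mul]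
  rw [finsum_congr e, finsum_eq_single _ z (fun y hy => if_neg hy), if_pos rfl]

/-- Green's representation of a finitely supported function that vanishes below the half-plane. -/
lemma finsum_greenPlus_mul_helmholtz {k : ℝ} (hk : Admissible k) {g : ℤ × ℤ → ℂ}
    (hg : (Function.support g).Finite) (h0 : ∀ y : ℤ × ℤ, y.2 < 0 → g y = 0) {x : ℤ × ℤ}
    (hx : 0 < x.2) : ∑ᶠ y, greenPlus k x y * helmholtz k g y = g x := by
  have hL : (Function.support (helmholtz k g)).Finite := by
    rw [← diffAct_helmholtzOp]; exact diffAct_finite_support _ hg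
  have e : ∀ y, greenPlus k x y * helmholtz k g y = green k (y + -x) * helmholtz k g y -
      green k (y + -reflect x) * helmholtz k g y := by
    intro y; rw [greenPlus_eq hk]; ring
  rw [finsum_congr e, finsum_sub_distrib (finite_support_mul _ hL) (finite_support_mul _ hL),
    finsum_green_mul_helmholtz hk hg, finsum_green_mul_helmholtz hk hg, h0 (reflect x), sub_zero]
  simp only [reflect]
  omega

/-- The commutator of the Helmholtz operator with multiplication by a function. -/
lemma helmholtz_mul (k : ℝ) (h v : ℤ × ℤ → ℂ) (y : ℤ × ℤ) :
    helmholtz k (fun z => h z * v z) y = h y * helmholtz k v y +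
      ∑ j : Fin 6, (h (y + dir j) - h y) * v (y + dir j) := by
  simp only [helmholtz, laplacian, sub_mul, Finset.sum_sub_distrib, ← Finset.mul_sum]
  ring

/-! ### Passage to the limit -/

/-- Functions that satisfy the Helmholtz equation up to `O(nrm ^ (-3/2))` and that are not seen by
the Green's function in the transition regions of cut-offs. -/
def Radiating (k : ℝ) (v : ℤ × ℤ → ℂ) : Prop :=
  Decay (3 / 2) (helmholtz k v) ∧ ∀ (z : ℤ × ℤ) (d : ℕ → ℤ × ℤ → ℂ), CutoffWeights d →
    Tendsto (fun N => ∑ᶠ y, green k (y + -z) * (d N y * v y)) atTop (𝓝 0)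

lemma Outgoing.radiating {k : ℝ} (hk : Admissible k) {D : Set (ℝ × ℝ)} {κ : ℝ}
    (h : WaveComponent k D κ) {w : ℤ × ℤ → ℂ} (hw : Outgoing (farPhase k D) w) :
    Radiating k w := by
  obtain ⟨c, hc, hlow⟩ := h.exists_le_reflOp
  refine ⟨?_, fun z d hd => hw.pairing_tendsto ((outgoingKernel_green hk).translate (-z))
    (slowPhase_farPhase h) hd (h.sliceRoot_farPhase hk) hc hlow⟩
  refine (hw.diffAct_mul (slowPhase_farPhase h) (Slow.const 1) (helmholtzOp k)).congr_le
    fun y => le_of_eq ?_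
  rw [opSymbol_helmholtzOp, h.symbol_farPhase, zero_mul, sub_zero, diffAct_helmholtzOp]
  simp only [one_mul]

lemma Radiating.add {k : ℝ} {v w : ℤ × ℤ → ℂ} (hv : Radiating k v) (hw : Radiating k w) :
    Radiating k (fun y => v y + w y) := by
  refine ⟨(hv.1.add hw.1).congr_le fun y => le_of_eq ?_, fun z d hd => ?_⟩
  · congr 1
    simp only [helmholtz, laplacian, Finset.sum_add_distrib]
    ring
  · have := (hv.2 z d hd).add (hw.2 z d hd)
    rw [add_zero] at this
    refine this.congr' ?_
    filter_upwards [eventually_ge_atTop 1] with N hN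
    rw [← finsum_add_distrib (finite_support_mul _ (hd.finite_support hN v))
      (finite_support_mul _ (hd.finite_support hN w))]
    refine finsum_congr fun y => ?_
    ring

/-- The commutator of the Helmholtz operator with the smooth cut-off does not contribute in the
limit. -/
lemma Radiating.tendsto_commutator {k : ℝ} (hk : Admissible k) {v : ℤ × ℤ → ℂ}
    (hv : Radiating k v) {δ : ℝ} (hδ : 0 < δ) (x : ℤ × ℤ) :
    Tendsto (fun N => ∑ᶠ y, greenPlus k x y * ∑ j : Fin 6,
      ((hexCutoff hδ N (y + dir j) - hexCutoff hδ N y : ℝ) : ℂ) * v (y + dir j)) atTop (𝓝 0) := by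
  have hfin : ∀ {N : ℕ}, 1 ≤ N → ∀ e : ℤ × ℤ, (Function.support fun y =>
      ((hexCutoff hδ N (y + e) - hexCutoff hδ N y : ℝ) : ℂ) * v (y + e)).Finite := fun hN e =>
    (cutoffWeights_hexCutoff hδ e).finite_support hN fun y => v (y + e)
  have one : ∀ e z : ℤ × ℤ, Tendsto (fun N => ∑ᶠ y, green k (y + -z) *
      (((hexCutoff hδ N (y + e) - hexCutoff hδ N y : ℝ) : ℂ) * v (y + e))) atTop (𝓝 0) := by
    intro e z
    -- the difference at `y` in direction `e` is, after translation by `e`, minus the one in direction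
    -- `-e`, so that the weight and `v` are taken at the same point
    have h := (hv.2 (z + e) _ (cutoffWeights_hexCutoff hδ (-e))).neg
    rw [neg_zero] at h
    refine h.congr fun N => ?_
    rw [← finsum_comp_equiv (Equiv.addRight e), ← finsum_neg_distrib]
    refine finsum_congr fun y => ?_
    have e1 : y + e + -(z + e) = y + -z := by abel
    rw [Equiv.coe_addRight, e1, add_neg_cancel_right]
    push_cast
    ring
  have two : ∀ e : ℤ × ℤ, Tendsto (fun N => ∑ᶠ y, greenPlus k x y *
      (((hexCutoff hδ N (y + e) - hexCutoff hδ N y : ℝ) : ℂ) * v (y + e))) atTop (𝓝 0) := by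
    intro e
    have h := (one e x).sub (one e (reflect x))
    rw [sub_zero] at h
    refine h.congr' ?_
    filter_upwards [eventually_ge_atTop 1] with N hN
    rw [← finsum_sub_distrib (finite_support_mul _ (hfin hN e)) (finite_support_mul _ (hfin hN e))]
    refine finsum_congr fun y => ?_
    rw [greenPlus_eq hk]
    ring
  have three := tendsto_finsetSum Finset.univ fun (j : Fin 6) _ => two (dir j)
  rw [Finset.sum_const_zero] at three
  refine three.congr' ?_
  filter_upwards [eventually_ge_atTop 1] with N hN
  rw [← finsum_sum_comm _ _ (fun j _ => finite_support_mul _ (hfin hN (dir j)))]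
  refine finsum_congr fun y => ?_
  rw [Finset.mul_sum]

lemma hexCutoff_finite_support {δ : ℝ} (hδ : 0 < δ) {N : ℕ} (hN : 1 ≤ N) (v : ℤ × ℤ → ℂ) :
    (Function.support fun y => (hexCutoff hδ N y : ℂ) * v y).Finite := by
  refine (box (⌈3 + 2 * δ⌉₊ * N)).finite_toSet.subset fun y hy => mem_box_of_nrm_le ?_
  have h0 : hexCutoff hδ N y ≠ 0 := by
    have := left_ne_zero_of_mul hy
    exact_mod_cast this
  obtain ⟨b1, b2, -⟩ := le_of_hexCutoff_ne_zero hδ hN h0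
  have hN0 : (1 : ℝ) ≤ N := by exact_mod_cast hN
  unfold nrm
  nlinarith

/-- Replacing the smooth cut-off by the sharp one costs `O(√δ)`, uniformly in `N`. -/
lemma norm_sum_shell_le {F f : ℤ × ℤ → ℂ} (hF : LinearGrowth F) (hf : Decay (3 / 2) f) :
    ∃ K : ℝ, 0 ≤ K ∧ ∀ (δ : ℝ) (hδ : 0 < δ), δ ≤ 1 → ∀ N : ℕ, 1 ≤ N →
      ‖∑ᶠ y, F y * ((hexCutoff hδ N y : ℂ) * f y) - ∑ y ∈ hexBall N, F y * f y‖ ^ 2 ≤ K * δ := by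
  obtain ⟨C, hC, hF⟩ := hF
  obtain ⟨D, hD, hf⟩ := hf
  refine ⟨90 * C * D ^ 2, by positivity, fun δ hδ hδ1 N hN => ?_⟩
  have hN0 : (1 : ℝ) ≤ N := by exact_mod_cast hN
  have hfin : (Function.support fun y => F y * ((hexCutoff hδ N y : ℂ) * f y)).Finite :=
    finite_support_mul _ (hexCutoff_finite_support hδ hN f)
  have hball : ∑ y ∈ hexBall N, F y * f y = ∑ᶠ y, if y ∈ hexBall N then F y * f y else 0 := by
    rw [finsum_eq_sum_of_support_subset (s := hexBall N)]
    · exact Finset.sum_congr rfl fun y hy => (if_pos hy).symm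
    · intro y hy
      by_contra h
      exact hy (if_neg h)
  have hballfin : (Function.support fun y => if y ∈ hexBall N then F y * f y else 0).Finite :=
    (hexBall N).finite_toSet.subset fun y hy => by
      by_contra h
      exact hy (if_neg h)
  have hout : ∀ y, F y * ((hexCutoff hδ N y : ℂ) * f y) -
      (if y ∈ hexBall N then F y * f y else 0) =
      if y ∈ hexBall N then 0 else F y * ((hexCutoff hδ N y : ℂ) * f y) := by
    intro y
    split_ifs with h
    · rw [hexCutoff_eq_one hδ h]; simp
    · rw [sub_zero]
  have hsub : (Function.support fun y => if y ∈ hexBall N then 0 else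
      F y * ((hexCutoff hδ N y : ℂ) * f y)) ⊆ hexShell δ N := by
    intro y hy
    rw [Function.mem_support] at hy
    by_cases hm : y ∈ hexBall N
    · exact absurd (if_pos hm) hy
    · rw [if_neg hm] at hy
      have h0 : hexCutoff hδ N y ≠ 0 := by
        have := left_ne_zero_of_mul (right_ne_zero_of_mul hy)
        exact_mod_cast this
      obtain ⟨b1, b2, b3⟩ := le_of_hexCutoff_ne_zero hδ hN h0
      refine Finset.mem_coe.2 (Finset.mem_filter.2 ⟨mem_box.2 ⟨?_, ?_⟩, hm, b1, b2, b3⟩)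
      · have : |(y.1 : ℝ)| ≤ ((2 * N : ℕ) : ℤ) := by push_cast; nlinarith
        exact_mod_cast this
      · have : |(y.2 : ℝ)| ≤ ((2 * N : ℕ) : ℤ) := by push_cast; nlinarith
        exact_mod_cast this
  rw [hball, ← finsum_sub_distrib hfin hballfin, finsum_congr hout,
    finsum_eq_sum_of_support_subset _ hsub]
  have h1 : ‖∑ y ∈ hexShell δ N, if y ∈ hexBall N then 0 else
      F y * ((hexCutoff hδ N y : ℂ) * f y)‖ ≤ ∑ y ∈ hexShell δ N, ‖F y‖ * ‖f y‖ := by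
    refine (norm_sum_le _ _).trans (Finset.sum_le_sum fun y hy => ?_)
    have hc := hexCutoff_mem_Icc hδ N y
    rw [if_neg (Finset.mem_filter.1 hy).2.1, norm_mul, norm_mul, Complex.norm_real, Real.norm_eq_abs,
      abs_of_nonneg hc.1]
    exact mul_le_mul_of_nonneg_left (mul_le_of_le_one_left (norm_nonneg _) hc.2) (norm_nonneg _)
  have h2 := Finset.sum_mul_sq_le_sq_mul_sq (hexShell δ N) (fun y => ‖F y‖) (fun y => ‖f y‖)
  have h3 : ∑ y ∈ hexShell δ N, ‖F y‖ ^ 2 ≤ C * (3 * N) := by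
    refine (Finset.sum_le_sum_of_subset_of_nonneg (Finset.filter_subset _ _)
      fun _ _ _ => by positivity).trans ((hF (2 * N)).trans ?_)
    push_cast
    gcongr
    linarith
  have h4 : ((N : ℝ) ^ (-(3 / 2) : ℝ)) ^ 2 = ((N : ℝ) ^ 3)⁻¹ := by
    rw [← Real.rpow_natCast, ← Real.rpow_mul (by positivity)]
    norm_num
  have h5 : ∑ y ∈ hexShell δ N, ‖f y‖ ^ 2 ≤ (30 * δ * N ^ 2) * (D ^ 2 * ((N : ℝ) ^ 3)⁻¹) := by
    refine le_trans ?_ (mul_le_mul_of_nonneg_right (card_hexShell_le hδ hN) (by positivity))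
    rw [← nsmul_eq_mul]
    refine Finset.sum_le_card_nsmul _ _ _ fun y hy => ?_
    have h6 := le_nrm_of_notMem_hexBall (Finset.mem_filter.1 hy).2.1
    have h7 : ‖f y‖ ≤ D * (N : ℝ) ^ (-(3 / 2) : ℝ) := (hf y).trans
      (mul_le_mul_of_nonneg_left (Real.rpow_le_rpow_of_nonpos (by linarith) h6 (by norm_num)) hD)
    rw [← h4, ← mul_pow]
    exact pow_le_pow_left₀ (norm_nonneg _) h7 2
  calc _ ≤ (∑ y ∈ hexShell δ N, ‖F y‖ * ‖f y‖) ^ 2 := pow_le_pow_left₀ (norm_nonneg _) h1 2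
    _ ≤ _ := h2
    _ ≤ (C * (3 * N)) * ((30 * δ * N ^ 2) * (D ^ 2 * ((N : ℝ) ^ 3)⁻¹)) :=
        mul_le_mul h3 h5 (Finset.sum_nonneg fun _ _ => by positivity) (by positivity)
    _ = 90 * C * D ^ 2 * δ := by
        have : (N : ℝ) ≠ 0 := by positivity
        field_simp
        ring

/-- Green's representation of a radiating function that vanishes below the half-plane, with the
source `β` on the lower rows. The width `δ` of the smooth cut-off is fixed first, then `N` tends to
infinity. -/
lemma Radiating.tendsto_sum {k : ℝ} (hk : Admissible k) {v : ℤ × ℤ → ℂ} (hv : Radiating k v)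
    (h0 : ∀ y : ℤ × ℤ, y.2 < 0 → v y = 0) {β : ℤ × ℤ → ℂ} (hβ : (Function.support β).Finite)
    (hβv : ∀ y : ℤ × ℤ, y.2 < 0 → helmholtz k v y = β y) (hβ0 : ∀ y : ℤ × ℤ, 0 < y.2 → β y = 0)
    {x : ℤ × ℤ} (hx : 0 < x.2) :
    Tendsto (fun N : ℕ => ∑ y ∈ (hexBall N).filter (fun y => 0 < y.2),
      greenPlus k x y * helmholtz k v y) atTop (𝓝 (v x - ∑ᶠ y, greenPlus k x y * β y)) := by
  set f : ℤ × ℤ → ℂ := fun y => if 0 < y.2 then helmholtz k v y else 0 with hf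
  have hfd : Decay (3 / 2) f := hv.1.congr_le fun y => by
    simp only [hf]
    split_ifs
    · exact le_rfl
    · simp
  obtain ⟨K, hK, hshell⟩ := norm_sum_shell_le (linearGrowth_greenPlus hk x) hfd
  have hS : ∀ N : ℕ, ∑ y ∈ (hexBall N).filter (fun y => 0 < y.2),
      greenPlus k x y * helmholtz k v y = ∑ y ∈ hexBall N, greenPlus k x y * f y := by
    intro N
    rw [Finset.sum_filter]
    refine Finset.sum_congr rfl fun y _ => ?_
    simp only [hf]
    split_ifs <;> simp
  simp only [hS]
  -- every finite set lies in the hexagons from some size on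
  have hin : ∀ y : ℤ × ℤ, ∀ᶠ N : ℕ in atTop, y ∈ hexBall N := by
    intro y
    filter_upwards [eventually_gt_atTop ⌈nrm y⌉₊] with N hN
    by_contra hc
    have h1 := Nat.le_ceil (nrm y)
    have h2 : ((⌈nrm y⌉₊ : ℕ) : ℝ) + 1 ≤ N := by exact_mod_cast hN
    have h3 := le_nrm_of_notMem_hexBall (N := ⌈nrm y⌉₊ + 1) (y := y) (fun h => hc (by
      rw [mem_hexBall] at h ⊢
      push_cast at h ⊢
      omega))
    push_cast at h3
    linarith
  have hinβ : ∀ᶠ N : ℕ in atTop, ∀ y ∈ hβ.toFinset, y ∈ hexBall N :=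
    (Filter.eventually_all_finset _).2 fun y _ => hin y
  rw [Metric.tendsto_nhds]
  intro ε hε
  set δ : ℝ := min 1 (ε ^ 2 / (8 * (K + 1))) with hδd
  have hδ : 0 < δ := lt_min one_pos (by positivity)
  have hδ1 : δ ≤ 1 := min_le_left _ _
  have hKδ : K * δ < (ε / 2) ^ 2 := by
    have h1 : δ ≤ ε ^ 2 / (8 * (K + 1)) := min_le_right _ _
    have h2 : K * δ ≤ K * (ε ^ 2 / (8 * (K + 1))) := mul_le_mul_of_nonneg_left h1 hK
    have h3 : K * (ε ^ 2 / (8 * (K + 1))) ≤ ε ^ 2 / 8 := by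
      rw [mul_div_assoc', div_le_div_iff₀ (by positivity) (by norm_num)]
      nlinarith [sq_nonneg ε]
    nlinarith [sq_pos_of_pos hε]
  have hcomm := (Metric.tendsto_nhds.1 (hv.tendsto_commutator hk hδ x)) (ε / 2) (by positivity)
  filter_upwards [hcomm, hin x, hinβ, eventually_ge_atTop 1] with N h1 h2 h3 hN
  have hcut := hexCutoff_finite_support hδ hN v
  have hrep := finsum_greenPlus_mul_helmholtz hk hcut (fun y hy => by rw [h0 y hy, mul_zero]) hx
  rw [hexCutoff_eq_one hδ h2, Complex.ofReal_one, one_mul] at hrep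
  have hsum : (Function.support fun y => ∑ j : Fin 6,
      ((hexCutoff hδ N (y + dir j) - hexCutoff hδ N y : ℝ) : ℂ) * v (y + dir j)).Finite := by
    refine (Set.finite_iUnion fun j : Fin 6 => (cutoffWeights_hexCutoff hδ (dir j)).finite_support hN
      fun y => v (y + dir j)).subset fun y hy => ?_
    obtain ⟨j, -, hj⟩ := Finset.exists_ne_zero_of_sum_ne_zero hy
    exact Set.mem_iUnion.2 ⟨j, hj⟩
  -- the representation of the cut-off function, with the product rule for the Helmholtz operator;
  -- `greenPlus` vanishes on the boundary row
  have hsplit : v x = ∑ᶠ y, greenPlus k x y * β y +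
      ∑ᶠ y, greenPlus k x y * ((hexCutoff hδ N y : ℂ) * f y) +
      ∑ᶠ y, greenPlus k x y * ∑ j : Fin 6,
        ((hexCutoff hδ N (y + dir j) - hexCutoff hδ N y : ℝ) : ℂ) * v (y + dir j) := by
    rw [← hrep, ← finsum_add_distrib (finite_support_mul _ hβ)
      (finite_support_mul _ (hexCutoff_finite_support hδ hN f)), ← finsum_add_distrib ?_
      (finite_support_mul _ hsum)]
    · refine finsum_congr fun y => ?_
      rw [helmholtz_mul k (fun z => (hexCutoff hδ N z : ℂ)) v y, mul_add]
      have e : greenPlus k x y * ((hexCutoff hδ N y : ℂ) * helmholtz k v y) =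
          greenPlus k x y * β y + greenPlus k x y * ((hexCutoff hδ N y : ℂ) * f y) := by
        rcases lt_trichotomy y.2 0 with hy | hy | hy
        · have hfy : f y = 0 := if_neg (by omega)
          rw [hfy, mul_zero, mul_zero, add_zero, hβv y hy]
          by_cases hb : β y = 0
          · rw [hb]; simp
          · rw [hexCutoff_eq_one hδ (h3 y (hβ.mem_toFinset.2 hb)), Complex.ofReal_one, one_mul]
        · rw [greenPlus_boundary hk x hy]; simp
        · have hfy : f y = helmholtz k v y := if_pos hy
          rw [hfy, hβ0 y hy, mul_zero, zero_add]
      rw [e]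
      push_cast
      rfl
    · refine ((finite_support_mul (greenPlus k x) hβ).union (finite_support_mul (greenPlus k x)
        (hexCutoff_finite_support hδ hN f))).subset ?_
      exact Function.support_add _ _
  have hb := hshell δ hδ hδ1 N hN
  have hb' : ‖∑ᶠ y, greenPlus k x y * ((hexCutoff hδ N y : ℂ) * f y) -
      ∑ y ∈ hexBall N, greenPlus k x y * f y‖ < ε / 2 :=
    lt_of_pow_lt_pow_left₀ 2 (by positivity) (hb.trans_lt hKδ)
  rw [dist_zero_right] at h1
  rw [dist_comm, dist_eq_norm]
  have e : v x - ∑ᶠ y, greenPlus k x y * β y - ∑ y ∈ hexBall N, greenPlus k x y * f y =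
      (∑ᶠ y, greenPlus k x y * ((hexCutoff hδ N y : ℂ) * f y) -
        ∑ y ∈ hexBall N, greenPlus k x y * f y) +
      ∑ᶠ y, greenPlus k x y * ∑ j : Fin 6,
        ((hexCutoff hδ N (y + dir j) - hexCutoff hδ N y : ℝ) : ℂ) * v (y + dir j) := by
    rw [hsplit]; ring
  rw [e]
  exact (norm_add_le _ _).trans_lt (by linarith)

/-! ### The boundary sum -/

lemma helmholtz_extend {k : ℝ} {u : ℤ × ℤ → ℂ} {y : ℤ × ℤ} (hy : 0 < y.2) :
    helmholtz k (extend u) y = helmholtz k u y := by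
  have h : ∀ j : Fin 6, extend u (y + dir j) = u (y + dir j) := by
    intro j
    refine if_pos ?_
    fin_cases j <;> simp [dir] <;> omega
  have h' : extend u y = u y := if_pos hy.le
  simp only [helmholtz, laplacian, h, h']

/-- The values on `Γ`, extended by zero. -/
noncomputable def trace (u : ℤ × ℤ → ℂ) (y : ℤ × ℤ) : ℂ := if y.2 = 0 then u y else 0

lemma trace_finite_support {u : ℤ × ℤ → ℂ}
    (hΓ : {y : ℤ × ℤ | y ∈ boundaryPts ∧ u y ≠ 0}.Finite) :
    (Function.support (trace u)).Finite := by
  refine hΓ.subset fun y hy => ?_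
  by_cases h : y.2 = 0
  · exact ⟨h, fun h0 => hy (by rw [trace, if_pos h, h0])⟩
  · exact absurd (if_neg h) hy

/-- The sum of the two shifts that lead from the row below `Γ` to `Γ`. -/
noncomputable def sideOp : DiffOp := shift (0, 1) + shift (-1, 1)

lemma diffAct_sideOp_trace (u : ℤ × ℤ → ℂ) (y : ℤ × ℤ) :
    diffAct sideOp (trace u) y = if y.2 = -1 then u (y + (0, 1)) + u (y + (-1, 1)) else 0 := by
  simp only [sideOp, map_add, LinearMap.add_apply, Pi.add_apply, diffAct_shift, trace,
    Prod.snd_add]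
  by_cases h : y.2 = -1
  · rw [if_pos h, if_pos (by omega), if_pos (by omega)]
  · rw [if_neg h, if_neg (by omega), if_neg (by omega), add_zero]

/-- Below `Γ` the extension by zero has sources only on the adjacent row. -/
lemma helmholtz_extend_below {k : ℝ} {u : ℤ × ℤ → ℂ} {y : ℤ × ℤ} (hy : y.2 < 0) :
    helmholtz k (extend u) y = diffAct sideOp (trace u) y := by
  rw [diffAct_sideOp_trace]
  obtain ⟨m, t⟩ := y
  simp only at hy ⊢
  have h0 : ¬ 0 ≤ t := by omega
  have h1 : ¬ 0 ≤ t + -1 := by omega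
  by_cases h : t = -1
  · subst h
    simp [helmholtz, laplacian, Fin.sum_univ_six, dir, extend]
  · have h2 : ¬ 0 ≤ t + 1 := by omega
    simp [helmholtz, laplacian, Fin.sum_univ_six, dir, extend, h0, h1, h2, h]

lemma sides_of_mem_boundary {y : ℤ × ℤ} (hy : y.2 = 0) : sides y = {2, 4} := by
  ext j
  simp only [sides, Finset.mem_filter, Finset.mem_univ, true_and, Prod.snd_sub, hy]
  fin_cases j <;> simp [dir]

/-- On `Γ` the normal derivatives of the Dirichlet Green's function are, by reflection, its values on
the row below. -/
lemma sum_sides {k : ℝ} (hk : Admissible k) (u : ℤ × ℤ → ℂ) (x : ℤ × ℤ) {y : ℤ × ℤ}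
    (hy : y.2 = 0) : ∑ j ∈ sides y, u y * normalDeriv j (greenPlus k x) y =
      diffAct (transpose sideOp) (greenPlus k x) y * trace u y := by
  have hr1 : greenPlus k x (y - dir 2) = -greenPlus k x (y + (0, -1)) := by
    rw [← greenPlus_reflect hk]
    congr 1
    ext <;> simp [reflect, dir, hy, sub_eq_add_neg]
  have hr2 : greenPlus k x (y - dir 4) = -greenPlus k x (y + (1, -1)) := by
    rw [← greenPlus_reflect hk]
    congr 1
    ext <;> simp [reflect, dir, hy]
  rw [sides_of_mem_boundary hy, Finset.sum_pair (by decide)]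
  simp only [normalDeriv, greenPlus_boundary hk x hy, hr1, hr2, sideOp, map_add, transpose_shift,
    LinearMap.add_apply, Pi.add_apply, diffAct_shift, trace, if_pos hy, Prod.neg_mk, neg_zero,
    neg_neg]
  ring

lemma transpose_transpose (a : DiffOp) : transpose (transpose a) = a := by
  induction a using diffOp_induction with
  | single m c => rw [transpose_single, transpose_single, neg_neg]
  | add a b ha hb => rw [map_add, map_add, ha, hb]

/-- The source of the extension by zero on the row below `Γ` produces the boundary sum. -/
lemma hasSum_boundary {k : ℝ} (hk : Admissible k) {u : ℤ × ℤ → ℂ}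
    (hΓ : {y : ℤ × ℤ | y ∈ boundaryPts ∧ u y ≠ 0}.Finite) (x : ℤ × ℤ) :
    HasSum (fun y : boundaryPts => ∑ j ∈ sides y, u y * normalDeriv j (greenPlus k x) y)
      (∑ᶠ y, greenPlus k x y * diffAct sideOp (trace u) y) := by
  have h1 := finsum_mul_diffAct (transpose sideOp) (greenPlus k x) (trace_finite_support hΓ)
  rw [transpose_transpose] at h1
  rw [h1]
  have hfin := finite_support_mul (diffAct (transpose sideOp) (greenPlus k x))
    (trace_finite_support hΓ)
  have h2 : HasSum (fun y => diffAct (transpose sideOp) (greenPlus k x) y * trace u y)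
      (∑ᶠ y, diffAct (transpose sideOp) (greenPlus k x) y * trace u y) := by
    rw [← tsum_eq_finsum (L := SummationFilter.unconditional _) hfin]
    exact (summable_of_hasFiniteSupport hfin).hasSum
  have h3 : Function.support (fun y => diffAct (transpose sideOp) (greenPlus k x) y * trace u y) ⊆
      boundaryPts := by
    intro y hy
    by_contra h
    exact right_ne_zero_of_mul hy (if_neg h)
  have h4 : HasSum ((fun y => diffAct (transpose sideOp) (greenPlus k x) y * trace u y) ∘
      ((↑) : boundaryPts → ℤ × ℤ)) _ := (hasSum_subtype_iff_of_support_subset h3).2 h2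
  convert h4 using 1
  ext y
  exact sum_sides hk u x y.2

/-! ### The radiation condition for the extension -/

lemma radiating_extend {k : ℝ} (hk : Admissible k) {u : ℤ × ℤ → ℂ} (hu : RadiationCondition k u)
    (hΓ : {y : ℤ × ℤ | y ∈ boundaryPts ∧ u y ≠ 0}.Finite) : Radiating k (extend u) := by
  obtain ⟨hk0, hk9, hk8⟩ := hk
  have hk : Admissible k := ⟨hk0, hk9, hk8⟩
  obtain ⟨B, hB, hb⟩ := exists_bound_of_finite hΓ (3 / 2)
  rcases lt_or_gt_of_ne hk8 with h8 | h8
  · have hW : WaveComponent k cell 0 := ⟨hk0, Or.inl ⟨h8, rfl, rfl⟩⟩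
    exact ((hu.1 h8).outgoing_extend hB hb).radiating hk hW
  · have hL : WaveComponent k cellLower (-Real.pi) := ⟨hk0, Or.inr ⟨h8, hk9, Or.inl ⟨rfl, rfl⟩⟩⟩
    have hU : WaveComponent k cellUpper Real.pi := ⟨hk0, Or.inr ⟨h8, hk9, Or.inr ⟨rfl, rfl⟩⟩⟩
    obtain ⟨u₁, u₂, hsum, h₁, h₂⟩ := hu.2 h8
    obtain ⟨B₁, hB₁, hb₁⟩ := exists_bound_component hk hL hU hsum h₁ h₂ hΓ
    have hb₂ : ∀ y : ℤ × ℤ, y.2 = 0 → ‖u₂ y‖ ≤ (B + B₁) * nrm y ^ (-(3 / 2) : ℝ) := by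
      intro y hy
      have e : u₂ y = u y - u₁ y := by rw [hsum y (mem_halfPlane.2 hy.ge)]; ring
      rw [e, add_mul]
      exact (norm_sub_le _ _).trans (add_le_add (hb y hy) (hb₁ y hy))
    have h := ((h₁.outgoing_extend hB₁ hb₁).radiating hk hL).add
      ((h₂.outgoing_extend (add_nonneg hB hB₁) hb₂).radiating hk hU)
    convert h using 1
    ext y
    unfold extend
    split_ifs with hy
    · exact hsum y (mem_halfPlane.2 hy)
    · simp

lemma admissible_of_mem {k : ℝ} (hk : k ∈ Set.Ioo (0 : ℝ) 3) (hk8 : k ≠ 2 * Real.sqrt 2) :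
    Admissible k := by
  obtain ⟨h0, h3⟩ := hk
  refine ⟨by positivity, by nlinarith, fun h => hk8 ?_⟩
  have h2 : (2 * Real.sqrt 2) ^ 2 = 8 := by
    rw [mul_pow, Real.sq_sqrt (by norm_num)]; norm_num
  rw [← h2] at h
  exact (pow_left_inj₀ h0.le (by positivity) (by norm_num)).1 h

end TriLattice

open TriLattice
theorem mainTheorem1 (k : ℝ) (hk : k ∈ Set.Ioo (0 : ℝ) 3) (hk8 : k ≠ 2 * Real.sqrt 2)
    (u : ℤ × ℤ → ℂ) (hu : RadiationCondition k u)
    (hΓ : {y : ℤ × ℤ | y ∈ boundaryPts ∧ u y ≠ 0}.Finite) :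
    (∀ z : ℤ × ℤ, Tendsto (fun ε : ℝ => resolventKernel k ε z) (𝓝[>] 0) (𝓝 (green k z))) ∧
    (∀ x ∈ interiorPts, ∃ B S : ℂ,
      HasSum (fun y : boundaryPts => ∑ j ∈ sides y,
        (u y * normalDeriv j (greenPlus k x) y - greenPlus k x y * normalDeriv j u y)) B ∧
      Tendsto (fun N : ℕ => ∑ y ∈ (hexBall N).filter (fun y => 0 < y.2),
        greenPlus k x y * helmholtz k u y) atTop (𝓝 S) ∧
      u x = B + S) ∧
    ((∀ y ∈ interiorPts, helmholtz k u y = 0) →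
      ∀ x ∈ interiorPts,
        HasSum (fun y : boundaryPts => ∑ j ∈ sides y,
          u y * normalDeriv j (greenPlus k x) y) (u x)) := by
  have hA := admissible_of_mem hk hk8
  have hlim : ∀ x ∈ interiorPts, Tendsto (fun N : ℕ => ∑ y ∈ (hexBall N).filter (fun y => 0 < y.2),
      greenPlus k x y * helmholtz k u y) atTop
      (𝓝 (u x - ∑ᶠ y, greenPlus k x y * diffAct sideOp (trace u) y)) := by
    intro x hx
    have h := (radiating_extend hA hu hΓ).tendsto_sum hA (fun y hy => if_neg (by omega))
      (diffAct_finite_support sideOp (trace_finite_support hΓ))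
      (fun y hy => helmholtz_extend_below hy)
      (fun y hy => by rw [diffAct_sideOp_trace, if_neg (by omega)]) hx
    have e : extend u x = u x := if_pos (le_of_lt hx)
    rw [e] at h
    refine h.congr fun N => Finset.sum_congr rfl fun y hy => ?_
    rw [helmholtz_extend (Finset.mem_filter.1 hy).2]
  refine ⟨tendsto_resolventKernel hA, fun x hx => ⟨∑ᶠ y, greenPlus k x y *
    diffAct sideOp (trace u) y, _, ?_, hlim x hx, ?_⟩, fun hu0 x hx => ?_⟩
  · convert hasSum_boundary hA hΓ x using 1
    ext y
    refine Finset.sum_congr rfl fun j _ => ?_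
    rw [greenPlus_boundary hA x y.2, zero_mul, sub_zero]
  · ring
  · have h0 : Tendsto (fun N : ℕ => ∑ y ∈ (hexBall N).filter (fun y => 0 < y.2),
        greenPlus k x y * helmholtz k u y) atTop (𝓝 0) := by
      refine tendsto_const_nhds.congr fun N => ?_
      refine (Finset.sum_eq_zero fun y hy => ?_).symm
      rw [hu0 y (Finset.mem_filter.1 hy).2, mul_zero]
    have h := tendsto_nhds_unique h0 (hlim x hx)
    rw [sub_eq_zero.1 h.symm]
    exact hasSum_boundary hA hΓ x
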